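/- Partitions are weakly decreasing sequences $\lambda=(\lambda_1\ge\lambda_2\ge\cdots)$ of non-negative integers with finite sum $|\lambda|$; $\ell(\lambda)$ is the number of nonzero parts, addition is componentwise, $(s^r)$ is the partition with $r$ parts equal to $s$, and $\mu\le\lambda$ means $|\mu|=|\lambda|$ and $\mu_1+\cdots+\mu_k\le\lambda_1+\cdots+\lambda_k$ for all $k$. For a field $K$ of characteristic $0$ let $\Lambda_{n,K}$ be the ring of symmetric polynomials in $x_1,\dots,x_n$ and $\Lambda_K$ the ring of symmetric functions (the graded projective limit of the $\Lambda_{n,K}$ under $x_{n+1}\mapsto 0$), with monomial symmetric functions $m_\lambda$ and power sums $p_\lambda=p_{\lambda_1}p_{\lambda_2}\cdots$. For $q,t\in K$ that are either two independent indeterminates (with $K=\mathbb Q(q,t)$) or real numbers in $(0,1)$ (with $K=\mathbb R$), let $\langle\,,\rangle_{q,t}$ be the bilinear form on $\Lambda_K$ with $$\langle p_\lambda,p_\mu\rangle_{q,t}=\delta_{\lambda\mu}\prod_{r\ge1}r^{m_r}m_r!\prod_{i=1}^{\ell(\lambda)}\frac{1-q^{\lambda_i}}{1-t^{\lambda_i}},\qquad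 m_r=\#\{i:\lambda_i=r\}.$$ The Macdonald symmetric functions $P_\lambda=P_\lambda(x;q,t)\in\Lambda_K$ are the unique family with (A) $P_\lambda\in m_\lambda+\sum_{\mu<\lambda}K\,m_\mu$ and (B) $\langle P_\lambda,P_\mu\rangle_{q,t}=0$ for $\lambda\ne\mu$; $P_\lambda(x_1,\dots,x_n;q,t)$ is the image of $P_\lambda$ in $\Lambda_{n,K}$. For integers $r,s\ge0$ let $\mathcal G_s:\Lambda_{r,K}\to\Lambda_{r,K}$, $(\mathcal G_sf)(x)=\prod_{i=1}^r x_i^s\cdot f(x)$. For real $0<q,t<1$ put $(a;q)_\infty=\prod_{k\ge0}(1-aq^k)$, $$\Pi(x,y)=\prod_{i,j}\frac{(tx_iy_j;q)_\infty}{(x_iy_j;q)_\infty},\qquad \Delta(y)=\prod_{i\ne j}\frac{(y_i/y_j;q)_\infty}{(ty_i/y_j;q)_\infty},$$ and, with all integrals over the torus $|y_j|=1$ and $\overline y=(1/y_1,\dots,1/y_m)$, $$\langle f,g\rangle'_{m;q,t}=\frac1{m!}\oint\prod_{j=1}^m\frac{dy_j}{2\pi i y_j}\,f(\overline y)g(y)\Delta(y),\qquad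 (\mathcal N_{n,m}f)(x)=\oint\prod_{j=1}^m\frac{dy_j}{2\pi iy_j}\,\Pi(x,\overline y)\Delta(y)f(y)$$ for $f,g\in\Lambda_{m,\mathbb R}$, where $0\le m<\infty$, $0\le n\le\infty$ and $x=(x_1,\dots,x_n)$ is a point with $|x_i|<1$ for all $i$ and, if $n=\infty$, $\sum_i|x_i|<\infty$. **Proposition 3.1.** (i) For all $r,s\ge0$ and every partition $\lambda$, both for indeterminates $q,t$ and for real $q,t\in(0,1)$, $$P_{(s^r)+\lambda}(x_1,\dots,x_r;q,t)=\mathcal G_sP_\lambda(x_1,\dots,x_r;q,t).$$ (ii) For all real $q,t\in(0,1)$, all $0\le m<\infty$, all $0\le n\le\infty$ and every partition $\lambda$ with $\ell(\lambda)\le m$, $$P_\lambda(x_1,\dots,x_n;q,t)=\frac{\langle P_\lambda,P_\lambda\rangle_{q,t}}{m!\,\langle P_\lambda,P_\lambda\rangle'_{m;q,t}}\;\mathcal N_{n,m}P_\lambda(x_1,\dots,x_m;q,t)$$ at all points $x$ as above, where for $n=\infty$ the left side is $\lim_{k\to\infty}P_\lambda(x_1,\dots,x_k;q,t)$. -/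

import Mathlib

open scoped BigOperators

noncomputable section

namespace MacSym

/-! ### Partitions -/

/-- A partition `l = (l₁ ≥ l₂ ≥ ⋯)`: a weakly decreasing, finitely supported sequence of
natural numbers (with indices shifted so that they start at `0`). -/
@[ext]
structure Ptn where
  row : ℕ →₀ ℕ
  anti : Antitone row

namespace Ptn

/-- The weight `|l| = ∑ lᵢ`. -/
def weight (l : Ptn) : ℕ := ∑ i ∈ l.row.support, l.row i

/-- The length `ℓ(l)`, the number of nonzero parts. -/
def length (l : Ptn) : ℕ := l.row.support.card

/-- The multiset of the (nonzero) parts. -/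
def parts (l : Ptn) : Multiset ℕ := l.row.support.val.map l.row

/-- The partition as an object of Mathlib's type of partitions of the number `|l|`. -/
def toNat (l : Ptn) : Nat.Partition l.parts.sum := Nat.Partition.ofMultiset l.parts

/-- Rowwise addition of partitions. -/
instance : Add Ptn := ⟨fun l k => ⟨l.row + k.row, l.anti.add k.anti⟩⟩

/-- The rectangle `(s^r)`: `r` rows equal to `s`. -/
def rect (s r : ℕ) : Ptn where
  row := Finsupp.onFinset (Finset.range r) (fun i => if i < r then s else 0) (by
    intro i h
    by_contra hi
    exact h (if_neg (by simpa using hi)))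
  anti := by
    intro i j hij
    simp only [Finsupp.onFinset_apply]
    split_ifs <;> omega

/-- The natural (dominance) partial order: `k.DomLE l` means `k ≤ l`. -/
def DomLE (k l : Ptn) : Prop :=
  k.weight = l.weight ∧
    ∀ r : ℕ, ∑ i ∈ Finset.range r, k.row i ≤ ∑ i ∈ Finset.range r, l.row i

/-- The strict natural order: `k.DomLT l` means `k < l`. -/
def DomLT (k l : Ptn) : Prop := k.DomLE l ∧ k ≠ l

end Ptn

/-! ### Symmetric functions -/

section Sym

variable (K : Type*) [Field K]

/-- `Λ_{n,K}`: symmetric polynomials in `n` variables. -/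
abbrev SymPoly (n : ℕ) : Type _ := MvPolynomial.symmetricSubalgebra (Fin n) K

/-- The substitution `f(x₁,…,xₙ,xₙ₊₁) ↦ f(x₁,…,xₙ,0)`. -/
def killLast (n : ℕ) : MvPolynomial (Fin (n + 1)) K →ₐ[K] MvPolynomial (Fin n) K :=
  MvPolynomial.aeval (Fin.snoc (α := fun _ => MvPolynomial (Fin n) K) MvPolynomial.X 0)

/-- The ring `Λ_K` of symmetric functions: the (graded) projective limit of the rings `Λ_{n,K}`
along the maps `killLast`, that is, compatible sequences of symmetric polynomials of bounded
degree. -/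
def SymFun : Subalgebra K (∀ n : ℕ, MvPolynomial (Fin n) K) where
  carrier := {f | (∀ n, (f n).IsSymmetric) ∧ (∀ n, killLast K n (f (n + 1)) = f n) ∧
    ∃ d : ℕ, ∀ n, (f n).totalDegree ≤ d}
  mul_mem' := by
    rintro f g ⟨hf, hf', d, hd⟩ ⟨hg, hg', e, he⟩
    refine ⟨fun n => (hf n).mul (hg n), fun n => ?_, d + e, fun n => ?_⟩
    · simp [hf', hg']
    · exact (MvPolynomial.totalDegree_mul _ _).trans (add_le_add (hd n) (he n))
  add_mem' := by
    rintro f g ⟨hf, hf', d, hd⟩ ⟨hg, hg', e, he⟩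
    refine ⟨fun n => (hf n).add (hg n), fun n => ?_, max d e, fun n => ?_⟩
    · simp [hf', hg']
    · exact (MvPolynomial.totalDegree_add _ _).trans (max_le_max (hd n) (he n))
  algebraMap_mem' := by
    intro c
    refine ⟨fun n => MvPolynomial.IsSymmetric.C c, fun n => ?_, 0, fun n => ?_⟩
    · simp only [Pi.algebraMap_apply, AlgHom.commutes]
    · simp only [Pi.algebraMap_apply, MvPolynomial.algebraMap_eq, MvPolynomial.totalDegree_C,
        le_refl]

variable {K}

/-- `f(x₁,…,xₙ)`, the image of a symmetric function in `Λ_{n,K}`. -/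
def inVars (f : SymFun K) (n : ℕ) : SymPoly K n := ⟨f.1 n, f.2.1 n⟩

theorem psum_mem (r : ℕ) (hr : 0 < r) :
    (fun n => MvPolynomial.psum (Fin n) K r) ∈ SymFun K := by
  refine ⟨fun n => MvPolynomial.psum_isSymmetric _ _ _, fun n => ?_, r, fun n => ?_⟩
  · simp [killLast, MvPolynomial.psum, Fin.sum_univ_castSucc, hr.ne']
  · refine MvPolynomial.totalDegree_finsetSum_le fun i _ => ?_
    rw [MvPolynomial.totalDegree_X_pow]

/-- The `r`-th power sum `p_r ∈ Λ_K`, for `r ≥ 1` (and, by convention, `1` for `r = 0`). -/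
def powerSum (K : Type*) [Field K] (r : ℕ) : SymFun K :=
  if hr : 0 < r then ⟨fun n => MvPolynomial.psum (Fin n) K r, psum_mem r hr⟩ else 1

/-- `p_l = p_{l₁} p_{l₂} ⋯ ∈ Λ_K`. -/
def powerSumPtn (K : Type*) [Field K] (l : Ptn) : SymFun K :=
  (l.parts.map (powerSum K)).prod

/-- The monomial symmetric function `m_l` in `n` variables. -/
def mono (K : Type*) [Field K] (l : Ptn) (n : ℕ) : MvPolynomial (Fin n) K :=
  MvPolynomial.msymm (Fin n) K l.toNat

/-- `z_l(q,t) = ∏_r r^{m_r} m_r! ⋅ ∏_i (1 - q^{lᵢ}) / (1 - t^{lᵢ})`. -/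
def zqt (q t : K) (l : Ptn) : K :=
  (∏ r ∈ l.parts.toFinset, (r : K) ^ l.parts.count r * ((l.parts.count r).factorial : K)) *
    ∏ i ∈ l.row.support, (1 - q ^ l.row i) / (1 - t ^ l.row i)

/-- The coefficients `a_l` in the expansion `f = ∑ a_l p_l` of a symmetric function in the power
sums. (In characteristic zero the `p_l` form a basis of `Λ_K`, so they exist and are unique.) -/
def powerSumCoeff (f : SymFun K) : Ptn →₀ K :=
  Function.invFun (Finsupp.linearCombination K (powerSumPtn K)) f

/-- The scalar product on `Λ_K` with `⟨p_l, p_k⟩_{q,t} = δ_{l,k} z_l(q,t)`. -/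
def formqt (q t : K) (f g : SymFun K) : K :=
  (powerSumCoeff f).sum fun l a => zqt q t l * a * powerSumCoeff g l

/-- The two conditions that characterize the family of Macdonald symmetric functions:
(A) `P_l = m_l + ∑_{k < l} u_{lk} m_k`, and (B) `⟨P_l, P_k⟩_{q,t} = 0` for `l ≠ k`. -/
def IsMacdonald (q t : K) (P : Ptn → SymFun K) : Prop :=
  (∀ l : Ptn, ∃ u : Ptn →₀ K, (∀ k ∈ u.support, k.DomLT l) ∧
    ∀ n : ℕ, ((P l).1 n) =
      mono K l n + u.sum fun k c => MvPolynomial.C c * mono K k n) ∧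
  ∀ l k : Ptn, l ≠ k → formqt q t (P l) (P k) = 0

/-- The Macdonald symmetric functions `P_l(x;q,t) ∈ Λ_K` with parameters `q, t ∈ K`: the family
with the properties (A) and (B). (There is exactly one such family when `q`, `t` are independent
indeterminates, and also when they are real numbers in `(0,1)`.) -/
def macP (q t : K) : Ptn → SymFun K := Classical.epsilon (IsMacdonald q t)

/-- `𝒢_s : Λ_{r,K} → Λ_{r,K}`, multiplication by `∏ xᵢ^s`. -/
def mapG (s r : ℕ) (f : SymPoly K r) : SymPoly K r :=
  ⟨∏ i, MvPolynomial.X i ^ s, fun e => by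
    rw [map_prod]
    simp only [map_pow, MvPolynomial.rename_X]
    exact Equiv.prod_comp e fun i => (MvPolynomial.X i : MvPolynomial (Fin r) K) ^ s⟩ * f

end Sym

/-- The field `ℚ(q,t)` of rational functions in two independent indeterminates. -/
abbrev Qqt : Type := FractionRing (MvPolynomial (Fin 2) ℚ)

/-- The indeterminate `q`. -/
def indq : Qqt := algebraMap (MvPolynomial (Fin 2) ℚ) Qqt (MvPolynomial.X 0)

/-- The indeterminate `t`. -/
def indt : Qqt := algebraMap (MvPolynomial (Fin 2) ℚ) Qqt (MvPolynomial.X 1)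

/-! ### Kernels and integrals, for real parameters `q`, `t` in `(0,1)` -/

/-- `(a;q)_∞ = ∏_{k ≥ 0} (1 - a q^k)`. -/
def qPoch (a q : ℂ) : ℂ := ∏' k : ℕ, (1 - a * q ^ k)

/-- `Δ(y;q,t) = ∏_{i ≠ j} (yᵢ/yⱼ;q)_∞ / (t yᵢ/yⱼ;q)_∞`. -/
def kerDelta (q t : ℝ) {m : ℕ} (y : Fin m → ℂ) : ℂ :=
  ∏ i, ∏ j ∈ Finset.univ.erase i, qPoch (y i / y j) q / qPoch (t * (y i / y j)) q

/-- `Π(x,y;q,t) = ∏_{i,j} (t xᵢ yⱼ;q)_∞ / (xᵢ yⱼ;q)_∞`; the family of variables `x` may be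
finite (`ι = Fin n`) or infinite (`ι = ℕ`). -/
def kerPi (q t : ℝ) {ι : Type} {m : ℕ} (x : ι → ℂ) (y : Fin m → ℂ) : ℂ :=
  ∏' i, ∏ j, qPoch (t * (x i * y j)) q / qPoch (x i * y j) q

/-- The normalized integral `∮ ∏_j dy_j / (2πi y_j) ⋅ F(y)` over the torus `|y_j| = 1`. -/
def torusMean {m : ℕ} (F : (Fin m → ℂ) → ℂ) : ℂ :=
  torusIntegral (fun y => (∏ j, (2 * (Real.pi : ℂ) * Complex.I * y j)⁻¹) * F y)
    (0 : Fin m → ℂ) (fun _ => (1 : ℝ))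

/-- The value `f(y)` of a real symmetric polynomial at a complex point. -/
def evalC {n : ℕ} (f : SymPoly ℝ n) (y : Fin n → ℂ) : ℂ :=
  MvPolynomial.aeval y (f : MvPolynomial (Fin n) ℝ)

/-- `⟨f,g⟩'_{n;q,t} = (1/n!) ∮ ∏_j dx_j / (2πi x_j) ⋅ f(1/x) g(x) Δ(x;q,t)`. -/
def formTorus (q t : ℝ) {n : ℕ} (f g : SymPoly ℝ n) : ℂ :=
  ((n.factorial : ℂ))⁻¹ *
    torusMean fun x => evalC f (fun j => (x j)⁻¹) * evalC g x * kerDelta q t x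

/-- `(𝒩_{n,m} f)(x) = ∮ ∏_j dy_j / (2πi y_j) ⋅ Π(x,1/y;q,t) Δ(y;q,t) f(y)` as a function of the
variables `x = (xᵢ)_{i ∈ ι}`; `ι = Fin n` for finite `n` and `ι = ℕ` for `n = ∞`. -/
def mapN (q t : ℝ) {ι : Type} {m : ℕ} (f : SymPoly ℝ m) (x : ι → ℂ) : ℂ :=
  torusMean fun y => kerPi q t x (fun j => (y j)⁻¹) * kerDelta q t y * evalC f y

/-- The constant `⟨P_l,P_l⟩_{q,t} / (m! ⟨P_l,P_l⟩'_{m;q,t})`. -/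
def coefN (q t : ℝ) (m : ℕ) (l : Ptn) : ℂ :=
  (formqt q t (macP q t l) (macP q t l) : ℂ) /
    ((m.factorial : ℂ) * formTorus q t (inVars (macP q t l) m) (inVars (macP q t l) m))

end MacSym

end

/-! Symmetric functions are handled as polynomials in the power sums: `X r` in `MvPolynomial ℕ R`
stands for p_{r+1}, and `ev` evaluates in n variables. Everything rests on one linear operator E =
`macOp` on this ring, with ρ = 1/q. In n variables it acts as t^n + (1-t) ∑_i ∏_{j≠i} (x_i - t
x_j)/(x_i - x_j) T_i, where T_i replaces x_i by x_i/q (`vand_mul_ev_macOp`). Leading terms show that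
E is triangular on the m_l for dominance, with diagonal entries e_l = `eig q⁻¹ t l`
(`macOp_monoFun_mem`, `macOp_monoFun_sub_mem`). It is self-adjoint for ⟨,⟩_{q,t} (`pform_macOp`).

If e_k ≠ e_l for all k < l, the functions ∏_{k<l} (E - e_k)/(e_l - e_k) m_l form a triangular family
of eigenfunctions (`macFun`), and eigenfunctions with different eigenvalues are orthogonal. For
indeterminates all e_l are distinct (`eig_ind_injective`). For real parameters comparable partitions
have different eigenvalues (`eig_lt_eig`), but this says nothing about incomparable ones. As
polynomials in t the eigenvalues are distinct, so orthogonality holds at all nearby values of t and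
passes to t by continuity (`eq_zero_of_eig_ne`). Uniqueness of orthogonal triangular families then
identifies `macFun` with P_l (`macP_ind`, `macP_real`).

For (i), multiplication by ∏ x_i^s in r variables multiplies each T_i by q^{-s}, so it takes the
eigenfunction P_l to an eigenfunction with eigenvalue e_{(s^r)+l} and leading term m_{(s^r)+l}. Its
difference from P_{(s^r)+l} lies in the span of lower m_k, where that eigenvalue does not occur, so
it is zero (`ev_macFun_rect_add`).

For (ii), E is also self-adjoint for the torus scalar product: moving the contour |y_i| = 1 to |y_i|
= q turns the contribution of T_i to ⟨F, E G⟩ into its contribution to ⟨E F, G⟩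
(`torusMean_shiftIntegrand`, `tform_macOp`). Hence the P_l are orthogonal for both scalar products,
and F ↦ ⟨F, P_l⟩' is a multiple of F ↦ ⟨F, P_l⟩_{q,t} (`tform_mul_pform`). Apply this to the
homogeneous pieces of the Cauchy kernel Π(x, ·), which reproduces every symmetric function under
⟨,⟩_{q,t} (`hasSum_pform_expFun`, `hasSum_kerPi`). Summation gives P_l(x) on one side and the
integral on the other (`coefN_mul_mapN`). The norm on the torus is nonzero because Δ ≥ 0 there and
P_l survives in m ≥ ℓ(l) variables. -/

noncomputable section

/-! ### Combinatorics: exponent vectors, partitions, dominance. -/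

namespace MacSym

open MvPolynomial

/-! ### Shapes of exponent vectors -/

/-- The multiset of nonzero values of an exponent vector. -/
def shape {σ : Type*} (e : σ →₀ ℕ) : Multiset ℕ := e.support.val.map e

theorem Ptn.parts_eq_shape (l : Ptn) : l.parts = shape l.row := rfl

theorem shape_pos {σ : Type*} (e : σ →₀ ℕ) : ∀ x ∈ shape e, 0 < x := by
  intro x hx
  obtain ⟨i, hi, rfl⟩ := Multiset.mem_map.1 hx
  exact Nat.pos_of_ne_zero (Finsupp.mem_support_iff.1 hi)

theorem card_shape {σ : Type*} (e : σ →₀ ℕ) : (shape e).card = e.support.card := by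
  simp [shape]

theorem sum_shape {σ : Type*} (e : σ →₀ ℕ) : (shape e).sum = ∑ i ∈ e.support, e i := rfl

theorem shape_mapDomain {σ τ : Type*} {f : σ → τ} (hf : Function.Injective f) (e : σ →₀ ℕ) :
    shape (e.mapDomain f) = shape e := by
  classical
  rw [shape, Finsupp.mapDomain_support_of_injective hf, Finset.image_val_of_injOn hf.injOn,
    Multiset.map_map, shape]
  refine Multiset.map_congr rfl fun i _ => ?_
  simp [Finsupp.mapDomain_apply hf]

theorem count_shape {σ : Type*} [Fintype σ] (e : σ →₀ ℕ) {v : ℕ} (hv : v ≠ 0) :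
    (shape e).count v = Fintype.card {i // e i = v} := by
  classical
  rw [shape, Multiset.count_map, Fintype.card_subtype]
  change Multiset.card (e.support.filter (fun a => v = e a)).val = _
  rw [Finset.card_val]
  congr 1
  ext i
  simp only [Finset.mem_filter, Finsupp.mem_support_iff, Finset.mem_univ, true_and]
  constructor
  · exact fun h => h.2.symm
  · intro h
    exact ⟨h ▸ hv, h.symm⟩

/-- The fibres of the two vectors over each value have the same size. For a nonzero value the shape
counts it; zeros are not recorded and are counted by complement, which uses that σ is finite.
Bijections of the fibres glue to the permutation. -/
theorem exists_perm_of_shape_eq {σ : Type*} [Fintype σ] {e e' : σ →₀ ℕ}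
    (h : shape e = shape e') : ∃ p : Equiv.Perm σ, e'.mapDomain p = e := by
  classical
  have hc : ∀ v, Fintype.card {i // e' i = v} = Fintype.card {i // e i = v} := by
    intro v
    rcases eq_or_ne v 0 with rfl | hv
    · have h1 : ∀ e : σ →₀ ℕ, Fintype.card {i // e i = 0} =
          Fintype.card σ - (shape e).card := by
        intro e
        rw [card_shape, Fintype.card_subtype, ← Finset.card_compl]
        congr 1
        ext i
        simp
      rw [h1, h1, h]
    · rw [← count_shape e' hv, ← count_shape e hv, h]
  let p : Equiv.Perm σ := Equiv.ofFiberEquiv (f := e') (g := e)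
    fun c => Fintype.equivOfCardEq (hc c)
  refine ⟨p, ?_⟩
  ext i
  obtain ⟨j, rfl⟩ := p.surjective i
  rw [Finsupp.mapDomain_apply p.injective]
  exact (Equiv.ofFiberEquiv_map (f := e') (g := e) _ j).symm

theorem _root_.MvPolynomial.IsSymmetric.coeff_eq_of_shape_eq {σ R : Type*} [Fintype σ]
    [CommRing R] {f : MvPolynomial σ R} (hf : f.IsSymmetric) {e e' : σ →₀ ℕ}
    (h : shape e = shape e') : coeff e f = coeff e' f := by
  obtain ⟨p, rfl⟩ := exists_perm_of_shape_eq h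
  conv_lhs => rw [← hf p]
  exact coeff_rename_mapDomain _ p.injective _ _

theorem shape_toFinsupp {σ : Type*} [DecidableEq σ] (s : Multiset σ) :
    shape (Multiset.toFinsupp s) = s.dedup.map s.count := by
  rw [shape, Multiset.toFinsupp_support]
  exact Multiset.map_congr rfl fun i _ => Multiset.toFinsupp_apply s i

theorem prod_map_X_eq_monomial {σ : Type*} [DecidableEq σ] (R : Type*) [CommRing R]
    (s : Multiset σ) :
    (s.map (X : σ → MvPolynomial σ R)).prod = monomial (Multiset.toFinsupp s) 1 := by
  induction s using Multiset.induction_on with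
  | empty => simp
  | cons a s ih =>
    rw [Multiset.map_cons, Multiset.prod_cons, ih, ← Multiset.singleton_add, map_add,
      Multiset.toFinsupp_singleton, X, monomial_mul, one_mul]

/-- Each exponent vector is the multiplicity vector of exactly one multiset of variables, so no
monomial occurs twice in `msymm`. -/
theorem coeff_msymm {σ : Type*} [Fintype σ] [DecidableEq σ] (R : Type*) [CommRing R] {n : ℕ}
    (μ : n.Partition) (e : σ →₀ ℕ) :
    coeff e (msymm σ R μ) = if shape e = μ.parts then 1 else 0 := by
  have hterm : ∀ s : {a : Sym σ n // Nat.Partition.ofSym a = μ},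
      coeff e ((s.1.1.map (X : σ → MvPolynomial σ R)).prod) =
        if Multiset.toFinsupp s.1.1 = e then 1 else 0 := by
    intro s
    rw [prod_map_X_eq_monomial, coeff_monomial]
  rw [msymm, coeff_sum, Finset.sum_congr rfl fun s _ => hterm s]
  split_ifs with h
  · have hcard : (Finsupp.toMultiset e).card = n := by
      rw [Finsupp.card_toMultiset, ← μ.parts_sum, ← h]
      rfl
    have hs : Nat.Partition.ofSym (⟨Finsupp.toMultiset e, hcard⟩ : Sym σ n) = μ := by
      ext1
      rw [← h]
      change (Finsupp.toMultiset e).dedup.map (Finsupp.toMultiset e).count = _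
      rw [← shape_toFinsupp, Finsupp.toMultiset_toFinsupp]
    rw [Finset.sum_eq_single ⟨⟨Finsupp.toMultiset e, hcard⟩, hs⟩]
    · rw [if_pos (Finsupp.toMultiset_toFinsupp e)]
    · intro s _ hne
      rw [if_neg]
      rintro rfl
      apply hne
      ext1
      ext1
      simp
    · simp
  · refine Finset.sum_eq_zero fun s _ => if_neg ?_
    rintro rfl
    apply h
    rw [shape_toFinsupp]
    exact congrArg Nat.Partition.parts s.2

/-! ### Partitions and their parts -/

namespace Ptn

/-- Since rows decrease, the rows exceeding v form an initial segment, whose length is a column of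
the diagram. The columns depend on the parts only, so the parts determine the rows. -/
theorem lt_countP_iff (l : Ptn) (v i : ℕ) :
    i < (l.parts.countP fun x => v < x) ↔ v < l.row i := by
  classical
  have h1 : (l.parts.countP fun x => v < x) = (l.row.support.filter fun j => v < l.row j).card := by
    rw [parts, Multiset.countP_map]
    rfl
  rw [h1]
  set S := l.row.support.filter fun j => v < l.row j with hS
  have hmem : ∀ j, j ∈ S ↔ v < l.row j := by
    intro j
    simp only [hS, Finset.mem_filter, Finsupp.mem_support_iff]
    omega
  have hdown : ∀ j ∈ S, ∀ k ≤ j, k ∈ S := by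
    intro j hj k hk
    rw [hmem] at *
    exact lt_of_lt_of_le hj (l.anti hk)
  rw [← hmem]
  constructor
  · intro hi
    by_contra hni
    have : S ⊆ Finset.range i := by
      intro j hj
      rw [Finset.mem_range]
      by_contra hji
      exact hni (hdown j hj i (not_lt.1 hji))
    have := Finset.card_le_card this
    simp at this
    omega
  · intro hi
    have : Finset.range (i + 1) ⊆ S := by
      intro j hj
      exact hdown i hi j (by simpa [Nat.lt_succ_iff] using hj)
    have := Finset.card_le_card this
    simp at this
    omega

theorem parts_injective : Function.Injective parts := by
  intro l k h
  ext i
  refine le_antisymm (not_lt.1 fun hlt => ?_) (not_lt.1 fun hlt => ?_)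
  · rw [← lt_countP_iff, h, lt_countP_iff] at hlt
    exact lt_irrefl _ hlt
  · rw [← lt_countP_iff, ← h, lt_countP_iff] at hlt
    exact lt_irrefl _ hlt

theorem parts_pos (l : Ptn) : ∀ x ∈ l.parts, 0 < x := shape_pos l.row

theorem card_parts (l : Ptn) : l.parts.card = l.length := card_shape l.row

theorem sum_parts (l : Ptn) : l.parts.sum = l.weight := rfl

theorem toNat_parts (l : Ptn) : l.toNat.parts = l.parts := by
  change l.parts.filter (· ≠ 0) = l.parts
  exact Multiset.filter_eq_self.2 fun x hx => (l.parts_pos x hx).ne'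

theorem row_ne_zero_iff (l : Ptn) (i : ℕ) : l.row i ≠ 0 ↔ i < l.length := by
  rw [← Nat.pos_iff_ne_zero, ← lt_countP_iff, ← card_parts,
    Multiset.countP_eq_card.2 (fun x hx => l.parts_pos x hx)]

theorem row_eq_zero (l : Ptn) {i : ℕ} (hi : l.length ≤ i) : l.row i = 0 := by
  by_contra h
  exact absurd ((l.row_ne_zero_iff i).1 h) (not_lt.2 hi)

theorem support_row (l : Ptn) : l.row.support = Finset.range l.length := by
  ext i
  simp [row_ne_zero_iff]

theorem sum_range_row (l : Ptn) {n : ℕ} (hn : l.length ≤ n) :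
    ∑ i ∈ Finset.range n, l.row i = l.weight := by
  rw [weight, support_row]
  refine (Finset.sum_subset (Finset.range_mono hn) fun i _ hi => ?_).symm
  exact l.row_eq_zero (by simpa using hi)

theorem exists_parts_eq (s : Multiset ℕ) (hs : ∀ x ∈ s, 0 < x) : ∃ l : Ptn, l.parts = s := by
  classical
  set L := s.sort (· ≥ ·) with hL
  have hLs : (L : Multiset ℕ) = s := Multiset.sort_eq _ _
  have hsorted : L.Pairwise (· ≥ ·) := Multiset.pairwise_sort _ _
  have hpos : ∀ i (h : i < L.length), 0 < L[i] := by
    intro i h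
    apply hs
    rw [← hLs]
    exact List.getElem_mem h
  let row : ℕ →₀ ℕ := Finsupp.onFinset (Finset.range L.length) (fun i => L.getD i 0) (by
    intro i hi
    rw [Finset.mem_range]
    by_contra h
    exact hi (List.getD_eq_default _ _ (not_lt.1 h)))
  have hrow : ∀ i, row i = L.getD i 0 := fun i => rfl
  have hanti : Antitone row := by
    intro i j hij
    rw [hrow, hrow]
    rcases lt_or_ge j L.length with hj | hj
    · rw [List.getD_eq_getElem _ _ hj, List.getD_eq_getElem _ _ (lt_of_le_of_lt hij hj)]
      rcases eq_or_lt_of_le hij with rfl | hlt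
      · exact le_rfl
      · exact List.pairwise_iff_getElem.1 hsorted i j _ _ hlt
    · rw [List.getD_eq_default _ _ hj]
      exact Nat.zero_le _
  refine ⟨⟨row, hanti⟩, ?_⟩
  have hsupp : row.support = Finset.range L.length := by
    ext i
    rw [Finsupp.mem_support_iff, hrow, Finset.mem_range]
    constructor
    · intro h
      by_contra h'
      exact h (List.getD_eq_default _ _ (not_lt.1 h'))
    · intro h
      rw [List.getD_eq_getElem _ _ h]
      exact (hpos i h).ne'
  change row.support.val.map row = s
  rw [hsupp, ← hLs]
  change (Multiset.range L.length).map row = L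
  rw [← Multiset.coe_range, Multiset.map_coe, Multiset.coe_eq_coe]
  refine List.Perm.of_eq (List.ext_getElem (by simp) ?_)
  intro i h1 h2
  simp [hrow, List.getElem?_eq_getElem h2]

/-- The exponent vector `x₁^{l₁} ⋯ xₙ^{lₙ}`. -/
def expo (l : Ptn) (n : ℕ) : Fin n →₀ ℕ := Finsupp.equivFunOnFinite.symm fun i => l.row i

@[simp] theorem expo_apply (l : Ptn) (n : ℕ) (i : Fin n) : l.expo n i = l.row i := rfl

theorem shape_expo (l : Ptn) {n : ℕ} (hn : l.length ≤ n) : shape (l.expo n) = l.parts := by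
  rw [parts_eq_shape, ← shape_mapDomain Fin.val_injective (l.expo n)]
  congr 1
  ext i
  by_cases hi : i < n
  · have := Finsupp.mapDomain_apply (Fin.val_injective (n := n)) (l.expo n) ⟨i, hi⟩
    simpa using this
  · rw [Finsupp.mapDomain_of_notMem_range, l.row_eq_zero (by omega)]
    rintro ⟨j, rfl⟩
    exact hi j.2

theorem length_le_of_shape_eq {n : ℕ} {e : Fin n →₀ ℕ} {l : Ptn} (h : shape e = l.parts) :
    l.length ≤ n := by
  rw [← card_parts, ← h, card_shape]
  simpa using Finset.card_le_univ e.support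

theorem finite_weight_le (d : ℕ) : {l : Ptn | l.weight ≤ d}.Finite := by
  have h : (⋃ m ∈ Finset.range (d + 1), {l : Ptn | l.weight = m}).Finite := by
    refine Set.Finite.biUnion (Finset.finite_toSet _) fun m _ => ?_
    have : Set.InjOn (fun l : Ptn => l.parts) {l : Ptn | l.weight = m} :=
      parts_injective.injOn
    refine Set.Finite.of_finite_image ?_ this
    refine (Set.finite_range fun p : Nat.Partition m => p.parts).subset ?_
    rintro _ ⟨l, hl, rfl⟩
    exact ⟨⟨l.parts, fun {x} hx => l.parts_pos x hx, hl⟩, rfl⟩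
  refine h.subset fun l hl => ?_
  simp only [Set.mem_iUnion, Finset.mem_range, Set.mem_ofPred_eq]
  exact ⟨l.weight, Nat.lt_succ_of_le hl, rfl⟩

theorem DomLE.refl (l : Ptn) : l.DomLE l := ⟨rfl, fun _ => le_rfl⟩

theorem DomLE.trans {k l m : Ptn} (h : k.DomLE l) (h' : l.DomLE m) : k.DomLE m :=
  ⟨h.1.trans h'.1, fun r => (h.2 r).trans (h'.2 r)⟩

theorem DomLE.antisymm {k l : Ptn} (h : k.DomLE l) (h' : l.DomLE k) : k = l := by
  have hs : ∀ r, ∑ i ∈ Finset.range r, k.row i = ∑ i ∈ Finset.range r, l.row i :=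
    fun r => le_antisymm (h.2 r) (h'.2 r)
  ext i
  have h1 := hs (i + 1)
  rw [Finset.sum_range_succ, Finset.sum_range_succ, hs i] at h1
  omega

theorem DomLT.trans_le {k l m : Ptn} (h : k.DomLT l) (h' : l.DomLE m) : k.DomLT m := by
  refine ⟨h.1.trans h', ?_⟩
  rintro rfl
  exact h.2 (h.1.antisymm h')

theorem DomLE.trans_lt {k l m : Ptn} (h : k.DomLE l) (h' : l.DomLT m) : k.DomLT m := by
  refine ⟨h.trans h'.1, ?_⟩
  rintro rfl
  exact h'.2 (h'.1.antisymm h)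

/-- At index ℓ(k) the partial sum of k is already the full weight, so the larger partial sum of l
must be the full weight too. This makes P_l vanish in fewer than ℓ(l) variables. -/
theorem DomLE.length_le {k l : Ptn} (h : k.DomLE l) : l.length ≤ k.length := by
  by_contra hlt
  push Not at hlt
  have h1 := h.2 k.length
  rw [k.sum_range_row le_rfl, h.1, ← l.sum_range_row (le_refl l.length),
    ← Finset.sum_range_add_sum_Ico _ hlt.le] at h1
  have h2 : 0 < ∑ i ∈ Finset.Ico k.length l.length, l.row i := by
    refine Finset.sum_pos (fun i hi => Nat.pos_of_ne_zero ?_) ⟨k.length, by simpa using hlt⟩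
    exact (l.row_ne_zero_iff i).2 (Finset.mem_Ico.1 hi).2
  omega

theorem finite_domLE (l : Ptn) : {k : Ptn | k.DomLE l}.Finite :=
  (finite_weight_le l.weight).subset fun _ hk => hk.1.le

theorem finite_domLT (l : Ptn) : {k : Ptn | k.DomLT l}.Finite :=
  l.finite_domLE.subset fun _ hk => hk.1

end Ptn

/-- Monomial symmetric polynomials with coefficients in a commutative ring. -/
def monoR (R : Type*) [CommRing R] (l : Ptn) (n : ℕ) : MvPolynomial (Fin n) R :=
  msymm (Fin n) R l.toNat

theorem mono_eq_monoR (K : Type*) [Field K] (l : Ptn) (n : ℕ) : mono K l n = monoR K l n := rfl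

theorem coeff_monoR (R : Type*) [CommRing R] (l : Ptn) (n : ℕ) (e : Fin n →₀ ℕ) :
    coeff e (monoR R l n) = if shape e = l.parts then 1 else 0 := by
  rw [monoR, coeff_msymm, l.toNat_parts]

theorem map_monoR {R S : Type*} [CommRing R] [CommRing S] (f : R →+* S) (l : Ptn) (n : ℕ) :
    map f (monoR R l n) = monoR S l n := by
  ext e
  rw [coeff_map, coeff_monoR, coeff_monoR]
  split_ifs <;> simp

theorem monoR_eq_zero (R : Type*) [CommRing R] {l : Ptn} {n : ℕ} (h : n < l.length) :
    monoR R l n = 0 := by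
  ext e
  rw [coeff_monoR, if_neg, coeff_zero]
  exact fun he => absurd (Ptn.length_le_of_shape_eq he) (not_le.2 h)

end MacSym
end

/-! ### Power sums as coordinates, and the change of basis to the monomial symmetric functions. -/

noncomputable section

namespace MacSym

open MvPolynomial

/-! ### Polynomials in the power sums -/

section Ring

variable {R : Type*} [CommRing R]

/-- The evaluation in `n` variables of a polynomial in the power sums; the variable `X r` stands
for `p_{r+1}`. -/
def ev (R : Type*) [CommRing R] (n : ℕ) : MvPolynomial ℕ R →ₐ[R] MvPolynomial (Fin n) R :=
  aeval fun r => psum (Fin n) R (r + 1)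

@[simp] theorem ev_X (n r : ℕ) : ev R n (X r) = psum (Fin n) R (r + 1) := aeval_X _ _

theorem ev_C (n : ℕ) (c : R) : ev R n (C c) = C c := by
  simp [ev, algebraMap_eq]

theorem ev_isSymmetric (n : ℕ) (F : MvPolynomial ℕ R) : (ev R n F).IsSymmetric := by
  intro p
  have : ((rename p : MvPolynomial (Fin n) R →ₐ[R] _).comp (ev R n)) = ev R n := by
    refine MvPolynomial.algHom_ext fun r => ?_
    rw [AlgHom.comp_apply, ev_X]
    exact psum_isSymmetric _ _ _ p
  exact DFunLike.congr_fun this F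

theorem killCompl_castLE_X {n n' : ℕ} (h : n ≤ n') (i : Fin n') :
    killCompl (Fin.castLE_injective h) (X i : MvPolynomial (Fin n') R) =
      if hi : (i : ℕ) < n then X ⟨i, hi⟩ else 0 := by
  split_ifs with hi
  · have : i = Fin.castLE h ⟨i, hi⟩ := rfl
    conv_lhs => rw [this, ← rename_X, killCompl_rename_app]
  · rw [killCompl, aeval_X, dif_neg]
    rintro ⟨j, rfl⟩
    exact hi j.2

theorem killCompl_ev {n n' : ℕ} (h : n ≤ n') (F : MvPolynomial ℕ R) :
    killCompl (Fin.castLE_injective h) (ev R n' F) = ev R n F := by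
  have : (killCompl (Fin.castLE_injective h)).comp (ev R n') = ev R n := by
    refine MvPolynomial.algHom_ext fun r => ?_
    rw [AlgHom.comp_apply, ev_X, ev_X, psum, map_sum, psum]
    simp only [map_pow, killCompl_castLE_X]
    obtain ⟨k, rfl⟩ := Nat.exists_eq_add_of_le h
    rw [Fin.sum_univ_add]
    simp
  exact DFunLike.congr_fun this F

/-- Setting extra variables to 0 keeps the coefficients of monomials without them, and symmetry
moves any exponent vector onto another one of the same shape. So the coefficient of m_l does not
depend on the number of variables, and ℓ(l) variables suffice to read it off. -/
theorem coeff_ev_eq {n n' : ℕ} (F : MvPolynomial ℕ R) {e : Fin n →₀ ℕ} {e' : Fin n' →₀ ℕ}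
    (h : shape e = shape e') : coeff e (ev R n F) = coeff e' (ev R n' F) := by
  wlog hn : n ≤ n' generalizing n n'
  · exact (this h.symm (le_of_not_ge hn)).symm
  rw [← killCompl_ev hn, coeff_killCompl]
  exact (ev_isSymmetric n' F).coeff_eq_of_shape_eq
    ((shape_mapDomain (Fin.castLE_injective hn) e).trans h)

theorem exists_totalDegree_ev_le (F : MvPolynomial ℕ R) :
    ∃ d, ∀ n, (ev R n F).totalDegree ≤ d := by
  induction F using MvPolynomial.induction_on with
  | C c => exact ⟨0, fun n => by simp [ev, algebraMap_eq]⟩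
  | add F G hF hG =>
    obtain ⟨d, hd⟩ := hF
    obtain ⟨e, he⟩ := hG
    refine ⟨max d e, fun n => ?_⟩
    rw [map_add]
    exact (totalDegree_add _ _).trans (max_le_max (hd n) (he n))
  | mul_X F r hF =>
    obtain ⟨d, hd⟩ := hF
    refine ⟨d + (r + 1), fun n => ?_⟩
    rw [map_mul, ev_X]
    refine (totalDegree_mul _ _).trans (add_le_add (hd n) ?_)
    refine totalDegree_finsetSum_le fun i _ => ?_
    rw [X_pow_eq_monomial]
    exact (totalDegree_monomial_le _ _).trans (by rw [Finsupp.sum_single_index] <;> simp)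

theorem finite_monomialCoeff (F : MvPolynomial ℕ R) :
    {l : Ptn | coeff (l.expo l.length) (ev R l.length F) ≠ 0}.Finite := by
  obtain ⟨d, hd⟩ := exists_totalDegree_ev_le F
  refine (Ptn.finite_weight_le d).subset fun l hl => ?_
  have h1 := (le_totalDegree (mem_support_iff.2 hl)).trans (hd _)
  have h2 := sum_shape (l.expo l.length)
  rw [l.shape_expo le_rfl, l.sum_parts] at h2
  change l.weight ≤ d
  rw [h2]
  exact h1

/-- The coefficients of a polynomial in the power sums with respect to the monomial symmetric
functions. -/
def monomialCoeff (R : Type*) [CommRing R] : MvPolynomial ℕ R →ₗ[R] (Ptn →₀ R) where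
  toFun F := Finsupp.ofSupportFinite _ (finite_monomialCoeff F)
  map_add' F G := by
    ext l
    change coeff _ (ev R _ (F + G)) = coeff _ (ev R _ F) + coeff _ (ev R _ G)
    rw [map_add, coeff_add]
  map_smul' c F := by
    ext l
    change coeff _ (ev R _ (c • F)) = c • coeff _ (ev R _ F)
    rw [map_smul, coeff_smul]

theorem monomialCoeff_eq_coeff (F : MvPolynomial ℕ R) (l : Ptn) {n : ℕ} {e : Fin n →₀ ℕ}
    (h : shape e = l.parts) : monomialCoeff R F l = coeff e (ev R n F) :=
  coeff_ev_eq F ((l.shape_expo le_rfl).trans h.symm)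

theorem exists_parts_eq_shape {σ : Type*} (e : σ →₀ ℕ) : ∃ l : Ptn, shape e = l.parts :=
  let ⟨l, hl⟩ := Ptn.exists_parts_eq (shape e) (shape_pos e)
  ⟨l, hl.symm⟩

theorem coeff_sum_monoR {n : ℕ} (u : Ptn →₀ R) {e : Fin n →₀ ℕ} {l : Ptn}
    (h : shape e = l.parts) :
    coeff e (u.sum fun k c => C c * monoR R k n) = u l := by
  classical
  rw [Finsupp.sum, coeff_sum]
  simp only [coeff_C_mul, coeff_monoR, h, Ptn.parts_injective.eq_iff, mul_ite, mul_one, mul_zero]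
  rw [Finset.sum_ite_eq]
  split_ifs with hl
  · rfl
  · exact (Finsupp.notMem_support_iff.1 hl).symm

theorem ev_eq_sum (n : ℕ) (F : MvPolynomial ℕ R) :
    ev R n F = (monomialCoeff R F).sum fun l c => C c * monoR R l n := by
  ext e
  obtain ⟨l, hl⟩ := exists_parts_eq_shape e
  rw [coeff_sum_monoR _ hl, monomialCoeff_eq_coeff F l hl]

theorem map_ev {S : Type*} [CommRing S] (f : R →+* S) (n : ℕ) (F : MvPolynomial ℕ R) :
    ev S n (map f F) = map f (ev R n F) := by
  have : (ev S n : MvPolynomial ℕ S →+* MvPolynomial (Fin n) S).comp (map f) =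
      (map f).comp (ev R n : MvPolynomial ℕ R →+* MvPolynomial (Fin n) R) := by
    refine MvPolynomial.ringHom_ext (fun r => ?_) fun r => ?_
    · simp [ev, algebraMap_eq]
    · simp [psum]
  exact DFunLike.congr_fun this F

theorem monomialCoeff_map {S : Type*} [CommRing S] (f : R →+* S) (F : MvPolynomial ℕ R)
    (l : Ptn) : monomialCoeff S (map f F) l = f (monomialCoeff R F l) := by
  rw [monomialCoeff_eq_coeff _ l (l.shape_expo le_rfl),
    monomialCoeff_eq_coeff _ l (l.shape_expo le_rfl), map_ev, coeff_map]

end Ring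

/-! ### Triangularity between power sums and monomial symmetric functions -/

theorem shape_add_single {σ : Type*} {e : σ →₀ ℕ} {i : σ} (hi : e i = 0) {v : ℕ} (hv : v ≠ 0) :
    shape (e + Finsupp.single i v) = v ::ₘ shape e := by
  classical
  have hni : i ∉ e.support := by simpa using hi
  have hsupp : (e + Finsupp.single i v).support = Finset.cons i e.support hni := by
    ext j
    by_cases hj : j = i
    · subst hj; simp [hv]
    · simp [hj]
  rw [shape, hsupp, Finset.cons_val, Multiset.map_cons]
  congr 1
  · simp [hi]
  · refine Multiset.map_congr rfl fun j hj => ?_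
    have : j ≠ i := by
      rintro rfl
      exact hni hj
    simp [this.symm]

theorem coeff_psum_mul {R : Type*} [CommRing R] {n : ℕ} (v : ℕ) (f : MvPolynomial (Fin n) R)
    (e : Fin n →₀ ℕ) :
    coeff e (psum (Fin n) R v * f) =
      ∑ i, if v ≤ e i then coeff (e - Finsupp.single i v) f else 0 := by
  rw [psum, Finset.sum_mul, coeff_sum]
  refine Finset.sum_congr rfl fun i _ => ?_
  rw [X_pow_eq_monomial, coeff_monomial_mul']
  simp only [one_mul, Finsupp.single_le_iff]

/-- In the expansion of the product each factor picks one variable, and factors picking the same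
variable merge their parts. So there are at most as many parts as factors, and equality means that
nothing merged. Nonnegativity over ℚ excludes cancellation, which gives the positivity. -/
theorem coeff_ev_powerSum (n : ℕ) (s : Multiset ℕ) (e : Fin n →₀ ℕ) :
    0 ≤ coeff e (ev ℚ n (s.map X).prod) ∧
    (coeff e (ev ℚ n (s.map X).prod) ≠ 0 →
      (shape e).card ≤ s.card ∧ ((shape e).card = s.card → shape e = s.map Nat.succ)) ∧
    (shape e = s.map Nat.succ → 0 < coeff e (ev ℚ n (s.map X).prod)) := by
  classical
  induction s using Multiset.induction_on generalizing e with
  | empty =>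
    simp only [Multiset.map_zero, Multiset.prod_zero, map_one, coeff_one]
    refine ⟨by split_ifs <;> simp, ?_, ?_⟩
    · intro h
      have : (0 : Fin n →₀ ℕ) = e := by
        by_contra h'
        exact h (if_neg h')
      subst this
      simp [shape]
    · intro h
      have : e.support = ∅ := by
        rw [← Finset.card_eq_zero, ← card_shape, h, Multiset.card_zero]
      rw [if_pos (Finsupp.support_eq_empty.1 this).symm]
      exact one_pos
  | cons r s ih =>
    rw [Multiset.map_cons, Multiset.prod_cons, map_mul, ev_X, coeff_psum_mul]
    have hterm : ∀ i ∈ Finset.univ, 0 ≤ if r + 1 ≤ e i then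
        coeff (e - Finsupp.single i (r + 1)) (ev ℚ n (s.map X).prod) else 0 := by
      intro i _
      split_ifs
      · exact (ih _).1
      · exact le_rfl
    refine ⟨Finset.sum_nonneg hterm, ?_, ?_⟩
    · intro h
      obtain ⟨i, _, hi⟩ := Finset.exists_ne_zero_of_sum_ne_zero h
      have hle : r + 1 ≤ e i := by
        by_contra h'
        exact hi (if_neg h')
      rw [if_pos hle] at hi
      obtain ⟨h1, h2⟩ := (ih _).2.1 hi
      set e' := e - Finsupp.single i (r + 1) with he'
      have he : e = e' + Finsupp.single i (r + 1) := by
        rw [he', tsub_add_cancel_of_le (Finsupp.single_le_iff.2 hle)]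
      by_cases h0 : e' i = 0
      · have hs : shape e = (r + 1) ::ₘ shape e' := by rw [he, shape_add_single h0 (by omega)]
        rw [hs]
        simp only [Multiset.card_cons, Multiset.map_cons]
        exact ⟨by omega, fun h' => by rw [h2 (by omega)]⟩
      · have hc : (shape e).card = (shape e').card := by
          rw [card_shape, card_shape]
          congr 1
          ext j
          rw [he]
          by_cases hj : j = i
          · subst hj; simp [h0]
          · simp [Ne.symm hj]
        rw [Multiset.card_cons, hc]
        exact ⟨by omega, fun h' => by omega⟩
    · intro h
      rw [Multiset.map_cons] at h
      have hmem : r + 1 ∈ shape e := by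
        rw [h]
        exact Multiset.mem_cons_self _ _
      obtain ⟨i, _, hi⟩ := Multiset.mem_map.1 hmem
      refine Finset.sum_pos' hterm ⟨i, Finset.mem_univ _, ?_⟩
      rw [if_pos hi.ge]
      refine (ih _).2.2 ?_
      set e' := e - Finsupp.single i (r + 1) with he'
      have he : e = e' + Finsupp.single i (r + 1) := by
        rw [he', tsub_add_cancel_of_le (Finsupp.single_le_iff.2 hi.ge)]
      have h0 : e' i = 0 := by simp [he', hi]
      rw [he, shape_add_single h0 (by omega)] at h
      exact (Multiset.cons_inj_right _).1 h

/-- Triangularity in the length: the power sum product with the parts of l is a positive multiple of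
m_l plus a combination of m's with fewer parts. Induction on the length solves for m_l, by one
polynomial that serves all n. -/
theorem exists_ev_eq_monoR (k : ℕ) (l : Ptn) (hl : l.length ≤ k) :
    ∃ F : MvPolynomial ℕ ℚ, ∀ n, ev ℚ n F = monoR ℚ l n := by
  classical
  induction k using Nat.strong_induction_on generalizing l with
  | _ k ih =>
    set s := l.parts.map Nat.pred with hs
    have hparts : s.map Nat.succ = l.parts := by
      rw [hs, Multiset.map_map]
      conv_rhs => rw [← Multiset.map_id l.parts]
      exact Multiset.map_congr rfl fun x hx => Nat.succ_pred_eq_of_pos (l.parts_pos x hx)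
    have hcard : s.card = l.length := by rw [hs, Multiset.card_map, l.card_parts]
    set P : MvPolynomial ℕ ℚ := (s.map X).prod with hP
    set c := monomialCoeff ℚ P with hc
    have hcl : 0 < c l := by
      rw [hc, monomialCoeff_eq_coeff P l (l.shape_expo le_rfl)]
      exact (coeff_ev_powerSum _ s _).2.2 ((l.shape_expo le_rfl).trans hparts.symm)
    have hlow : ∀ m ∈ (c.erase l).support, m.length < l.length := by
      intro m hm
      rw [Finsupp.support_erase, Finset.mem_erase, Finsupp.mem_support_iff] at hm
      have h2 := hm.2
      rw [hc, monomialCoeff_eq_coeff P m (m.shape_expo le_rfl)] at h2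
      obtain ⟨h3, h4⟩ := (coeff_ev_powerSum _ s _).2.1 h2
      rw [m.shape_expo le_rfl, m.card_parts, hcard] at h3 h4
      refine lt_of_le_of_ne h3 fun h5 => hm.1 (Ptn.parts_injective ?_)
      rw [h4 h5, hparts]
    have hex : ∀ m : Ptn, ∃ F : MvPolynomial ℕ ℚ, m ∈ (c.erase l).support →
        ∀ n, ev ℚ n F = monoR ℚ m n := by
      intro m
      by_cases hm : m ∈ (c.erase l).support
      · obtain ⟨F, hF⟩ := ih m.length (lt_of_lt_of_le (hlow m hm) hl) m le_rfl
        exact ⟨F, fun _ => hF⟩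
      · exact ⟨0, fun h => absurd h hm⟩
    choose G hG using hex
    refine ⟨C (c l)⁻¹ * (P - (c.erase l).sum fun m a => C a * G m), fun n => ?_⟩
    have h1 : ev ℚ n ((c.erase l).sum fun m a => C a * G m) =
        (c.erase l).sum fun m a => C a * monoR ℚ m n := by
      rw [Finsupp.sum, map_sum, Finsupp.sum]
      refine Finset.sum_congr rfl fun m hm => ?_
      rw [map_mul, hG m hm n]
      simp [ev, algebraMap_eq]
    have h2 : ev ℚ n P = C (c l) * monoR ℚ l n +
        (c.erase l).sum fun m a => C a * monoR ℚ m n := by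
      rw [ev_eq_sum, ← hc]
      conv_lhs => rw [← Finsupp.single_add_erase l c]
      rw [Finsupp.sum_add_index' (by simp) (by simp [add_mul]), Finsupp.sum_single_index (by simp)]
    rw [map_mul, map_sub, h1, h2, add_sub_cancel_right]
    have h3 : ev ℚ n (C (c l)⁻¹) = C (c l)⁻¹ := by simp [ev, algebraMap_eq]
    rw [h3, ← mul_assoc, ← C_mul, inv_mul_cancel₀ hcl.ne', C_1, one_mul]

section Alg

variable (R : Type*) [CommRing R] [Algebra ℚ R]

/-- The monomial symmetric function `m_l` as a polynomial in the power sums. -/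
def monoFun (l : Ptn) : MvPolynomial ℕ R :=
  map (algebraMap ℚ R) (exists_ev_eq_monoR l.length l le_rfl).choose

theorem ev_monoFun (n : ℕ) (l : Ptn) : ev R n (monoFun R l) = monoR R l n := by
  rw [monoFun, map_ev, (exists_ev_eq_monoR l.length l le_rfl).choose_spec n, map_monoR]

theorem map_monoFun {R S : Type*} [CommRing R] [Algebra ℚ R] [CommRing S] [Algebra ℚ S]
    (f : R →+* S) (l : Ptn) : map f (monoFun R l) = monoFun S l := by
  rw [monoFun, map_map, monoFun, Subsingleton.elim (f.comp (algebraMap ℚ R)) (algebraMap ℚ S)]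

variable {R}

theorem coeff_ev_monomial {n : ℕ} (a : ℕ →₀ ℕ) (e : Fin n →₀ ℕ) :
    coeff e (ev R n (monomial a 1)) =
      algebraMap ℚ R (coeff e (ev ℚ n ((Finsupp.toMultiset a).map X).prod)) := by
  classical
  rw [prod_map_X_eq_monomial, Finsupp.toMultiset_toFinsupp, ← coeff_map, ← map_ev, map_monomial,
    RingHom.map_one]

/-- Distinct monomials in the power sums of degree at most `n` remain independent in `n`
variables. -/
theorem eq_zero_of_ev_eq_zero {n : ℕ} {F : MvPolynomial ℕ R} (hd : F.totalDegree ≤ n)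
    (h : ev R n F = 0) : F = 0 := by
  classical
  by_contra hF
  -- Take a monomial with the most factors. At its own shape no other monomial of F contributes:
  -- those with fewer factors give too few parts, and those with equally many have another shape.
  obtain ⟨a, ha, hmax⟩ := Finset.exists_max_image F.support
    (fun a => (Finsupp.toMultiset a).card) (support_nonempty.2 hF)
  have hcard : (Finsupp.toMultiset a).card ≤ n := by
    rw [Finsupp.card_toMultiset]
    exact (le_totalDegree ha).trans hd
  obtain ⟨l, hl⟩ := Ptn.exists_parts_eq ((Finsupp.toMultiset a).map Nat.succ) (by
    intro x hx
    obtain ⟨y, _, rfl⟩ := Multiset.mem_map.1 hx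
    exact Nat.succ_pos y)
  have hlen : l.length = (Finsupp.toMultiset a).card := by
    rw [← l.card_parts, hl, Multiset.card_map]
  have hsh := l.shape_expo (n := n) (by omega)
  have hsum : coeff (l.expo n) (ev R n F) =
      ∑ b ∈ F.support, coeff b F * coeff (l.expo n) (ev R n (monomial b 1)) := by
    conv_lhs => rw [F.as_sum, map_sum, coeff_sum]
    refine Finset.sum_congr rfl fun b _ => ?_
    rw [← coeff_C_mul, ← mul_one (coeff b F), ← C_mul_monomial, map_mul, mul_one]
    simp [ev, algebraMap_eq]
  rw [h, coeff_zero, Finset.sum_eq_single_of_mem a ha, coeff_ev_monomial] at hsum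
  · have hpos := (coeff_ev_powerSum n (Finsupp.toMultiset a) (l.expo n)).2.2 (hsh.trans hl)
    -- R need not be a domain, but a nonzero rational is a unit in any ℚ-algebra.
    have hunit : IsUnit (algebraMap ℚ R
        (coeff (l.expo n) (ev ℚ n ((Finsupp.toMultiset a).map X).prod))) :=
      (IsUnit.mk0 _ hpos.ne').map _
    exact mem_support_iff.1 ha ((hunit.mul_left_eq_zero).1 hsum.symm)
  · intro b hb hne
    rw [coeff_ev_monomial]
    by_contra h0
    have h1 : coeff (l.expo n) (ev ℚ n ((Finsupp.toMultiset b).map X).prod) ≠ 0 := by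
      intro h1
      rw [h1] at h0
      simp at h0
    obtain ⟨h2, h3⟩ := (coeff_ev_powerSum _ _ _).2.1 h1
    rw [hsh, hl, Multiset.card_map] at h2 h3
    have h4 := h3 (le_antisymm h2 (hmax b hb))
    exact hne (Multiset.toFinsupp.symm.injective
      (Multiset.map_injective Nat.succ_injective h4)).symm

theorem eq_of_ev_eq {F G : MvPolynomial ℕ R} (h : ∀ n, ev R n F = ev R n G) : F = G := by
  rw [← sub_eq_zero]
  refine eq_zero_of_ev_eq_zero (n := (F - G).totalDegree) le_rfl ?_
  rw [map_sub, h, sub_self]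

theorem monomialCoeff_monoFun (l : Ptn) :
    monomialCoeff R (monoFun R l) = Finsupp.single l 1 := by
  classical
  ext k
  rw [monomialCoeff_eq_coeff _ k (k.shape_expo le_rfl), ev_monoFun, coeff_monoR,
    k.shape_expo le_rfl, Finsupp.single_apply]
  simp only [Ptn.parts_injective.eq_iff, eq_comm]

theorem eq_sum_monoFun (F : MvPolynomial ℕ R) :
    F = (monomialCoeff R F).sum fun l c => c • monoFun R l := by
  refine eq_of_ev_eq fun n => ?_
  rw [ev_eq_sum, Finsupp.sum, Finsupp.sum, map_sum]
  refine Finset.sum_congr rfl fun l _ => ?_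
  rw [smul_eq_C_mul, map_mul, ev_C, ev_monoFun]

end Alg

end MacSym
end

/-! ### Exponential series, adjoints, and the Macdonald operator on polynomials in the power sums.
-/

noncomputable section

namespace MacSym

open MvPolynomial

/-! ### Coefficients of exponentials -/

section Exp

variable {A B : Type*} [CommRing A] [Algebra ℚ A] [CommRing B] [Algebra ℚ B]

/-- The coefficients of `exp (∑ r, s r * z ^ (r + 1) / (r + 1))`. -/
def expCoeff (s : ℕ → A) : ℕ → A
  | 0 => 1
  | k + 1 => algebraMap ℚ A ((k + 1 : ℚ)⁻¹) * ∑ r : Fin (k + 1), s r * expCoeff s (k - r)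

@[simp] theorem expCoeff_zero (s : ℕ → A) : expCoeff s 0 = 1 := by rw [expCoeff]

theorem algebraMap_inv_succ_mul (k : ℕ) : (algebraMap ℚ A ((k + 1 : ℚ)⁻¹)) * ((k : A) + 1) = 1 := by
  have : ((k : A) + 1) = algebraMap ℚ A (k + 1 : ℚ) := by simp
  rw [this, ← map_mul, inv_mul_cancel₀ (by positivity), map_one]

theorem succ_mul_cancel {k : ℕ} {a b : A} (h : ((k : A) + 1) * a = (k + 1) * b) : a = b := by
  have := congrArg (fun x => algebraMap ℚ A ((k + 1 : ℚ)⁻¹) * x) h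
  simpa only [← mul_assoc, algebraMap_inv_succ_mul, one_mul] using this

theorem succ_mul_expCoeff (s : ℕ → A) (k : ℕ) :
    ((k : A) + 1) * expCoeff s (k + 1) =
      ∑ r ∈ Finset.range (k + 1), s r * expCoeff s (k - r) := by
  rw [expCoeff, ← mul_assoc, mul_comm ((k : A) + 1), algebraMap_inv_succ_mul, one_mul,
    Fin.sum_univ_eq_sum_range (fun r => s r * expCoeff s (k - r))]

theorem eq_expCoeff {s y : ℕ → A} (h0 : y 0 = 1)
    (h : ∀ k : ℕ, ((k : A) + 1) * y (k + 1) = ∑ r ∈ Finset.range (k + 1), s r * y (k - r)) :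
    y = expCoeff s := by
  ext k
  induction k using Nat.strong_induction_on with
  | _ k ih =>
    cases k with
    | zero => rw [h0, expCoeff_zero]
    | succ k =>
      refine succ_mul_cancel (k := k) ?_
      rw [h, succ_mul_expCoeff]
      refine Finset.sum_congr rfl fun r hr => ?_
      rw [ih (k - r) (by omega)]

theorem map_expCoeff (f : A →+* B) (s : ℕ → A) (k : ℕ) :
    f (expCoeff s k) = expCoeff (fun r => f (s r)) k := by
  refine congrFun (eq_expCoeff (y := fun k => f (expCoeff s k)) (by simp) fun k => ?_) k
  have := congrArg f (succ_mul_expCoeff s k)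
  simpa using this

/-- This is the rescaling z ↦ c z of the exponential series. -/
theorem expCoeff_pow_mul (c : A) (s : ℕ → A) (k : ℕ) :
    expCoeff (fun r => c ^ (r + 1) * s r) k = c ^ k * expCoeff s k := by
  refine (congrFun (eq_expCoeff (y := fun k => c ^ k * expCoeff s k) (by simp) fun k => ?_) k).symm
  rw [mul_left_comm, succ_mul_expCoeff, Finset.mul_sum]
  refine Finset.sum_congr rfl fun r hr => ?_
  have : k + 1 = (r + 1) + (k - r) := by
    have := Finset.mem_range.1 hr
    omega
  rw [this, pow_add]
  ring

/-- The characterization of the exponential by its logarithmic derivative. -/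
theorem mk_expCoeff_eq {s : ℕ → A} {Y : PowerSeries A} (h0 : PowerSeries.constantCoeff Y = 1)
    (h : PowerSeries.derivative A Y = PowerSeries.mk s * Y) :
    Y = PowerSeries.mk (expCoeff s) := by
  have : (fun k => PowerSeries.coeff k Y) = expCoeff s := by
    refine eq_expCoeff (by simpa using h0) fun k => ?_
    have h1 := congrArg (PowerSeries.coeff k) h
    rw [PowerSeries.coeff_derivative, PowerSeries.coeff_mul,
      Finset.Nat.sum_antidiagonal_eq_sum_range_succ
        (fun i j => PowerSeries.coeff i (PowerSeries.mk s) * PowerSeries.coeff j Y)] at h1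
    rw [mul_comm, h1]
    simp
  ext k
  rw [PowerSeries.coeff_mk, ← this]

theorem derivative_mk_expCoeff (s : ℕ → A) :
    PowerSeries.derivative A (PowerSeries.mk (expCoeff s)) =
      PowerSeries.mk s * PowerSeries.mk (expCoeff s) := by
  ext k
  rw [PowerSeries.coeff_derivative, PowerSeries.coeff_mul,
    Finset.Nat.sum_antidiagonal_eq_sum_range_succ
      (fun i j => PowerSeries.coeff i (PowerSeries.mk s) *
        PowerSeries.coeff j (PowerSeries.mk (expCoeff s)))]
  simp only [PowerSeries.coeff_mk]
  rw [mul_comm, succ_mul_expCoeff]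

end Exp

/-! ### The scalar product on polynomials in the power sums -/

section Form

variable {R : Type*} [CommRing R]

/-- The norm `∏ c_r^{a_r} a_r!` of the monomial `∏ p_{r+1}^{a_r}`. -/
def pnorm (c : ℕ → R) (a : ℕ →₀ ℕ) : R := a.prod fun r k => c r ^ k * (k.factorial : R)

theorem pnorm_add_single (c : ℕ → R) (a : ℕ →₀ ℕ) (r : ℕ) :
    pnorm c (a + Finsupp.single r 1) = c r * ((a r : R) + 1) * pnorm c a := by
  classical
  have h : ∀ b : ℕ →₀ ℕ, b.support ⊆ insert r a.support →
      pnorm c b = (c r ^ b r * ((b r).factorial : R)) *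
        ∏ j ∈ a.support.erase r, c j ^ b j * ((b j).factorial : R) := by
    intro b hb
    rw [pnorm, Finsupp.prod_of_support_subset _ hb _ (by simp),
      ← Finset.mul_prod_erase _ _ (Finset.mem_insert_self r a.support), Finset.erase_insert_eq_erase]
  have hb : ∀ j, (a + Finsupp.single r 1 : ℕ →₀ ℕ) j = a j + (Finsupp.single r 1 : ℕ →₀ ℕ) j :=
    fun j => rfl
  rw [h (a + Finsupp.single r 1), h a (Finset.subset_insert _ _),
    Finset.prod_congr rfl fun j hj => by
      rw [hb, Finsupp.single_eq_of_ne (Finset.ne_of_mem_erase hj), add_zero]]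
  · rw [hb, Finsupp.single_eq_same, Nat.factorial_succ, pow_succ]
    push_cast
    ring
  · intro j hj
    rw [Finset.mem_insert]
    by_cases hjr : j = r
    · exact Or.inl hjr
    · right
      simpa [Ne.symm hjr] using hj

/-- The bilinear form for which the monomials in the power sums are orthogonal, with norms given
by `pnorm c`. -/
def pform (c : ℕ → R) : MvPolynomial ℕ R →ₗ[R] MvPolynomial ℕ R →ₗ[R] R :=
  (basisMonomials ℕ R).constr R fun a => pnorm c a • lcoeff R a

theorem pform_monomial (c : ℕ → R) (a : ℕ →₀ ℕ) (x : R) (G : MvPolynomial ℕ R) :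
    pform c (monomial a x) G = x * (pnorm c a * coeff a G) := by
  have h1 : monomial a x = x • basisMonomials ℕ R a := by
    rw [coe_basisMonomials, smul_monomial, smul_eq_mul, mul_one]
  rw [h1, map_smul, pform, Module.Basis.constr_basis]
  simp

theorem pform_eq_sum (c : ℕ → R) (F G : MvPolynomial ℕ R) {S : Finset (ℕ →₀ ℕ)}
    (hS : F.support ⊆ S) :
    pform c F G = ∑ a ∈ S, coeff a F * (pnorm c a * coeff a G) := by
  conv_lhs => rw [F.as_sum, map_sum, LinearMap.sum_apply]
  simp only [pform_monomial]
  refine Finset.sum_subset hS fun a _ ha => ?_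
  rw [notMem_support_iff.1 ha, zero_mul]

theorem pform_comm (c : ℕ → R) (F G : MvPolynomial ℕ R) : pform c F G = pform c G F := by
  classical
  rw [pform_eq_sum c F G Finset.subset_union_left, pform_eq_sum c G F Finset.subset_union_right]
  exact Finset.sum_congr rfl fun a _ => by ring

/-- Raising the exponent of p_{r+1} from k to k + 1 multiplies the norm by c_r (k + 1), so
multiplication by p_{r+1} is adjoint to c_r ∂/∂p_{r+1}. All further adjoints are derived from this
one. -/
theorem pform_X_mul (c : ℕ → R) (r : ℕ) (F G : MvPolynomial ℕ R) :
    pform c (X r * F) G = c r * pform c F (pderiv r G) := by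
  induction F using MvPolynomial.induction_on' with
  | monomial a x =>
    rw [X, monomial_mul, one_mul, pform_monomial, pform_monomial, add_comm, pnorm_add_single,
      coeff_pderiv]
    ring
  | add F F' h h' =>
    rw [mul_add, map_add, map_add, LinearMap.add_apply, LinearMap.add_apply, h, h', mul_add]

theorem pform_C_mul (c : ℕ → R) (x : R) (F G : MvPolynomial ℕ R) :
    pform c (C x * F) G = x * pform c F G := by
  rw [← smul_eq_C_mul, map_smul, LinearMap.smul_apply, smul_eq_mul]

/-! ### Shifting the power sums -/

/-- The substitution `p_{r+1} ↦ p_{r+1} + s_r u^{r+1}`. -/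
def shift (s : ℕ → R) : MvPolynomial ℕ R →ₐ[R] Polynomial (MvPolynomial ℕ R) :=
  aeval fun r => Polynomial.C (X r) + Polynomial.C (C (s r)) * Polynomial.X ^ (r + 1)

@[simp] theorem shift_X (s : ℕ → R) (r : ℕ) :
    shift s (X r) = Polynomial.C (X r) + Polynomial.C (C (s r)) * Polynomial.X ^ (r + 1) :=
  aeval_X _ _

theorem shift_C (s : ℕ → R) (x : R) : shift s (C x) = Polynomial.C (C x) := algHom_C _ _

theorem coeff_zero_shift (s : ℕ → R) (F : MvPolynomial ℕ R) : (shift s F).coeff 0 = F := by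
  induction F using MvPolynomial.induction_on with
  | C x => simp
  | add F G hF hG => rw [map_add, Polynomial.coeff_add, hF, hG]
  | mul_X F r hF => rw [map_mul, Polynomial.mul_coeff_zero, hF]; simp

/-- Chain rule in u. F involves finitely many power sums, so the sum over r may stop at any large
enough N; leaving N free allows two bounds to be reconciled. -/
theorem derivative_shift (s : ℕ → R) (F : MvPolynomial ℕ R) : ∃ N₀, ∀ N ≥ N₀,
    Polynomial.derivative (shift s F) = ∑ r ∈ Finset.range N,
      Polynomial.C (C (((r : R) + 1) * s r)) * Polynomial.X ^ r * shift s (pderiv r F) := by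
  induction F using MvPolynomial.induction_on with
  | C x => exact ⟨0, fun N _ => by simp⟩
  | add F G hF hG =>
    obtain ⟨N, hN⟩ := hF
    obtain ⟨M, hM⟩ := hG
    refine ⟨max N M, fun n hn => ?_⟩
    rw [map_add, map_add, hN n (le_of_max_le_left hn), hM n (le_of_max_le_right hn),
      ← Finset.sum_add_distrib]
    exact Finset.sum_congr rfl fun r _ => by rw [map_add, map_add, mul_add]
  | mul_X F j hF =>
    obtain ⟨N, hN⟩ := hF
    refine ⟨max N (j + 1), fun n hn => ?_⟩
    have h1 : ∀ r ∈ Finset.range n,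
        Polynomial.C (C (((r : R) + 1) * s r)) * Polynomial.X ^ r * shift s (pderiv r (F * X j)) =
        Polynomial.C (C (((r : R) + 1) * s r)) * Polynomial.X ^ r * shift s (pderiv r F) *
          shift s (X j) + if r = j then
            Polynomial.C (C (((j : R) + 1) * s j)) * Polynomial.X ^ j * shift s F else 0 := by
      intro r _
      rw [Derivation.leibniz, smul_eq_mul, smul_eq_mul, map_add, map_mul (shift s),
        map_mul (shift s)]
      split_ifs with h
      · subst h
        rw [pderiv_X_self, map_one]
        ring
      · rw [pderiv_X_of_ne (Ne.symm h), map_zero]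
        ring
    rw [Finset.sum_congr rfl h1, Finset.sum_add_distrib, ← Finset.sum_mul,
      ← hN n (le_of_max_le_left hn), Finset.sum_ite_eq', if_pos, map_mul,
      Polynomial.derivative_mul]
    · rw [shift_X]
      simp only [Polynomial.derivative_C, Polynomial.derivative_C_mul,
        Polynomial.derivative_X_pow, map_mul, map_add, map_natCast, map_one, zero_add]
      simp only [Nat.add_sub_cancel, Nat.cast_add, Nat.cast_one]
      ring
    · exact Finset.mem_range.2 (le_of_max_le_right hn)

/-- The coefficient of u^k in the chain rule. It has the shape of the recursion of `expCoeff`, with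
a derivative in place of a multiplication, so the two sides of `pform_expFun_mul` obey the same
recursion. -/
theorem succ_mul_coeff_shift (s : ℕ → R) (F : MvPolynomial ℕ R) (k : ℕ) :
    ((k : R) + 1) • (shift s F).coeff (k + 1) = ∑ r ∈ Finset.range (k + 1),
      (((r : R) + 1) * s r) • (shift s (pderiv r F)).coeff (k - r) := by
  obtain ⟨N₀, h⟩ := derivative_shift s F
  have h1 := congrArg (fun f => Polynomial.coeff f k) (h (max N₀ (k + 1)) (le_max_left _ _))
  simp only [Polynomial.coeff_derivative, Polynomial.finsetSum_coeff, mul_assoc,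
    Polynomial.coeff_C_mul, Polynomial.coeff_X_pow_mul'] at h1
  rw [smul_eq_C_mul, map_add, map_natCast, map_one, mul_comm, h1]
  rw [← Finset.sum_subset (Finset.range_mono (le_max_right N₀ (k + 1))) fun r _ hr => by
    rw [if_neg (by simpa using hr), mul_zero]]
  refine Finset.sum_congr rfl fun r hr => ?_
  rw [if_pos (by simpa [Nat.lt_succ_iff] using hr), smul_eq_C_mul]

theorem map_shift {S : Type*} [CommRing S] (f : R →+* S) (s : ℕ → R) (F : MvPolynomial ℕ R) :
    shift (fun r => f (s r)) (map f F) = (shift s F).map (map f) := by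
  induction F using MvPolynomial.induction_on with
  | C x => simp
  | add F G hF hG => simp only [map_add, hF, hG, Polynomial.map_add]
  | mul_X F r hF => simp [hF]

end Form

section Adjoint

variable {R : Type*} [CommRing R] [Algebra ℚ R]

/-- The coefficients of `exp (∑ r, b r * p_{r+1} * z ^ (r + 1) / (r + 1))`. -/
def expFun (b : ℕ → R) (k : ℕ) : MvPolynomial ℕ R := expCoeff (fun r => C (b r) * X r) k

/-- Multiplication by the exponential of a linear form in the power sums is adjoint to a shift. -/
theorem pform_expFun_mul {b c s : ℕ → R} (h : ∀ r : ℕ, ((r : R) + 1) * s r = b r * c r) (k : ℕ)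
    (F G : MvPolynomial ℕ R) :
    pform c (expFun b k * F) G = pform c F ((shift s G).coeff k) := by
  induction k using Nat.strong_induction_on generalizing G with
  | _ k ih =>
    cases k with
    | zero => rw [expFun, expCoeff_zero, one_mul, coeff_zero_shift]
    | succ k =>
      refine succ_mul_cancel (k := k) ?_
      have h1 : ((k : R) + 1) * pform c (expFun b (k + 1) * F) G =
          pform c ((((k : MvPolynomial ℕ R) + 1) * expFun b (k + 1)) * F) G := by
        have : ((k : MvPolynomial ℕ R) + 1) = C ((k : R) + 1) := by simp
        rw [this, mul_assoc, pform_C_mul]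
      have h2 : ((k : R) + 1) * pform c F ((shift s G).coeff (k + 1)) =
          pform c F (((k : R) + 1) • (shift s G).coeff (k + 1)) := by
        rw [map_smul, smul_eq_mul]
      rw [h1, h2, succ_mul_coeff_shift, expFun, succ_mul_expCoeff, Finset.sum_mul, map_sum,
        LinearMap.sum_apply, map_sum]
      refine Finset.sum_congr rfl fun r hr => ?_
      rw [map_smul, smul_eq_mul, ← ih (k - r) (by omega), mul_assoc, mul_assoc, pform_C_mul,
        pform_X_mul, h r, mul_assoc]
      rfl

/-! ### The Macdonald operator -/

/-- The Macdonald operator `∑ₖ gₖ φₖ`, where `∑ gₖ uᵏ = ∏ (1 - t xᵢ u) / (1 - xᵢ u)` and where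
`φₖ` are the coefficients of the substitution `p_r ↦ p_r + (ρ^r - 1) u^r`. -/
def macOp (ρ t : R) : MvPolynomial ℕ R →ₗ[R] MvPolynomial ℕ R :=
  (Polynomial.lsum fun k => LinearMap.mulLeft R (expFun (fun r => 1 - t ^ (r + 1)) k)) ∘ₗ
    (shift fun r => ρ ^ (r + 1) - 1).toLinearMap

theorem macOp_eq_sum (ρ t : R) (F : MvPolynomial ℕ R) {N : ℕ}
    (hN : (shift (fun r => ρ ^ (r + 1) - 1) F).natDegree < N) :
    macOp ρ t F = ∑ k ∈ Finset.range N, expFun (fun r => 1 - t ^ (r + 1)) k *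
      (shift (fun r => ρ ^ (r + 1) - 1) F).coeff k := by
  change Polynomial.sum (shift (fun r => ρ ^ (r + 1) - 1) F) (fun k a =>
    expFun (fun r => 1 - t ^ (r + 1)) k * a) = _
  rw [Polynomial.sum_over_range' _ (by simp) N hN]

/-- The adjoint of multiplication by g_k is q^k φ_k, because ρ^{r+1} (1 - t^{r+1}) c_r =
(r+1)(ρ^{r+1} - 1). Hence ⟨g_k φ_k F, G⟩ = q^k ⟨φ_k F, φ_k G⟩, which is symmetric in F and G. -/
theorem pform_macOp {q t ρ : R} {c : ℕ → R} (hρ : ρ * q = 1)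
    (hc : ∀ r : ℕ, (1 - t ^ (r + 1)) * c r = ((r : R) + 1) * (1 - q ^ (r + 1)))
    (F G : MvPolynomial ℕ R) : pform c (macOp ρ t F) G = pform c F (macOp ρ t G) := by
  have hρ' : ∀ k, ρ ^ k * q ^ k = 1 := fun k => by rw [← mul_pow, hρ, one_pow]
  set φ : ℕ → MvPolynomial ℕ R → MvPolynomial ℕ R :=
    fun k F => (shift (fun r => ρ ^ (r + 1) - 1) F).coeff k with hφ
  have hadj : ∀ k F G, pform c (expFun (fun r => 1 - t ^ (r + 1)) k * F) G =
      q ^ k * pform c F (φ k G) := by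
    intro k F G
    have h1 : expFun (fun r => ρ ^ (r + 1) * (1 - t ^ (r + 1))) k =
        C (ρ ^ k) * expFun (fun r => 1 - t ^ (r + 1)) k := by
      rw [expFun, expFun, map_pow, ← expCoeff_pow_mul]
      simp only [map_mul, map_pow, mul_assoc]
    rw [hφ, ← pform_expFun_mul (b := fun r => ρ ^ (r + 1) * (1 - t ^ (r + 1))), h1, mul_assoc,
      pform_C_mul, ← mul_assoc, mul_comm (q ^ k), hρ', one_mul]
    intro r
    rw [mul_assoc, hc]
    linear_combination ((r : R) + 1) * hρ' (r + 1)
  set N := max (shift (fun r => ρ ^ (r + 1) - 1) F).natDegree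
    (shift (fun r => ρ ^ (r + 1) - 1) G).natDegree + 1 with hN
  rw [macOp_eq_sum ρ t F (N := N) (by omega), macOp_eq_sum ρ t G (N := N) (by omega),
    map_sum, map_sum, LinearMap.sum_apply]
  refine Finset.sum_congr rfl fun k _ => ?_
  rw [hadj, pform_comm c F, hadj, pform_comm c _ (φ k F)]

theorem map_macOp {S : Type*} [CommRing S] [Algebra ℚ S] (f : R →+* S) (ρ t : R)
    (F : MvPolynomial ℕ R) : map f (macOp ρ t F) = macOp (f ρ) (f t) (map f F) := by
  have h1 : ∀ k, map f (expFun (fun r => 1 - t ^ (r + 1)) k) =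
      expFun (fun r => 1 - f t ^ (r + 1)) k := by
    intro k
    rw [expFun, map_expCoeff, expFun]
    simp
  have h2 := map_shift f (fun r => ρ ^ (r + 1) - 1) F
  simp only [map_sub, map_pow, map_one] at h2
  set N := max (shift (fun r => ρ ^ (r + 1) - 1) F).natDegree
    (shift (fun r => f ρ ^ (r + 1) - 1) (map f F)).natDegree + 1 with hN
  rw [macOp_eq_sum ρ t F (N := N) (by omega), macOp_eq_sum _ _ _ (N := N) (by omega), map_sum]
  refine Finset.sum_congr rfl fun k _ => ?_
  rw [map_mul, h1, h2, Polynomial.coeff_map]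

end Adjoint

end MacSym
end

/-! ### The explicit form of the operator in n variables, cleared of denominators. -/

noncomputable section

namespace MacSym

open MvPolynomial

/-! ### The Macdonald operator in finitely many variables -/

section PairProducts

variable {A : Type*} [CommRing A] {n : ℕ}

/-- The product `∏_{k < l} (s_l x_k - s_k x_l)`. -/
def pairProd (s x : Fin n → A) : A := ∏ k, ∏ l ∈ Finset.Ioi k, (s l * x k - s k * x l)

theorem map_pairProd {B : Type*} [CommRing B] (f : A →+* B) (s x : Fin n → A) :
    f (pairProd s x) = pairProd (fun i => f (s i)) fun i => f (x i) := by
  simp [pairProd]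

theorem prod_pairs_eq_prod_erase {M : Type*} [CommMonoid M] (i : Fin n) (g : Fin n → M) :
    (∏ k, ∏ l ∈ Finset.Ioi k, (if k = i then g l else 1) * (if l = i then g k else 1)) =
      ∏ j ∈ Finset.univ.erase i, g j := by
  simp only [Finset.prod_mul_distrib]
  have h1 : (∏ k, ∏ l ∈ Finset.Ioi k, if k = i then g l else 1) = ∏ l ∈ Finset.Ioi i, g l := by
    rw [Finset.prod_eq_single i]
    · simp
    · intro k _ hk
      simp [hk]
    · simp
  have h2 : (∏ k, ∏ l ∈ Finset.Ioi k, if l = i then g k else 1) = ∏ k ∈ Finset.Iio i, g k := by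
    rw [← Finset.prod_subset (Finset.subset_univ (Finset.Iio i))]
    · refine Finset.prod_congr rfl fun k hk => ?_
      rw [Finset.prod_ite_eq' (Finset.Ioi k) i fun _ => g k, if_pos (by simpa using hk)]
    · intro k _ hk
      rw [Finset.prod_ite_eq' (Finset.Ioi k) i fun _ => g k, if_neg (by simpa using hk)]
  rw [h1, h2, ← Finset.prod_union]
  · congr 1
    ext j
    simp only [Finset.mem_union, Finset.mem_Ioi, Finset.mem_Iio, Finset.mem_erase,
      Finset.mem_univ, and_true]
    exact ⟨fun h => h.elim (fun h => h.ne') (fun h => h.ne), fun h => (lt_or_gt_of_ne h).symm⟩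
  · rw [Finset.disjoint_left]
    intro j hj hj'
    exact absurd (Finset.mem_Ioi.1 hj) (Finset.mem_Iio.1 hj').not_gt

/-- Only pairs containing i change: i < l gives x_i - t x_l, and k < i gives -(x_i - t x_k), whose
sign is that of the Vandermonde factor x_k - x_i. So the quotient by the Vandermonde product is
∏_{j≠i} (x_i - t x_j)/(x_i - x_j). -/
theorem pairProd_update (t : A) (x : Fin n → A) (i : Fin n) :
    pairProd (Function.update 1 i t) x * ∏ j ∈ Finset.univ.erase i, (x i - x j) =
      pairProd 1 x * ∏ j ∈ Finset.univ.erase i, (x i - t * x j) := by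
  rw [← prod_pairs_eq_prod_erase i, ← prod_pairs_eq_prod_erase i, pairProd, pairProd]
  simp only [← Finset.prod_mul_distrib]
  refine Finset.prod_congr rfl fun k _ => Finset.prod_congr rfl fun l hl => ?_
  have hkl : k ≠ l := (Finset.mem_Ioi.1 hl).ne
  by_cases hk : k = i
  · subst hk
    simp [hkl.symm]
    ring
  · by_cases hl : l = i
    · subst hl
      simp [hkl]
      ring
    · simp [hk, hl, Function.update_of_ne]

theorem pairProd_one_ne_zero [IsDomain A] {x : Fin n → A} (hx : Function.Injective x) :
    pairProd 1 x ≠ 0 := by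
  rw [pairProd]
  refine Finset.prod_ne_zero_iff.2 fun k _ => Finset.prod_ne_zero_iff.2 fun l hl => ?_
  simp only [Pi.one_apply, one_mul]
  exact sub_ne_zero.2 fun h => (Finset.mem_Ioi.1 hl).ne (hx h)

end PairProducts

section Lagrange

open Polynomial in
theorem coeff_prod_one_sub {K ι : Type*} [CommRing K] (S : Finset ι) (a : ι → K) :
    (∏ j ∈ S, (1 - Polynomial.C (a j) * Polynomial.X)).coeff S.card = ∏ j ∈ S, -a j := by
  have h := Polynomial.coeff_prod_of_natDegree_le S
    (fun j => 1 - Polynomial.C (a j) * Polynomial.X) 1 (fun j _ => by compute_degree)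
  rw [mul_one] at h
  rw [h]
  refine Finset.prod_congr rfl fun j _ => ?_
  simp [Polynomial.coeff_one]

theorem natDegree_prod_one_sub_le {K ι : Type*} [CommRing K] (S : Finset ι) (a : ι → K) :
    (∏ j ∈ S, (1 - Polynomial.C (a j) * Polynomial.X)).natDegree ≤ S.card := by
  refine (Polynomial.natDegree_prod_le _ _).trans ?_
  rw [Finset.card_eq_sum_ones]
  exact Finset.sum_le_sum fun j _ => by compute_degree

/-- The partial fraction expansion of ∏ (1 - t x_j u)/(1 - x_j u), multiplied out. Both sides have
degree at most n in u and the same coefficient of u^n, so agreement at the n points u = 1/x_i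
suffices. -/
theorem prod_one_sub_eq_lagrange {K : Type*} [Field K] {n : ℕ} (t : K) {x : Fin n → K}
    (hx : Function.Injective x) (h0 : ∀ i, x i ≠ 0) :
    (∏ j, (1 - Polynomial.C (t * x j) * Polynomial.X)) =
      Polynomial.C (t ^ n) * ∏ j, (1 - Polynomial.C (x j) * Polynomial.X) +
      Polynomial.C (1 - t) * ∑ i, Polynomial.C (∏ j ∈ Finset.univ.erase i,
        (x i - t * x j) / (x i - x j)) *
          ∏ j ∈ Finset.univ.erase i, (1 - Polynomial.C (x j) * Polynomial.X) := by
  have hinj : Set.InjOn (fun i => (x i)⁻¹) (Finset.univ : Finset (Fin n)) :=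
    fun i _ j _ h => hx (inv_injective h)
  have hcard : (Finset.univ : Finset (Fin n)).card = n := by simp
  refine Polynomial.eq_of_degree_sub_lt_of_eval_index_eq (s := Finset.univ) (v := fun i => (x i)⁻¹)
    hinj ?_ fun i _ => ?_
  · rw [hcard, Polynomial.degree_lt_iff_coeff_zero]
    intro m hm
    have hlow : ∀ i : Fin n, (Polynomial.C (∏ j ∈ Finset.univ.erase i,
        (x i - t * x j) / (x i - x j)) * ∏ j ∈ Finset.univ.erase i,
          (1 - Polynomial.C (x j) * Polynomial.X)).coeff m = 0 := by
      intro i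
      rw [Polynomial.coeff_C_mul, Polynomial.coeff_eq_zero_of_natDegree_lt, mul_zero]
      refine (natDegree_prod_one_sub_le _ _).trans_lt ?_
      rw [Finset.card_erase_of_mem (Finset.mem_univ i), hcard]
      have := i.pos
      omega
    rw [Polynomial.coeff_sub, Polynomial.coeff_add, Polynomial.coeff_C_mul, Polynomial.coeff_C_mul,
      Polynomial.finsetSum_coeff, Finset.sum_eq_zero fun i _ => hlow i, mul_zero, add_zero]
    rcases eq_or_lt_of_le hm with rfl | hlt
    · have h1 := coeff_prod_one_sub Finset.univ fun j => t * x j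
      have h2 := coeff_prod_one_sub Finset.univ x
      rw [hcard] at h1 h2
      rw [h1, h2]
      simp [← mul_neg, Finset.prod_mul_distrib]
    · rw [Polynomial.coeff_eq_zero_of_natDegree_lt, Polynomial.coeff_eq_zero_of_natDegree_lt,
        mul_zero, sub_zero]
      · exact (natDegree_prod_one_sub_le _ _).trans_lt (by rwa [hcard])
      · exact (natDegree_prod_one_sub_le _ _).trans_lt (by rwa [hcard])
  · simp only [Polynomial.eval_prod, Polynomial.eval_add, Polynomial.eval_mul, Polynomial.eval_C,
      Polynomial.eval_finsetSum, Polynomial.eval_sub, Polynomial.eval_one, Polynomial.eval_X]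
    have hz : ∏ j, (1 - x j * (x i)⁻¹) = 0 :=
      Finset.prod_eq_zero (Finset.mem_univ i) (by rw [mul_inv_cancel₀ (h0 i), sub_self])
    rw [hz, mul_zero, zero_add, Finset.sum_eq_single i]
    · rw [← Finset.mul_prod_erase _ _ (Finset.mem_univ i), mul_assoc t, mul_inv_cancel₀ (h0 i),
        mul_one, ← Finset.prod_mul_distrib]
      congr 1
      refine Finset.prod_congr rfl fun j hj => ?_
      have : x i - x j ≠ 0 := sub_ne_zero.2 fun h => (Finset.ne_of_mem_erase hj) (hx h).symm
      have := h0 i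
      field_simp
    · intro k _ hk
      refine mul_eq_zero_of_right _ (Finset.prod_eq_zero (i := i)
        (Finset.mem_erase.2 ⟨hk.symm, Finset.mem_univ _⟩) ?_)
      rw [mul_inv_cancel₀ (h0 i), sub_self]
    · simp

variable {R : Type*} [CommRing R] [IsDomain R] {n : ℕ}

/-- The `i`-th coefficient of the Macdonald operator, multiplied by the Vandermonde product. -/
def macCoeff (t : R) (i : Fin n) : MvPolynomial (Fin n) R :=
  pairProd (Function.update 1 i (C t)) X

/-- The Vandermonde product. -/
def vand (R : Type*) [CommRing R] (n : ℕ) : MvPolynomial (Fin n) R := pairProd 1 X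

theorem vand_ne_zero : vand R n ≠ 0 := pairProd_one_ne_zero (X_injective)

/-- The Vandermonde product clears the denominators of the partial fractions, so the identity holds
already in a subring of a field, such as a polynomial ring. -/
theorem pairProd_mul_prod_one_sub_of_injective {n : ℕ} {A L : Type*} [CommRing A] [Field L]
    {f : A →+* L} (hfi : Function.Injective f) (t : A) {x : Fin n → A} (hx : Function.Injective x) (h0 : ∀ i, x i ≠ 0) :
    Polynomial.C (pairProd 1 x) * ∏ j, (1 - Polynomial.C (t * x j) * Polynomial.X) =
      Polynomial.C (pairProd 1 x * t ^ n) * ∏ j, (1 - Polynomial.C (x j) * Polynomial.X) +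
      ∑ i, Polynomial.C ((1 - t) * pairProd (Function.update 1 i t) x) *
        ∏ j ∈ Finset.univ.erase i, (1 - Polynomial.C (x j) * Polynomial.X) := by
  have hfx : Function.Injective fun i : Fin n => f (x i) := hfi.comp hx
  have hf0 : ∀ i : Fin n, f (x i) ≠ 0 := fun i => (map_ne_zero_iff f hfi).2 (h0 i)
  refine Polynomial.map_injective f hfi ?_
  have hW : ∀ i : Fin n, f (pairProd (Function.update 1 i t) x) =
      f (pairProd 1 x) * ∏ j ∈ Finset.univ.erase i,
        (f (x i) - f t * f (x j)) / (f (x i) - f (x j)) := by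
    intro i
    have h1 := congrArg f (pairProd_update t x i)
    simp only [map_mul, map_prod, map_sub] at h1
    have h2 : ∏ j ∈ Finset.univ.erase i, (f (x i) - f (x j)) ≠ 0 :=
      Finset.prod_ne_zero_iff.2 fun j hj =>
        sub_ne_zero.2 fun h => (Finset.ne_of_mem_erase hj) (hfx h).symm
    rw [Finset.prod_div_distrib, ← mul_div_assoc, eq_div_iff h2]
    exact h1
  have h3 := prod_one_sub_eq_lagrange (f t) hfx hf0
  simp only [Polynomial.map_mul, Polynomial.map_add, Polynomial.map_C, Polynomial.map_prod,
    Polynomial.map_sub, Polynomial.map_one, Polynomial.map_X, Polynomial.map_sum, Polynomial.map_pow,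
    map_mul, map_pow, map_sub, map_one, hW] at h3 ⊢
  rw [h3, Finset.mul_sum, mul_add, Finset.mul_sum]
  congr 1
  · ring
  · refine Finset.sum_congr rfl fun i _ => ?_
    ring

theorem pairProd_mul_prod_one_sub {n : ℕ} {A : Type*} [CommRing A] [IsDomain A] (t : A)
    {x : Fin n → A} (hx : Function.Injective x) (h0 : ∀ i, x i ≠ 0) :
    Polynomial.C (pairProd 1 x) * ∏ j, (1 - Polynomial.C (t * x j) * Polynomial.X) =
      Polynomial.C (pairProd 1 x * t ^ n) * ∏ j, (1 - Polynomial.C (x j) * Polynomial.X) +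
      ∑ i, Polynomial.C ((1 - t) * pairProd (Function.update 1 i t) x) *
        ∏ j ∈ Finset.univ.erase i, (1 - Polynomial.C (x j) * Polynomial.X) :=
  pairProd_mul_prod_one_sub_of_injective (IsFractionRing.injective A (FractionRing A)) t hx h0

end Lagrange

section Series

variable {A : Type*} [CommRing A] [Algebra ℚ A]

theorem mk_expCoeff_mul (s s' : ℕ → A) :
    PowerSeries.mk (expCoeff s) * PowerSeries.mk (expCoeff s') =
      PowerSeries.mk (expCoeff fun r => s r + s' r) := by
  refine mk_expCoeff_eq (by simp) ?_
  rw [Derivation.leibniz, derivative_mk_expCoeff, derivative_mk_expCoeff, smul_eq_mul, smul_eq_mul]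
  have : PowerSeries.mk (fun r => s r + s' r) = PowerSeries.mk s + PowerSeries.mk s' := by
    ext; simp
  rw [this]
  ring

theorem one_sub_eq_mk_expCoeff (a : A) :
    1 - PowerSeries.C a * PowerSeries.X = PowerSeries.mk (expCoeff fun r => -a ^ (r + 1)) := by
  refine mk_expCoeff_eq (by simp) ?_
  ext k
  rw [PowerSeries.coeff_derivative, mul_sub, mul_one, ← mul_assoc, map_sub, map_sub]
  cases k with
  | zero => simp [mul_comm, PowerSeries.coeff_one]
  | succ k =>
    rw [PowerSeries.coeff_succ_mul_X, PowerSeries.coeff_succ_mul_X,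
      mul_comm (PowerSeries.mk _), PowerSeries.coeff_C_mul]
    simp [PowerSeries.coeff_one, pow_succ]
    ring

theorem prod_one_sub_eq_mk_expCoeff {ι : Type*} (S : Finset ι) (a : ι → A) :
    ∏ j ∈ S, (1 - PowerSeries.C (a j) * PowerSeries.X) =
      PowerSeries.mk (expCoeff fun r => -∑ j ∈ S, a j ^ (r + 1)) := by
  classical
  induction S using Finset.induction_on with
  | empty =>
    rw [Finset.prod_empty]
    refine mk_expCoeff_eq (by simp) ?_
    ext
    simp
  | insert i S hi ih =>
    rw [Finset.prod_insert hi, ih, one_sub_eq_mk_expCoeff, mk_expCoeff_mul]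
    simp only [Finset.sum_insert hi, neg_add]

theorem mk_expCoeff_zero : PowerSeries.mk (expCoeff fun _ => (0 : A)) = 1 := by
  symm
  refine mk_expCoeff_eq (by simp) ?_
  ext
  simp

omit [Algebra ℚ A] in
theorem one_sub_mul_mk_pow (a : A) :
    (1 - PowerSeries.C a * PowerSeries.X) * PowerSeries.mk (fun k => a ^ k) = 1 := by
  ext k
  rw [sub_mul, one_mul, mul_assoc, map_sub, PowerSeries.coeff_C_mul]
  cases k with
  | zero => simp
  | succ k => simp [PowerSeries.coeff_succ_X_mul, PowerSeries.coeff_one, pow_succ, mul_comm]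

/-- The exponential of ∑ (1 - t^r) p_r u^r / r is ∏ (1 - t x_j u)/(1 - x_j u). In its partial
fractions each 1/(1 - x_i u) is a geometric series, and the constant t^n is seen by k = 0 only. -/
theorem pairProd_mul_expCoeff {A : Type*} [CommRing A] [Algebra ℚ A] [IsDomain A] {n : ℕ} (t : A)
    {x : Fin n → A} (hx : Function.Injective x) (h0 : ∀ i, x i ≠ 0) (k : ℕ) :
    pairProd 1 x * expCoeff (fun r => (1 - t ^ (r + 1)) * ∑ j, x j ^ (r + 1)) k =
      (if k = 0 then pairProd 1 x * t ^ n else 0) +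
        ∑ i, (1 - t) * pairProd (Function.update 1 i t) x * x i ^ k := by
  set H := PowerSeries.mk (expCoeff fun r => (1 - t ^ (r + 1)) * ∑ j, x j ^ (r + 1)) with hH
  set D := ∏ j, (1 - PowerSeries.C (x j) * PowerSeries.X) with hD
  have hDmk : D = PowerSeries.mk (expCoeff fun r => -∑ j, x j ^ (r + 1)) := by
    rw [hD, prod_one_sub_eq_mk_expCoeff]
  have hN : D * H = ∏ j, (1 - PowerSeries.C (t * x j) * PowerSeries.X) := by
    rw [prod_one_sub_eq_mk_expCoeff, hDmk, hH, mk_expCoeff_mul]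
    congr 2
    ext1 r
    simp only [mul_pow, ← Finset.mul_sum]
    ring
  have hDu : PowerSeries.mk (expCoeff fun r => ∑ j, x j ^ (r + 1)) * D = 1 := by
    rw [hDmk, mk_expCoeff_mul]
    simp only [add_neg_cancel]
    exact mk_expCoeff_zero
  have hpoly := congrArg (Polynomial.coeToPowerSeries.ringHom (R := A))
    (pairProd_mul_prod_one_sub t hx h0)
  simp only [map_mul (Polynomial.coeToPowerSeries.ringHom), map_add, map_sum, map_prod, map_sub,
    map_one, Polynomial.coeToPowerSeries.ringHom_apply, Polynomial.coe_C, Polynomial.coe_X] at hpoly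
  have hgeom : ∀ i, D * PowerSeries.mk (fun k => x i ^ k) =
      ∏ j ∈ Finset.univ.erase i, (1 - PowerSeries.C (x j) * PowerSeries.X) := by
    intro i
    rw [hD, ← Finset.mul_prod_erase _ _ (Finset.mem_univ i), mul_right_comm, one_sub_mul_mk_pow,
      one_mul]
  have key : PowerSeries.C (pairProd 1 x) * H = PowerSeries.C (pairProd 1 x * t ^ n) +
      ∑ i, PowerSeries.C ((1 - t) * pairProd (Function.update 1 i t) x) *
        PowerSeries.mk (fun k => x i ^ k) := by
    have h1 : D * (PowerSeries.C (pairProd 1 x) * H) = D * (PowerSeries.C (pairProd 1 x * t ^ n) +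
        ∑ i, PowerSeries.C ((1 - t) * pairProd (Function.update 1 i t) x) *
          PowerSeries.mk (fun k => x i ^ k)) := by
      rw [mul_left_comm, hN, hpoly, mul_add, Finset.mul_sum, mul_comm D]
      congr 1
      refine Finset.sum_congr rfl fun i _ => ?_
      rw [mul_left_comm, hgeom]
    have h2 := congrArg
      (fun Y => PowerSeries.mk (expCoeff fun r => ∑ j, x j ^ (r + 1)) * Y) h1
    simpa only [← mul_assoc, hDu, one_mul] using h2
  have h3 := congrArg (PowerSeries.coeff k) key
  rw [PowerSeries.coeff_C_mul, hH, PowerSeries.coeff_mk, map_add, map_sum,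
    PowerSeries.coeff_C] at h3
  simpa only [PowerSeries.coeff_C_mul, PowerSeries.coeff_mk] using h3

end Series

section MacOp

variable {R : Type*} [CommRing R] [Algebra ℚ R] [IsDomain R] {n : ℕ}

theorem vand_mul_ev_expFun (t : R) (k : ℕ) :
    vand R n * ev R n (expFun (fun r => 1 - t ^ (r + 1)) k) =
      (if k = 0 then vand R n * C t ^ n else 0) +
        ∑ i, (1 - C t) * macCoeff t i * X i ^ k := by
  have hev : ev R n (expFun (fun r => 1 - t ^ (r + 1)) k) =
      expCoeff (fun r => (1 - C t ^ (r + 1)) * ∑ j : Fin n, X j ^ (r + 1)) k := by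
    rw [expFun]
    refine (map_expCoeff (ev R n : MvPolynomial ℕ R →+* MvPolynomial (Fin n) R) _ k).trans ?_
    simp [psum]
  rw [hev]
  exact pairProd_mul_expCoeff (C t) X_injective X_ne_zero k

/-- The substitution `x_i ↦ ρ x_i`. -/
def scaleVar (ρ : R) (i : Fin n) : MvPolynomial (Fin n) R →ₐ[R] MvPolynomial (Fin n) R :=
  aeval (Function.update X i (C ρ * X i))

-- At u = x_i the shift is p_r ↦ p_r + (ρ^r - 1) x_i^r, which is the effect of x_i ↦ ρ x_i on power
-- sums.
omit [Algebra ℚ R] [IsDomain R] in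
theorem eval_map_shift (ρ : R) (i : Fin n) (F : MvPolynomial ℕ R) :
    ((shift (fun r => ρ ^ (r + 1) - 1) F).map
      (ev R n : MvPolynomial ℕ R →+* MvPolynomial (Fin n) R)).eval (X i) =
        scaleVar ρ i (ev R n F) := by
  induction F using MvPolynomial.induction_on with
  | C x => simp [scaleVar, algebraMap_eq]
  | add F G hF hG => simp only [map_add, Polynomial.map_add, Polynomial.eval_add, hF, hG]
  | mul_X F r hF =>
    rw [map_mul, Polynomial.map_mul, Polynomial.eval_mul, hF, map_mul, map_mul]
    congr 1
    have h1 : scaleVar ρ i (psum (Fin n) R (r + 1)) =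
        psum (Fin n) R (r + 1) + (C ρ ^ (r + 1) - 1) * X i ^ (r + 1) := by
      rw [psum, map_sum, ← Finset.add_sum_erase _ _ (Finset.mem_univ i),
        ← Finset.add_sum_erase _ _ (Finset.mem_univ i)]
      have h2 : ∀ j ∈ Finset.univ.erase i, scaleVar ρ i (X j ^ (r + 1)) = X j ^ (r + 1) := by
        intro j hj
        rw [map_pow, scaleVar, aeval_X, Function.update_of_ne (Finset.ne_of_mem_erase hj)]
      rw [Finset.sum_congr rfl h2, map_pow, scaleVar, aeval_X, Function.update_self]
      ring
    rw [ev_X, h1]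
    simp

/-- The part of g_k belonging to i is a multiple of x_i^k. Summing over k against φ_k F evaluates
the shift at u = x_i, that is, rescales x_i; the additional term of g_0 gives t^n. -/
theorem vand_mul_ev_macOp (ρ t : R) (F : MvPolynomial ℕ R) :
    vand R n * ev R n (macOp ρ t F) = C t ^ n * (vand R n * ev R n F) +
      ∑ i, (1 - C t) * macCoeff t i * scaleVar ρ i (ev R n F) := by
  set f := (shift (fun r => ρ ^ (r + 1) - 1) F).map
    (ev R n : MvPolynomial ℕ R →+* MvPolynomial (Fin n) R) with hf
  set N := max (shift (fun r => ρ ^ (r + 1) - 1) F).natDegree f.natDegree + 1 with hN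
  have hfk : ∀ k, ev R n ((shift (fun r => ρ ^ (r + 1) - 1) F).coeff k) = f.coeff k := by
    intro k
    rw [hf, Polynomial.coeff_map]
    rfl
  have h0 : f.coeff 0 = ev R n F := by rw [← hfk, coeff_zero_shift]
  rw [macOp_eq_sum ρ t F (N := N) (by omega), map_sum, Finset.mul_sum]
  have h1 : ∀ k ∈ Finset.range N, vand R n * ev R n (expFun (fun r => 1 - t ^ (r + 1)) k *
      (shift (fun r => ρ ^ (r + 1) - 1) F).coeff k) =
      (if k = 0 then C t ^ n * (vand R n * ev R n F) else 0) +
        ∑ i, (1 - C t) * macCoeff t i * (f.coeff k * X i ^ k) := by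
    intro k _
    rw [map_mul, ← mul_assoc, vand_mul_ev_expFun, hfk, add_mul, Finset.sum_mul]
    congr 1
    · split_ifs with hk
      · subst hk
        rw [h0]
        ring
      · rw [zero_mul]
    · exact Finset.sum_congr rfl fun i _ => by ring
  rw [Finset.sum_congr rfl h1, Finset.sum_add_distrib, Finset.sum_ite_eq',
    if_pos (by simp [hN]), Finset.sum_comm]
  congr 1
  refine Finset.sum_congr rfl fun i _ => ?_
  rw [← Finset.mul_sum, ← eval_map_shift, ← hf, Polynomial.eval_eq_sum_range' (n := N) (by omega)]

end MacOp

end MacSym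
end

/-! ### Weighted degrees and leading terms of the operator. -/

noncomputable section

namespace MacSym

open MvPolynomial

/-! ### Degrees with respect to a weight -/

section Weight

variable {R : Type*} [CommRing R] {n : ℕ}

/-- The weight of an exponent vector. -/
def wt (w : Fin n → ℕ) (e : Fin n →₀ ℕ) : ℕ := ∑ i, w i * e i

/-- The substitution `x_i ↦ x_i Y ^ {w i}`. -/
def wsub (w : Fin n → ℕ) : MvPolynomial (Fin n) R →ₐ[R] Polynomial (MvPolynomial (Fin n) R) :=
  aeval fun i => Polynomial.C (X i) * Polynomial.X ^ w i

theorem wsub_X (w : Fin n → ℕ) (i : Fin n) :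
    wsub w (X i : MvPolynomial (Fin n) R) = Polynomial.C (X i) * Polynomial.X ^ w i :=
  aeval_X _ _

theorem wsub_C (w : Fin n → ℕ) (x : R) :
    wsub w (C x : MvPolynomial (Fin n) R) = Polynomial.C (C x) := algHom_C _ _

theorem wsub_monomial (w : Fin n → ℕ) (e : Fin n →₀ ℕ) (x : R) :
    wsub w (monomial e x) = Polynomial.monomial (wt w e) (monomial e x) := by
  rw [wsub, aeval_monomial, Finsupp.prod_fintype _ _ (by simp)]
  have h : ∀ i, (Polynomial.C (X i : MvPolynomial (Fin n) R) * Polynomial.X ^ w i) ^ e i =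
      Polynomial.C (X i ^ e i) * Polynomial.X ^ (w i * e i) := by
    intro i
    rw [mul_pow, ← pow_mul, Polynomial.C_pow]
  simp only [h, Finset.prod_mul_distrib]
  rw [Finset.prod_pow_eq_pow_sum, ← map_prod, ← wt, ← Polynomial.C_mul_X_pow_eq_monomial, ← mul_assoc]
  congr 1
  rw [IsScalarTower.algebraMap_apply R (MvPolynomial (Fin n) R) (Polynomial _),
    Polynomial.algebraMap_eq, ← Polynomial.C_mul, algebraMap_eq, monomial_eq,
    Finsupp.prod_fintype _ _ (by simp)]

theorem coeff_coeff_wsub (w : Fin n → ℕ) (g : MvPolynomial (Fin n) R) (d : ℕ) (e : Fin n →₀ ℕ) :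
    coeff e ((wsub w g).coeff d) = if wt w e = d then coeff e g else 0 := by
  classical
  induction g using MvPolynomial.induction_on' with
  | monomial a x =>
    rw [wsub_monomial, Polynomial.coeff_monomial]
    by_cases h : a = e
    · subst h
      split_ifs <;> simp
    · split_ifs <;> simp [coeff_monomial, h]
  | add f g hf hg =>
    rw [map_add, Polynomial.coeff_add, coeff_add, hf, hg, coeff_add]
    split_ifs <;> simp

/-- The weighted degree becomes the degree in one auxiliary variable. Over a domain that degree is
additive, so the Vandermonde factor can be cancelled in estimates. -/
theorem natDegree_wsub_le_iff (w : Fin n → ℕ) (g : MvPolynomial (Fin n) R) (d : ℕ) :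
    (wsub w g).natDegree ≤ d ↔ ∀ e, coeff e g ≠ 0 → wt w e ≤ d := by
  rw [Polynomial.natDegree_le_iff_coeff_eq_zero]
  constructor
  · intro h e he
    by_contra hlt
    have h1 := congrArg (coeff e) (h (wt w e) (not_le.1 hlt))
    rw [coeff_coeff_wsub, if_pos rfl, coeff_zero] at h1
    exact he h1
  · intro h N hN
    ext e
    rw [coeff_coeff_wsub, coeff_zero]
    split_ifs with he
    · by_contra h0
      exact absurd (h e h0) (by omega)
    · rfl

theorem eval_one_wsub (w : Fin n → ℕ) (g : MvPolynomial (Fin n) R) :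
    (wsub w g).eval 1 = g := by
  induction g using MvPolynomial.induction_on with
  | C x => simp
  | add f g hf hg => rw [map_add, Polynomial.eval_add, hf, hg]
  | mul_X f i hf => rw [map_mul, Polynomial.eval_mul, hf]; simp [wsub_X]

theorem wsub_ne_zero (w : Fin n → ℕ) {g : MvPolynomial (Fin n) R} (hg : g ≠ 0) :
    wsub w g ≠ 0 := by
  intro h
  apply hg
  rw [← eval_one_wsub w g, h, Polynomial.eval_zero]

theorem coeff_scaleVar (ρ : R) (i : Fin n) (g : MvPolynomial (Fin n) R) (e : Fin n →₀ ℕ) :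
    coeff e (scaleVar ρ i g) = ρ ^ e i * coeff e g := by
  classical
  induction g using MvPolynomial.induction_on' with
  | monomial a x =>
    have h : scaleVar ρ i (monomial a x) = C (ρ ^ a i) * monomial a x := by
      rw [scaleVar, aeval_monomial, monomial_eq, Finsupp.prod_fintype _ _ (by simp),
        Finsupp.prod_fintype _ _ (by simp), ← Finset.mul_prod_erase _ _ (Finset.mem_univ i),
        ← Finset.mul_prod_erase _ (fun j => X j ^ a j) (Finset.mem_univ i),
        Function.update_self, mul_pow, algebraMap_eq, C_pow,
        Finset.prod_congr rfl fun j hj => by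
          rw [Function.update_of_ne (Finset.ne_of_mem_erase hj)]]
      ring
    rw [h, coeff_C_mul, coeff_monomial]
    split_ifs with h'
    · rw [h']
    · simp
  | add f g hf hg => rw [map_add, coeff_add, coeff_add, hf, hg, mul_add]

/-- The total degree of the pair product in the weight `w`. -/
def pairDeg (w : Fin n → ℕ) : ℕ := ∑ k, ∑ _l ∈ Finset.Ioi k, w k

theorem wsub_pairProd (w : Fin n → ℕ) (s : Fin n → R) :
    wsub w (pairProd (fun i => C (s i)) X) = ∏ k, ∏ l ∈ Finset.Ioi k,
      (Polynomial.C (C (s l) * X k) * Polynomial.X ^ w k -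
        Polynomial.C (C (s k) * X l) * Polynomial.X ^ w l) := by
  simp only [pairProd, map_prod, map_sub, map_mul, wsub_C, wsub_X]
  simp only [mul_assoc]

theorem natDegree_factor_le {w : Fin n → ℕ} (hw : Antitone w) (a b : MvPolynomial (Fin n) R)
    {k l : Fin n} (hkl : k < l) :
    (Polynomial.C a * Polynomial.X ^ w k - Polynomial.C b * Polynomial.X ^ w l).natDegree ≤ w k :=
  (Polynomial.natDegree_sub_le _ _).trans (max_le (Polynomial.natDegree_C_mul_X_pow_le _ _)
    ((Polynomial.natDegree_C_mul_X_pow_le _ _).trans (hw hkl.le)))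

theorem natDegree_wsub_pairProd_le {w : Fin n → ℕ} (hw : Antitone w) (s : Fin n → R) :
    (wsub w (pairProd (fun i => C (s i)) X)).natDegree ≤ pairDeg w := by
  rw [wsub_pairProd]
  refine (Polynomial.natDegree_prod_le _ _).trans (Finset.sum_le_sum fun k _ => ?_)
  refine (Polynomial.natDegree_prod_le _ _).trans (Finset.sum_le_sum fun l hl => ?_)
  exact natDegree_factor_le hw _ _ (Finset.mem_Ioi.1 hl)

theorem macCoeff_eq (t : R) (i : Fin n) :
    macCoeff t i = pairProd (fun j => C (Function.update (1 : Fin n → R) i t j)) X := by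
  rw [macCoeff]
  congr 1
  ext1 j
  by_cases h : j = i
  · subst h; simp
  · simp [Function.update_of_ne h]

theorem vand_eq : vand R n = pairProd (fun _ => C 1) X := by
  rw [vand]
  congr 1

variable [IsDomain R]

/-- Every factor has degree exactly w_k, even if w_k = w_l, where the top coefficient X_k - X_l is
still nonzero. An upper bound would not be enough to cancel the product. -/
theorem natDegree_wsub_vand {w : Fin n → ℕ} (hw : Antitone w) :
    (wsub w (vand R n)).natDegree = pairDeg w := by
  have hne : ∀ k, ∀ l ∈ Finset.Ioi k,
      (Polynomial.C (C (1 : R) * X k) * Polynomial.X ^ w k -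
        Polynomial.C (C (1 : R) * X l) * Polynomial.X ^ w l).coeff (w k) ≠ 0 := by
    intro k l hl
    have hkl : k ≠ l := (Finset.mem_Ioi.1 hl).ne
    simp only [C_1, one_mul, Polynomial.coeff_sub, Polynomial.coeff_C_mul, Polynomial.coeff_X_pow,
      if_true, mul_one, mul_ite, mul_zero]
    split_ifs
    · exact sub_ne_zero.2 fun h => hkl (X_injective h)
    · rw [sub_zero]
      exact X_ne_zero k
  have hdeg : ∀ k, ∀ l ∈ Finset.Ioi k,
      (Polynomial.C (C (1 : R) * X k) * Polynomial.X ^ w k -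
        Polynomial.C (C (1 : R) * X l) * Polynomial.X ^ w l).natDegree = w k :=
    fun k l hl => Polynomial.natDegree_eq_of_le_of_coeff_ne_zero
      (natDegree_factor_le hw _ _ (Finset.mem_Ioi.1 hl)) (hne k l hl)
  have h0 : ∀ k, ∀ l ∈ Finset.Ioi k,
      (Polynomial.C (C (1 : R) * X k) * Polynomial.X ^ w k -
        Polynomial.C (C (1 : R) * X l) * Polynomial.X ^ w l) ≠ 0 := by
    intro k l hl h
    exact hne k l hl (by rw [h, Polynomial.coeff_zero])
  rw [vand_eq, wsub_pairProd, Polynomial.natDegree_prod _ _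
    fun k _ => Finset.prod_ne_zero_iff.2 (h0 k), pairDeg]
  refine Finset.sum_congr rfl fun k _ => ?_
  rw [Polynomial.natDegree_prod _ _ (h0 k)]
  exact Finset.sum_congr rfl (hdeg k)

omit [IsDomain R] in
theorem natDegree_wsub_scaleVar_le {w : Fin n → ℕ} {g : MvPolynomial (Fin n) R} {d : ℕ}
    (h : (wsub w g).natDegree ≤ d) (ρ : R) (i : Fin n) :
    (wsub w (scaleVar ρ i g)).natDegree ≤ d := by
  rw [natDegree_wsub_le_iff] at h ⊢
  intro e he
  rw [coeff_scaleVar] at he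
  exact h e (right_ne_zero_of_mul he)

variable [Algebra ℚ R]

omit [IsDomain R] [Algebra ℚ R] in
theorem natDegree_C_mul_le' {w : Fin n → ℕ} {g : MvPolynomial (Fin n) R} {d : ℕ}
    (h : (wsub w g).natDegree ≤ d) (x : R) : (wsub w (C x * g)).natDegree ≤ d := by
  rw [map_mul, wsub_C]
  exact (Polynomial.natDegree_C_mul_le _ _).trans h

/-- The coefficients `macCoeff` have at most the degree of the Vandermonde product, and rescaling a
variable creates no new monomials. -/
theorem natDegree_wsub_ev_macOp_le {w : Fin n → ℕ} (hw : Antitone w) (ρ t : R)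
    {F : MvPolynomial ℕ R} {d : ℕ} (h : (wsub w (ev R n F)).natDegree ≤ d) :
    (wsub w (ev R n (macOp ρ t F))).natDegree ≤ d := by
  by_cases h0 : ev R n (macOp ρ t F) = 0
  · rw [h0, map_zero]
    simp
  have h1 := congrArg (fun g => (wsub w g).natDegree) (vand_mul_ev_macOp (n := n) ρ t F)
  rw [map_mul, Polynomial.natDegree_mul (wsub_ne_zero w vand_ne_zero) (wsub_ne_zero w h0),
    natDegree_wsub_vand hw] at h1
  have h2 : (wsub w (C t ^ n * (vand R n * ev R n F) +
      ∑ i, (1 - C t) * macCoeff t i * scaleVar ρ i (ev R n F))).natDegree ≤ pairDeg w + d := by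
    rw [map_add, map_sum]
    refine (Polynomial.natDegree_add_le _ _).trans (max_le ?_
      (Polynomial.natDegree_sum_le_of_forall_le _ _ fun i _ => ?_))
    · rw [← C_pow]
      refine natDegree_C_mul_le' ?_ _
      rw [map_mul]
      exact Polynomial.natDegree_mul_le.trans (add_le_add (natDegree_wsub_vand hw).le h)
    · rw [mul_assoc, ← C_1, ← C_sub]
      refine natDegree_C_mul_le' ?_ _
      rw [map_mul, macCoeff_eq]
      exact Polynomial.natDegree_mul_le.trans (add_le_add (natDegree_wsub_pairProd_le hw _)
        (natDegree_wsub_scaleVar_le h ρ i))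
  omega

/-! ### Homogeneity -/

omit [IsDomain R] [Algebra ℚ R] in
theorem wsub_one_pairProd (s : Fin n → R) :
    wsub 1 (pairProd (fun i => C (s i)) X) =
      Polynomial.C (pairProd (fun i => C (s i)) X) *
        Polynomial.X ^ (∑ k : Fin n, (Finset.Ioi k).card) := by
  rw [wsub_pairProd, pairProd, map_prod, ← Finset.prod_pow_eq_pow_sum, ← Finset.prod_mul_distrib]
  refine Finset.prod_congr rfl fun k _ => ?_
  rw [map_prod, ← Finset.prod_const, ← Finset.prod_mul_distrib]
  refine Finset.prod_congr rfl fun l _ => ?_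
  simp only [Pi.one_apply, pow_one, Polynomial.C_sub]
  ring

omit [IsDomain R] [Algebra ℚ R] in
theorem wsub_one_eq_iff (g : MvPolynomial (Fin n) R) (d : ℕ) :
    wsub 1 g = Polynomial.C g * Polynomial.X ^ d ↔ ∀ e, coeff e g ≠ 0 → wt 1 e = d := by
  constructor
  · intro h e he
    have h1 := congrArg (fun p => coeff e (p.coeff d)) h
    simp only [coeff_coeff_wsub, Polynomial.coeff_C_mul_X_pow, if_true] at h1
    by_contra h2
    rw [if_neg h2] at h1
    exact he h1.symm
  · intro h
    ext j e
    rw [coeff_coeff_wsub, Polynomial.coeff_C_mul_X_pow]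
    by_cases he : coeff e g = 0
    · split_ifs <;> simp [he]
    · rw [h e he]
      by_cases hj : j = d
      · simp [hj]
      · simp [hj, Ne.symm hj]

theorem wsub_one_ev_macOp (ρ t : R) {F : MvPolynomial ℕ R} {d : ℕ}
    (h : wsub 1 (ev R n F) = Polynomial.C (ev R n F) * Polynomial.X ^ d) :
    wsub 1 (ev R n (macOp ρ t F)) =
      Polynomial.C (ev R n (macOp ρ t F)) * Polynomial.X ^ d := by
  have h1 : ∀ i : Fin n, wsub 1 (scaleVar ρ i (ev R n F)) =
      Polynomial.C (scaleVar ρ i (ev R n F)) * Polynomial.X ^ d := by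
    intro i
    rw [wsub_one_eq_iff] at h ⊢
    intro e he
    rw [coeff_scaleVar] at he
    exact h e (right_ne_zero_of_mul he)
  have hne : Polynomial.C (vand R n) *
      Polynomial.X ^ (∑ k : Fin n, (Finset.Ioi k).card) ≠ 0 :=
    mul_ne_zero (Polynomial.C_ne_zero.2 vand_ne_zero) (pow_ne_zero _ Polynomial.X_ne_zero)
  refine mul_left_cancel₀ hne ?_
  have hv : wsub 1 (vand R n) = Polynomial.C (vand R n) *
      Polynomial.X ^ (∑ k : Fin n, (Finset.Ioi k).card) := by
    rw [vand_eq, wsub_one_pairProd]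
  have hm : ∀ i : Fin n, wsub 1 (macCoeff t i) = Polynomial.C (macCoeff t i) *
      Polynomial.X ^ (∑ k : Fin n, (Finset.Ioi k).card) := by
    intro i
    rw [macCoeff_eq, wsub_one_pairProd]
  have hkey := vand_mul_ev_macOp (n := n) ρ t F
  rw [← hv, ← map_mul, hkey, hv, mul_mul_mul_comm, ← Polynomial.C_mul, hkey, Polynomial.C_add,
    add_mul, map_add]
  congr 1
  · simp only [map_mul, map_pow, wsub_C, hv, h]
    ring
  · rw [map_sum, map_sum, Finset.sum_mul]
    refine Finset.sum_congr rfl fun i _ => ?_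
    simp only [map_mul, map_sub, map_one, wsub_C, hm, h1]
    ring

/-! ### Leading coefficients -/

-- For strictly decreasing weights each factor has the single leading term s_l x_k, so the whole
-- product has a single leading monomial.
omit [Algebra ℚ R] in
theorem coeff_pairDeg_wsub_pairProd {w : Fin n → ℕ} (hw : StrictAnti w) {s : Fin n → R}
    (hs : ∀ i, s i ≠ 0) :
    (wsub w (pairProd (fun i => C (s i)) X)).coeff (pairDeg w) =
      ∏ k, ∏ l ∈ Finset.Ioi k, (C (s l) * X k) := by
  have hcoeff : ∀ k, ∀ l ∈ Finset.Ioi k, (Polynomial.C (C (s l) * X k) * Polynomial.X ^ w k -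
      Polynomial.C (C (s k) * X l) * Polynomial.X ^ w l).coeff (w k) = C (s l) * X k := by
    intro k l hl
    have : w l < w k := hw (Finset.mem_Ioi.1 hl)
    rw [Polynomial.coeff_sub, Polynomial.coeff_C_mul_X_pow, Polynomial.coeff_C_mul_X_pow,
      if_pos rfl, if_neg this.ne', sub_zero]
  have hX : ∀ k l : Fin n, (C (s l) * X k : MvPolynomial (Fin n) R) ≠ 0 := fun k l =>
    mul_ne_zero (C_ne_zero.2 (hs l)) (X_ne_zero k)
  have hdeg : ∀ k, ∀ l ∈ Finset.Ioi k, (Polynomial.C (C (s l) * X k) * Polynomial.X ^ w k -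
      Polynomial.C (C (s k) * X l) * Polynomial.X ^ w l).natDegree = w k := fun k l hl =>
    Polynomial.natDegree_eq_of_le_of_coeff_ne_zero
      (natDegree_factor_le hw.antitone _ _ (Finset.mem_Ioi.1 hl)) (by
        rw [hcoeff k l hl]
        exact hX k l)
  have h0 : ∀ k, ∀ l ∈ Finset.Ioi k, (Polynomial.C (C (s l) * X k) * Polynomial.X ^ w k -
      Polynomial.C (C (s k) * X l) * Polynomial.X ^ w l) ≠ 0 := by
    intro k l hl h
    refine hX k l ?_
    rw [← hcoeff k l hl, h, Polynomial.coeff_zero]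
  have hd : (wsub w (pairProd (fun i => C (s i)) X)).natDegree = pairDeg w := by
    rw [wsub_pairProd, Polynomial.natDegree_prod _ _
      fun k _ => Finset.prod_ne_zero_iff.2 (h0 k), pairDeg]
    refine Finset.sum_congr rfl fun k _ => ?_
    rw [Polynomial.natDegree_prod _ _ (h0 k)]
    exact Finset.sum_congr rfl (hdeg k)
  rw [← hd, Polynomial.coeff_natDegree, wsub_pairProd, Polynomial.leadingCoeff_prod]
  refine Finset.prod_congr rfl fun k _ => ?_
  rw [Polynomial.leadingCoeff_prod]
  refine Finset.prod_congr rfl fun l hl => ?_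
  rw [← Polynomial.coeff_natDegree, hdeg k l hl, hcoeff k l hl]

omit [IsDomain R] [Algebra ℚ R] in
theorem prod_update_pairs (t : R) (i : Fin n) :
    (∏ k : Fin n, ∏ l ∈ Finset.Ioi k, (Function.update (1 : Fin n → R) i t l)) = t ^ (i : ℕ) := by
  have h : ∀ k : Fin n, ∏ l ∈ Finset.Ioi k, (Function.update (1 : Fin n → R) i t l) =
      if k ∈ Finset.Iio i then t else 1 := by
    intro k
    have h1 : ∀ l, Function.update (1 : Fin n → R) i t l = if l = i then t else 1 := by
      intro l
      by_cases hl : l = i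
      · subst hl; simp
      · simp [hl]
    simp only [h1]
    rw [Finset.prod_ite_eq' (Finset.Ioi k) i fun _ => t]
    simp
  simp only [h]
  rw [Finset.prod_ite_mem, Finset.univ_inter, Finset.prod_const, Fin.card_Iio]

/-- Compare the coefficients of δ x^a, with δ the leading monomial of the Vandermonde product. The
leading term of the i-th coefficient is t^i δ, counting i from 0: one factor t for each pair k < i.
-/
theorem coeff_ev_macOp {w : Fin n → ℕ} (hw : StrictAnti w) (ρ : R) {t : R} (ht : t ≠ 0)
    {F : MvPolynomial ℕ R} {a : Fin n →₀ ℕ} (h : ∀ e, coeff e (ev R n F) ≠ 0 → wt w e ≤ wt w a) :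
    coeff a (ev R n (macOp ρ t F)) =
      (t ^ n + (1 - t) * ∑ i : Fin n, t ^ (i : ℕ) * ρ ^ a i) * coeff a (ev R n F) := by
  rw [← natDegree_wsub_le_iff] at h
  set δ : MvPolynomial (Fin n) R := ∏ k, ∏ l ∈ Finset.Ioi k, X k with hδ
  have hδm : ∃ b, δ = monomial b 1 := by
    refine ⟨∑ k, ∑ l ∈ Finset.Ioi k, Finsupp.single k 1, ?_⟩
    rw [monomial_sum_one]
    refine Finset.prod_congr rfl fun k _ => ?_
    rw [monomial_sum_one]
    rfl
  obtain ⟨b, hb⟩ := hδm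
  have hv : (wsub w (vand R n)).coeff (pairDeg w) = δ := by
    rw [vand_eq, coeff_pairDeg_wsub_pairProd hw (s := fun _ => (1 : R)) (fun _ => one_ne_zero), hδ]
    simp
  have hm : ∀ i : Fin n, (wsub w (macCoeff t i)).coeff (pairDeg w) = C (t ^ (i : ℕ)) * δ := by
    intro i
    rw [macCoeff_eq, coeff_pairDeg_wsub_pairProd hw, hδ, ← prod_update_pairs t i]
    · simp only [Finset.prod_mul_distrib, map_prod]
    · intro j
      by_cases hj : j = i
      · subst hj; simpa using ht
      · simp [Function.update_of_ne hj]
  have htop : ∀ f g : MvPolynomial (Fin n) R, (wsub w f).natDegree ≤ pairDeg w →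
      (wsub w g).natDegree ≤ wt w a → (wsub w (f * g)).coeff (pairDeg w + wt w a) =
        (wsub w f).coeff (pairDeg w) * (wsub w g).coeff (wt w a) := by
    intro f g hf hg
    rw [map_mul, Polynomial.coeff_mul_add_eq_of_natDegree_le hf hg]
  have hvd := (natDegree_wsub_vand (R := R) hw.antitone).le
  have hmd : ∀ i : Fin n, (wsub w (macCoeff t i)).natDegree ≤ pairDeg w := by
    intro i
    rw [macCoeff_eq]
    exact natDegree_wsub_pairProd_le hw.antitone _
  have h1 := congrArg (fun g => coeff (b + a) ((wsub w g).coeff (pairDeg w + wt w a)))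
    (vand_mul_ev_macOp (n := n) ρ t F)
  have hC : ∀ (x : R) (g : MvPolynomial (Fin n) R) (j : ℕ),
      (wsub w (C x * g)).coeff j = C x * (wsub w g).coeff j := by
    intro x g j
    rw [map_mul, wsub_C, Polynomial.coeff_C_mul]
  have hmon : ∀ g : MvPolynomial (Fin n) R, coeff (b + a) (δ * g) = coeff a g := by
    intro g
    rw [hb, add_comm, mul_comm, coeff_mul_monomial, mul_one]
  have h3 : ∀ i : Fin n, coeff (b + a) ((wsub w ((1 - C t) * macCoeff t i *
      scaleVar ρ i (ev R n F))).coeff (pairDeg w + wt w a)) =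
      (1 - t) * (t ^ (i : ℕ) * (ρ ^ a i * coeff a (ev R n F))) := by
    intro i
    rw [mul_assoc, ← C_1, ← C_sub, hC, htop _ _ (hmd i) (natDegree_wsub_scaleVar_le h ρ i), hm,
      mul_assoc, coeff_C_mul, coeff_C_mul, hmon, coeff_coeff_wsub, if_pos rfl, coeff_scaleVar]
  simp only [map_add, map_sum, Polynomial.coeff_add, Polynomial.finsetSum_coeff, coeff_add,
    coeff_sum] at h1
  rw [htop _ _ hvd (natDegree_wsub_ev_macOp_le hw.antitone ρ t h), hv, hmon, coeff_coeff_wsub,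
    if_pos rfl, ← C_pow, hC, htop _ _ hvd h, hv, coeff_C_mul, hmon, coeff_coeff_wsub, if_pos rfl,
    Finset.sum_congr rfl fun i _ => h3 i] at h1
  rw [h1, add_mul, mul_assoc, Finset.sum_mul, Finset.mul_sum]
  congr 1
  exact Finset.sum_congr rfl fun i _ => by ring

end Weight

end MacSym
end

/-! ### Dominance triangularity, eigenvalues, and eigenfunctions without division. -/

noncomputable section

namespace MacSym

open MvPolynomial

/-! ### Triangularity with respect to dominance -/

theorem sum_le_sum_range_of_antitone {f : ℕ → ℕ} (hf : Antitone f) (S : Finset ℕ) :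
    ∑ i ∈ S, f i ≤ ∑ i ∈ Finset.range S.card, f i := by
  induction S using Finset.induction_on_max with
  | empty => simp
  | insert a s ha ih =>
    have hna : a ∉ s := fun h => lt_irrefl _ (ha a h)
    have hcard : s.card ≤ a := by
      have : s ⊆ Finset.range a := fun j hj => Finset.mem_range.2 (ha j hj)
      simpa using Finset.card_le_card this
    rw [Finset.sum_insert hna, Finset.card_insert_of_notMem hna, Finset.sum_range_succ, add_comm]
    exact add_le_add ih (hf hcard)

theorem sum_le_of_shape_eq {n : ℕ} {e : Fin n →₀ ℕ} {l : Ptn} (h : shape e = l.parts)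
    (S : Finset (Fin n)) : ∑ i ∈ S, e i ≤ ∑ i ∈ Finset.range S.card, l.row i := by
  obtain ⟨p, rfl⟩ := exists_perm_of_shape_eq
    (h.trans (l.shape_expo (Ptn.length_le_of_shape_eq h)).symm)
  have h1 : ∀ i, (l.expo n).mapDomain p i = l.row (p.symm i) := by
    intro i
    obtain ⟨j, rfl⟩ := p.surjective i
    rw [Finsupp.mapDomain_apply p.injective]
    simp
  set g : Fin n ↪ ℕ := p.symm.toEmbedding.trans Fin.valEmbedding
  have h2 : ∑ i ∈ S, (l.expo n).mapDomain p i = ∑ j ∈ S.map g, l.row j := by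
    rw [Finset.sum_map]
    exact Finset.sum_congr rfl fun i _ => h1 i
  rw [h2, ← Finset.card_map g]
  exact sum_le_sum_range_of_antitone l.anti _

theorem wt_initial {n k : ℕ} (e : Fin n →₀ ℕ) :
    wt (fun i : Fin n => if (i : ℕ) < k then 1 else 0) e =
      ∑ i ∈ Finset.univ.filter (fun i : Fin n => (i : ℕ) < k), e i := by
  rw [wt, Finset.sum_filter]
  exact Finset.sum_congr rfl fun i _ => by split_ifs <;> simp

theorem card_filter_lt_le (n k : ℕ) :
    (Finset.univ.filter (fun i : Fin n => (i : ℕ) < k)).card ≤ k := by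
  rw [← Finset.card_map Fin.valEmbedding]
  refine (Finset.card_le_card (t := Finset.range k) fun j hj => ?_).trans (by simp)
  obtain ⟨i, hi, rfl⟩ := Finset.mem_map.1 hj
  simpa using hi

theorem wt_initial_le {n k : ℕ} {e : Fin n →₀ ℕ} {l : Ptn} (h : shape e = l.parts) :
    wt (fun i : Fin n => if (i : ℕ) < k then 1 else 0) e ≤ ∑ i ∈ Finset.range k, l.row i := by
  rw [wt_initial]
  refine (sum_le_of_shape_eq h _).trans (Finset.sum_le_sum_of_subset (Finset.range_mono ?_))
  exact card_filter_lt_le n k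

theorem wt_initial_expo {n : ℕ} (l : Ptn) (hl : l.length ≤ n) (k : ℕ) :
    wt (fun i : Fin n => if (i : ℕ) < k then 1 else 0) (l.expo n) =
      ∑ i ∈ Finset.range k, l.row i := by
  rw [wt_initial]
  have h1 : ∑ i ∈ Finset.univ.filter (fun i : Fin n => (i : ℕ) < k), l.expo n i =
      ∑ i ∈ Finset.range (min n k), l.row i := by
    rw [Finset.sum_filter]
    simp only [Ptn.expo_apply]
    rw [Fin.sum_univ_eq_sum_range (fun i => if i < k then l.row i else 0), ← Finset.sum_filter]
    congr 1
    ext i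
    simp
  rw [h1]
  refine Finset.sum_subset (Finset.range_mono (min_le_right _ _)) fun i hi hi' => ?_
  refine l.row_eq_zero ?_
  simp only [Finset.mem_range] at hi hi'
  omega

theorem wt_one {n : ℕ} {e : Fin n →₀ ℕ} {l : Ptn} (h : shape e = l.parts) :
    wt 1 e = l.weight := by
  rw [← l.sum_parts, ← h, sum_shape, wt]
  simp only [Pi.one_apply, one_mul]
  exact (Finset.sum_subset (Finset.subset_univ _) (by simp)).symm

/-- A strictly decreasing weight that is a sum of the weights measuring partial sums. Dominance
bounds each summand, so x^l is of maximal weight in m_l. -/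
theorem wt_descending {n : ℕ} (e : Fin n →₀ ℕ) :
    wt (fun i : Fin n => n - i) e = ∑ k ∈ Finset.range n,
      wt (fun i : Fin n => if (i : ℕ) < k + 1 then 1 else 0) e := by
  simp only [wt]
  rw [Finset.sum_comm]
  refine Finset.sum_congr rfl fun i _ => ?_
  rw [← Finset.sum_mul, ← Finset.sum_filter, Finset.sum_const, smul_eq_mul, mul_one]
  congr 1
  have : (Finset.range n).filter (fun k => (i : ℕ) < k + 1) = Finset.Ico (i : ℕ) n := by
    ext k
    simp only [Finset.mem_filter, Finset.mem_range, Finset.mem_Ico]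
    omega
  rw [this, Nat.card_Ico]

theorem antitone_initial (n k : ℕ) :
    Antitone (fun i : Fin n => if (i : ℕ) < k then 1 else 0) := by
  intro i j hij
  have : (i : ℕ) ≤ j := hij
  simp only
  split_ifs <;> omega

theorem strictAnti_descending (n : ℕ) : StrictAnti (fun i : Fin n => n - (i : ℕ)) := by
  intro i j hij
  have h1 : (i : ℕ) < j := hij
  have := j.2
  simp only
  omega

section Eig

variable {R : Type*} [CommRing R]

/-- The eigenvalues of the Macdonald operator. -/
def eig (ρ t : R) (l : Ptn) : R :=
  1 + (1 - t) * ∑ i ∈ Finset.range l.length, t ^ i * (ρ ^ l.row i - 1)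

theorem map_eig {S : Type*} [CommRing S] (f : R →+* S) (ρ t : R) (l : Ptn) :
    f (eig ρ t l) = eig (f ρ) (f t) l := by
  simp [eig]

theorem eig_eq_sum (ρ t : R) (l : Ptn) {n : ℕ} (hn : l.length ≤ n) :
    eig ρ t l = 1 + (1 - t) * ∑ i ∈ Finset.range n, t ^ i * (ρ ^ l.row i - 1) := by
  rw [eig]
  congr 2
  refine Finset.sum_subset (Finset.range_mono hn) fun i _ hi => ?_
  rw [l.row_eq_zero (by simpa using hi), pow_zero, sub_self, mul_zero]

/-- Since t^n = 1 - (1 - t) ∑_{i<n} t^i, the eigenvalue does not depend on n ≥ ℓ(l), as it must for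
an operator on Λ. -/
theorem eig_eq (ρ t : R) (l : Ptn) {n : ℕ} (hn : l.length ≤ n) :
    t ^ n + (1 - t) * ∑ i : Fin n, t ^ (i : ℕ) * ρ ^ (l.row i) = eig ρ t l := by
  rw [eig_eq_sum ρ t l hn, Fin.sum_univ_eq_sum_range (fun i => t ^ i * ρ ^ l.row i)]
  simp only [mul_sub, mul_one, Finset.sum_sub_distrib]
  linear_combination mul_neg_geom_sum t n

variable [Algebra ℚ R]

/-- The span of the monomial symmetric functions in a set of partitions. -/
def monoSpan (R : Type*) [CommRing R] [Algebra ℚ R] (S : Set Ptn) :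
    Submodule R (MvPolynomial ℕ R) :=
  Submodule.span R (monoFun R '' S)

theorem monoFun_mem {S : Set Ptn} {l : Ptn} (h : l ∈ S) : monoFun R l ∈ monoSpan R S :=
  Submodule.subset_span ⟨l, h, rfl⟩

theorem monoSpan_mono {S T : Set Ptn} (h : S ⊆ T) : monoSpan R S ≤ monoSpan R T :=
  Submodule.span_mono (Set.image_mono h)

theorem mem_monoSpan_iff {S : Set Ptn} {F : MvPolynomial ℕ R} :
    F ∈ monoSpan R S ↔ ∀ l, monomialCoeff R F l ≠ 0 → l ∈ S := by
  classical
  constructor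
  · intro h
    induction h using Submodule.span_induction with
    | mem F hF =>
      obtain ⟨k, hk, rfl⟩ := hF
      intro l hl
      rw [monomialCoeff_monoFun, Finsupp.single_apply] at hl
      have : k = l := by
        by_contra h
        exact hl (if_neg h)
      exact this ▸ hk
    | zero =>
      intro l hl
      simp at hl
    | add F G _ _ hF hG =>
      intro l hl
      rw [map_add, Finsupp.add_apply] at hl
      by_cases h : monomialCoeff R F l = 0
      · rw [h, zero_add] at hl
        exact hG l hl
      · exact hF l h
    | smul c F _ hF =>
      intro l hl
      rw [map_smul, Finsupp.smul_apply] at hl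
      exact hF l (right_ne_zero_of_mul hl)
  · intro h
    rw [eq_sum_monoFun F]
    exact Submodule.sum_mem _ fun l hl =>
      Submodule.smul_mem _ _ (monoFun_mem (h l (Finsupp.mem_support_iff.1 hl)))

theorem shape_of_coeff_ev_monoFun_ne_zero {n : ℕ} {l : Ptn} {e : Fin n →₀ ℕ}
    (h : coeff e (ev R n (monoFun R l)) ≠ 0) : shape e = l.parts := by
  rw [ev_monoFun, coeff_monoR] at h
  by_contra h'
  exact h (if_neg h')

variable [IsDomain R]

/-- Dominance is tested by weights: the constant weight 1 gives equality of sizes, and the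
indicators of the first r variables, which are decreasing, give the partial sums. -/
theorem macOp_monoFun_mem (ρ t : R) (l : Ptn) :
    macOp ρ t (monoFun R l) ∈ monoSpan R {k | k.DomLE l} := by
  rw [mem_monoSpan_iff]
  intro k hk
  rw [monomialCoeff_eq_coeff _ k (k.shape_expo le_rfl)] at hk
  set n := k.length
  constructor
  · have h1 : wsub 1 (ev R n (monoFun R l)) =
        Polynomial.C (ev R n (monoFun R l)) * Polynomial.X ^ l.weight := by
      rw [wsub_one_eq_iff]
      exact fun e he => wt_one (shape_of_coeff_ev_monoFun_ne_zero he)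
    have h2 := (wsub_one_eq_iff _ _).1 (wsub_one_ev_macOp ρ t h1) _ hk
    rw [← h2, wt_one (k.shape_expo le_rfl)]
  · intro r
    have h1 : (wsub (fun i : Fin n => if (i : ℕ) < r then 1 else 0)
        (ev R n (monoFun R l))).natDegree ≤ ∑ i ∈ Finset.range r, l.row i := by
      rw [natDegree_wsub_le_iff]
      exact fun e he => wt_initial_le (shape_of_coeff_ev_monoFun_ne_zero he)
    have h2 := (natDegree_wsub_le_iff _ _ _).1
      (natDegree_wsub_ev_macOp_le (antitone_initial n r) ρ t h1) _ hk
    rwa [wt_initial_expo k le_rfl] at h2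

theorem macOp_monoFun_sub_mem (ρ : R) {t : R} (ht : t ≠ 0) (l : Ptn) :
    macOp ρ t (monoFun R l) - eig ρ t l • monoFun R l ∈ monoSpan R {k | k.DomLT l} := by
  rw [mem_monoSpan_iff]
  intro k hk
  rw [map_sub, map_smul, Finsupp.sub_apply, Finsupp.smul_apply, monomialCoeff_monoFun] at hk
  by_cases hkl : k = l
  · subst hkl
    exfalso
    apply hk
    rw [Finsupp.single_eq_same, monomialCoeff_eq_coeff _ k (k.shape_expo le_rfl),
      coeff_ev_macOp (strictAnti_descending _) ρ ht, ev_monoFun, coeff_monoR,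
      if_pos (k.shape_expo le_rfl), ← eig_eq ρ t k le_rfl]
    · simp
    · intro e he
      have he' := shape_of_coeff_ev_monoFun_ne_zero he
      rw [wt_descending, wt_descending]
      refine Finset.sum_le_sum fun j _ => ?_
      rw [wt_initial_expo k le_rfl]
      exact wt_initial_le he'
  · rw [Finsupp.single_eq_of_ne hkl, smul_zero, sub_zero] at hk
    exact ⟨mem_monoSpan_iff.1 (macOp_monoFun_mem ρ t l) k hk, hkl⟩

theorem macOp_mem_of_isLowerSet (ρ t : R) {S : Set Ptn}
    (hS : ∀ l ∈ S, ∀ k : Ptn, k.DomLE l → k ∈ S) {F : MvPolynomial ℕ R} (hF : F ∈ monoSpan R S) :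
    macOp ρ t F ∈ monoSpan R S := by
  induction hF using Submodule.span_induction with
  | mem F hF =>
    obtain ⟨l, hl, rfl⟩ := hF
    exact monoSpan_mono (fun k hk => hS l hl k hk) (macOp_monoFun_mem ρ t l)
  | zero => simp
  | add F G _ _ hF hG => rw [map_add]; exact add_mem hF hG
  | smul c F _ hF => rw [map_smul]; exact Submodule.smul_mem _ _ hF

/-! ### Eigenfunctions -/

/-- The product of `X - e_k` over a finite set of partitions. -/
def eigPoly (ρ t : R) (S : Finset Ptn) : Polynomial R :=
  ∏ k ∈ S, (Polynomial.X - Polynomial.C (eig ρ t k))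

/-- Cayley–Hamilton for a triangular operator: for v maximal in the lower set S, E - e_v maps the
span of S into the span of S without v, which is again a lower set. Repeated eigenvalues do no harm.
-/
theorem aeval_eigPoly_eq_zero (ρ : R) {t : R} (ht : t ≠ 0) (S : Finset Ptn)
    (hS : ∀ l ∈ S, ∀ k : Ptn, k.DomLE l → k ∈ S) {F : MvPolynomial ℕ R}
    (hF : F ∈ monoSpan R (S : Set Ptn)) : Polynomial.aeval (macOp ρ t) (eigPoly ρ t S) F = 0 := by
  classical
  induction hn : S.card generalizing S F with
  | zero =>
    rw [Finset.card_eq_zero] at hn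
    subst hn
    have : F = 0 := by simpa [monoSpan] using hF
    rw [this, map_zero]
  | succ m ih =>
    have hne : S.Nonempty := Finset.card_pos.1 (by omega)
    obtain ⟨v, hv, hmax⟩ : ∃ v ∈ S, ∀ k ∈ S, ¬ v.DomLT k := by
      have h1 : Std.Irrefl fun a b : S => Ptn.DomLT b.1 a.1 := ⟨fun a h => h.2 rfl⟩
      have h2 : IsTrans S fun a b : S => Ptn.DomLT b.1 a.1 :=
        ⟨fun a b c h h' => h'.trans_le h.1⟩
      have hwf := Finite.wellFounded_of_trans_of_irrefl fun a b : S => Ptn.DomLT b.1 a.1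
      obtain ⟨v, _, hv⟩ := hwf.has_min Set.univ ⟨⟨_, hne.choose_spec⟩, trivial⟩
      exact ⟨v.1, v.2, fun k hk h => hv ⟨k, hk⟩ trivial h⟩
    have hprod : eigPoly ρ t S =
        eigPoly ρ t (S.erase v) * (Polynomial.X - Polynomial.C (eig ρ t v)) := by
      rw [eigPoly, eigPoly, mul_comm]
      exact (Finset.mul_prod_erase S _ hv).symm
    rw [hprod, map_mul, Module.End.mul_apply]
    refine ih (S.erase v) ?_ ?_ (by rw [Finset.card_erase_of_mem hv, hn]; rfl)
    · intro l hl k hk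
      refine Finset.mem_erase.2 ⟨?_, hS l (Finset.mem_of_mem_erase hl) k hk⟩
      rintro rfl
      exact hmax l (Finset.mem_of_mem_erase hl) ⟨hk, (Finset.ne_of_mem_erase hl).symm⟩
    · have hE : ∀ G : MvPolynomial ℕ R, Polynomial.aeval (macOp ρ t)
          (Polynomial.X - Polynomial.C (eig ρ t v)) G = macOp ρ t G - eig ρ t v • G := by
        intro G
        simp [Algebra.algebraMap_eq_smul_one]
      rw [hE]
      induction hF using Submodule.span_induction with
      | mem F hF =>
        obtain ⟨k, hk, rfl⟩ := hF
        by_cases hkv : k = v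
        · subst hkv
          refine monoSpan_mono (fun j hj => ?_) (macOp_monoFun_sub_mem ρ ht k)
          exact Finset.mem_coe.2 (Finset.mem_erase.2 ⟨hj.2, hS k hk j hj.1⟩)
        · refine sub_mem (monoSpan_mono (fun j hj => ?_) (macOp_monoFun_mem ρ t k))
            (Submodule.smul_mem _ _ (monoFun_mem (Finset.mem_coe.2 (Finset.mem_erase.2 ⟨hkv, hk⟩))))
          refine Finset.mem_coe.2 (Finset.mem_erase.2 ⟨?_, hS k hk j hj⟩)
          rintro rfl
          exact hmax k hk ⟨hj, Ne.symm hkv⟩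
      | zero => simp
      | add F G _ _ hF hG =>
        rw [map_add, smul_add, add_sub_add_comm]
        exact add_mem hF hG
      | smul c F _ hF =>
        rw [map_smul, smul_comm, ← smul_sub]
        exact Submodule.smul_mem _ _ hF

omit [Algebra ℚ R] [IsDomain R] in
/-- The partitions strictly below `l` in the dominance order. -/
def domBelow (l : Ptn) : Finset Ptn := l.finite_domLT.toFinset

theorem mem_domBelow {k l : Ptn} : k ∈ domBelow l ↔ k.DomLT l := by
  rw [domBelow, Set.Finite.mem_toFinset]
  rfl

theorem coe_domBelow (l : Ptn) : (domBelow l : Set Ptn) = {k | k.DomLT l} := by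
  ext k
  exact mem_domBelow

/-- The eigenfunction `∏_{k < l} (E - e_k) m_l` of the Macdonald operator, without
denominators. -/
def eigFun (ρ t : R) (l : Ptn) : MvPolynomial ℕ R :=
  Polynomial.aeval (macOp ρ t) (eigPoly ρ t (domBelow l)) (monoFun R l)

/-- Applying E - e_l as well gives the product over all k ≤ l, which annihilates the span of these
m_k. The eigenvalues need not be distinct. -/
theorem macOp_eigFun (ρ : R) {t : R} (ht : t ≠ 0) (l : Ptn) :
    macOp ρ t (eigFun ρ t l) = eig ρ t l • eigFun ρ t l := by
  classical
  have hnot : l ∉ domBelow l := fun h => (mem_domBelow.1 h).2 rfl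
  have h := aeval_eigPoly_eq_zero ρ ht (insert l (domBelow l)) (F := monoFun R l) (by
    intro k hk j hj
    rw [Finset.mem_insert, mem_domBelow] at hk ⊢
    by_cases hjl : j = l
    · exact Or.inl hjl
    · rcases hk with rfl | hk
      · exact Or.inr ⟨hj, hjl⟩
      · exact Or.inr (hj.trans_lt hk)) (monoFun_mem (by simp))
  rw [eigPoly, Finset.prod_insert hnot, map_mul, Module.End.mul_apply, ← eigPoly, ← eigFun] at h
  rw [← sub_eq_zero, ← h]
  simp [Algebra.algebraMap_eq_smul_one]

theorem aeval_macOp_monoFun_sub_mem (ρ : R) {t : R} (ht : t ≠ 0) (l : Ptn) (p : Polynomial R) :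
    Polynomial.aeval (macOp ρ t) p (monoFun R l) - p.eval (eig ρ t l) • monoFun R l ∈
      monoSpan R {k | k.DomLT l} := by
  have hinv : ∀ G ∈ monoSpan R {k | k.DomLT l},
      macOp ρ t G ∈ monoSpan R {k | k.DomLT l} := fun G hG =>
    macOp_mem_of_isLowerSet ρ t (fun k hk j hj => Ptn.DomLE.trans_lt hj hk) hG
  have hpow : ∀ m : ℕ, (macOp ρ t ^ m) (monoFun R l) - eig ρ t l ^ m • monoFun R l ∈
      monoSpan R {k | k.DomLT l} := by
    intro m
    induction m with
    | zero => simp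
    | succ m ih =>
      have h1 := hinv _ ih
      have h2 := Submodule.smul_mem _ (eig ρ t l ^ m) (macOp_monoFun_sub_mem ρ ht l)
      have h3 := add_mem h1 h2
      rw [map_sub, map_smul, smul_sub, sub_add_sub_cancel, smul_smul, ← pow_succ] at h3
      rwa [pow_succ', Module.End.mul_apply]
  induction p using Polynomial.induction_on' with
  | add p p' hp hp' =>
    rw [map_add, LinearMap.add_apply, Polynomial.eval_add, add_smul, add_sub_add_comm]
    exact add_mem hp hp'
  | monomial m c =>
    rw [Polynomial.aeval_monomial, Polynomial.eval_monomial, Algebra.algebraMap_eq_smul_one,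
      smul_mul_assoc, one_mul, LinearMap.smul_apply, mul_smul, ← smul_sub]
    exact Submodule.smul_mem _ _ (hpow m)

omit [Algebra ℚ R] [IsDomain R] in
/-- The leading coefficient `∏_{k < l} (e_l - e_k)` of `eigFun`. -/
def eigLead (ρ t : R) (l : Ptn) : R := ∏ k ∈ domBelow l, (eig ρ t l - eig ρ t k)

theorem eigFun_sub_mem (ρ : R) {t : R} (ht : t ≠ 0) (l : Ptn) :
    eigFun ρ t l - eigLead ρ t l • monoFun R l ∈ monoSpan R {k | k.DomLT l} := by
  have h := aeval_macOp_monoFun_sub_mem ρ ht l (eigPoly ρ t (domBelow l))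
  have h1 : (eigPoly ρ t (domBelow l)).eval (eig ρ t l) = eigLead ρ t l := by
    simp [eigPoly, eigLead, Polynomial.eval_prod]
  rwa [h1] at h

omit [IsDomain R] in
theorem map_aeval_macOp {S : Type*} [CommRing S] [Algebra ℚ S] (f : R →+* S) (ρ t : R)
    (p : Polynomial R) (F : MvPolynomial ℕ R) :
    map f (Polynomial.aeval (macOp ρ t) p F) =
      Polynomial.aeval (macOp (f ρ) (f t)) (p.map f) (map f F) := by
  have hpow : ∀ m : ℕ, map f ((macOp ρ t ^ m) F) = (macOp (f ρ) (f t) ^ m) (map f F) := by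
    intro m
    induction m with
    | zero => simp
    | succ m ih => rw [pow_succ', Module.End.mul_apply, map_macOp, ih, pow_succ',
        Module.End.mul_apply]
  induction p using Polynomial.induction_on' with
  | add p p' hp hp' => rw [map_add, LinearMap.add_apply, map_add, hp, hp', Polynomial.map_add,
      map_add, LinearMap.add_apply]
  | monomial m c =>
    rw [Polynomial.aeval_monomial, Polynomial.map_monomial, Polynomial.aeval_monomial,
      Algebra.algebraMap_eq_smul_one, Algebra.algebraMap_eq_smul_one, smul_mul_assoc, one_mul,
      smul_mul_assoc, one_mul, LinearMap.smul_apply, LinearMap.smul_apply, smul_eq_C_mul,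
      smul_eq_C_mul, map_mul, map_C, hpow]

-- No division enters `eigFun`, so it commutes with ring homomorphisms. Evaluation ℝ[t] → ℝ then
-- shows that it depends polynomially on t.
omit [IsDomain R] in
theorem map_eigFun {S : Type*} [CommRing S] [Algebra ℚ S] (f : R →+* S) (ρ t : R) (l : Ptn) :
    map f (eigFun ρ t l) = eigFun (f ρ) (f t) l := by
  rw [eigFun, map_aeval_macOp, map_monoFun, eigFun]
  congr 2
  simp [eigPoly, Polynomial.map_prod, map_eig f]

end Eig

end MacSym
end

/-! ### Passage to Λ, uniqueness of Macdonald families, and rectangles. -/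

noncomputable section

namespace MacSym

open MvPolynomial

/-! ### Symmetric functions as polynomials in the power sums -/

section SymFun

variable {K : Type*} [Field K]

/-- The symmetric function given by a polynomial in the power sums. -/
def toSymFun (K : Type*) [Field K] : MvPolynomial ℕ K →ₐ[K] SymFun K :=
  aeval fun r => powerSum K (r + 1)

theorem toSymFun_apply (F : MvPolynomial ℕ K) (n : ℕ) : (toSymFun K F).1 n = ev K n F := by
  have h : ((Pi.evalAlgHom K (fun n : ℕ => MvPolynomial (Fin n) K) n).comp
      (SymFun K).val).comp (toSymFun K) = ev K n := by
    refine MvPolynomial.algHom_ext fun r => ?_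
    rw [AlgHom.comp_apply, toSymFun, aeval_X, ev_X, powerSum, dif_pos (Nat.succ_pos r)]
    rfl
  exact DFunLike.congr_fun h F

/-- The multiplicities of the parts; the index `r` counts the parts equal to `r + 1`. -/
def mult (l : Ptn) : ℕ →₀ ℕ := Multiset.toFinsupp (l.parts.map Nat.pred)

theorem map_succ_map_pred (l : Ptn) : (l.parts.map Nat.pred).map Nat.succ = l.parts := by
  rw [Multiset.map_map]
  conv_rhs => rw [← Multiset.map_id l.parts]
  exact Multiset.map_congr rfl fun x hx => Nat.succ_pred_eq_of_pos (l.parts_pos x hx)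

theorem mult_bijective : Function.Bijective mult := by
  constructor
  · intro l k h
    apply Ptn.parts_injective
    rw [← map_succ_map_pred l, ← map_succ_map_pred k, Multiset.toFinsupp.injective h]
  · intro a
    obtain ⟨l, hl⟩ := Ptn.exists_parts_eq ((Finsupp.toMultiset a).map Nat.succ) (by
      intro x hx
      obtain ⟨y, _, rfl⟩ := Multiset.mem_map.1 hx
      exact Nat.succ_pos y)
    refine ⟨l, ?_⟩
    rw [mult, hl, Multiset.map_map]
    have : Nat.pred ∘ Nat.succ = id := rfl
    rw [this, Multiset.map_id, Finsupp.toMultiset_toFinsupp]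

/-- Partitions correspond to multiplicity vectors. -/
def multEquiv : Ptn ≃ (ℕ →₀ ℕ) := Equiv.ofBijective mult mult_bijective

theorem powerSumPtn_eq (l : Ptn) : powerSumPtn K l = toSymFun K (monomial (mult l) 1) := by
  rw [mult, ← prod_map_X_eq_monomial, map_multiset_prod, powerSumPtn, Multiset.map_map]
  conv_lhs => rw [← map_succ_map_pred l, Multiset.map_map]
  congr 1
  refine Multiset.map_congr rfl fun r _ => ?_
  simp [toSymFun]

theorem linearCombination_powerSumPtn (u : Ptn →₀ K) :
    Finsupp.linearCombination K (powerSumPtn K) u =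
      toSymFun K (u.sum fun l a => monomial (mult l) a) := by
  rw [Finsupp.linearCombination_apply, Finsupp.sum, Finsupp.sum, map_sum]
  refine Finset.sum_congr rfl fun l _ => ?_
  rw [powerSumPtn_eq, ← map_smul, smul_monomial, smul_eq_mul, mul_one]

theorem coeff_mult_sum (u : Ptn →₀ K) (l : Ptn) :
    coeff (mult l) (u.sum fun l a => monomial (mult l) a) = u l := by
  classical
  rw [Finsupp.sum, coeff_sum]
  simp only [coeff_monomial, mult_bijective.1.eq_iff]
  rw [Finset.sum_ite_eq']
  split_ifs with h
  · rfl
  · exact (Finsupp.notMem_support_iff.1 h).symm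

/-- The coefficients of a polynomial in the power sums, indexed by partitions. -/
def ptnCoeff (F : MvPolynomial ℕ K) : Ptn →₀ K :=
  Finsupp.onFinset (F.support.map multEquiv.symm.toEmbedding) (fun l => coeff (mult l) F) (by
    intro l hl
    rw [Finset.mem_map_equiv, Equiv.symm_symm]
    exact mem_support_iff.2 hl)

theorem ptnCoeff_apply (F : MvPolynomial ℕ K) (l : Ptn) :
    ptnCoeff F l = coeff (mult l) F := rfl

theorem sum_monomial_ptnCoeff (F : MvPolynomial ℕ K) :
    ((ptnCoeff F).sum fun l a => monomial (mult l) a) = F := by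
  ext a
  obtain ⟨l, rfl⟩ := mult_bijective.2 a
  rw [coeff_mult_sum, ptnCoeff_apply]

variable [Algebra ℚ K]

theorem toSymFun_injective : Function.Injective (toSymFun K) := by
  intro F G h
  refine eq_of_ev_eq fun n => ?_
  rw [← toSymFun_apply, ← toSymFun_apply, h]

theorem linearCombination_powerSumPtn_injective :
    Function.Injective (Finsupp.linearCombination K (powerSumPtn K)) := by
  intro u v h
  rw [linearCombination_powerSumPtn, linearCombination_powerSumPtn] at h
  ext l
  rw [← coeff_mult_sum u, toSymFun_injective h, coeff_mult_sum]

/-- `Function.invFun` yields the true coefficients on the image of `toSymFun`, because the power sum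
products are independent. Only elements of this image are ever needed. -/
theorem powerSumCoeff_toSymFun (F : MvPolynomial ℕ K) :
    powerSumCoeff (toSymFun K F) = ptnCoeff F := by
  have h : toSymFun K F = Finsupp.linearCombination K (powerSumPtn K) (ptnCoeff F) := by
    rw [linearCombination_powerSumPtn, sum_monomial_ptnCoeff]
  rw [powerSumCoeff, h]
  exact Function.leftInverse_invFun linearCombination_powerSumPtn_injective _

omit [Algebra ℚ K] in
/-- The norms `⟨p_{r+1}, p_{r+1}⟩_{q,t}`. -/
def cnorm (q t : K) (r : ℕ) : K := ((r : K) + 1) * ((1 - q ^ (r + 1)) / (1 - t ^ (r + 1)))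

omit [Algebra ℚ K] in
theorem zqt_eq (q t : K) (l : Ptn) : zqt q t l = pnorm (cnorm q t) (mult l) := by
  classical
  have h1 : ∏ i ∈ l.row.support, (1 - q ^ l.row i) / (1 - t ^ l.row i) =
      (l.parts.map fun r => (1 - q ^ r) / (1 - t ^ r)).prod := by
    rw [Ptn.parts, Multiset.map_map]
    rfl
  have hsupp : l.parts.toFinset = (mult l).support.image Nat.succ := by
    rw [mult, Multiset.toFinsupp_support]
    conv_lhs => rw [← map_succ_map_pred l]
    exact Multiset.toFinset_map _ _
  have hcount : ∀ r, l.parts.count (Nat.succ r) = mult l r := by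
    intro r
    rw [mult, Multiset.toFinsupp_apply]
    conv_lhs => rw [← map_succ_map_pred l]
    exact Multiset.count_map_eq_count' _ _ Nat.succ_injective r
  rw [zqt, h1, Finset.prod_multiset_map_count, ← Finset.prod_mul_distrib, hsupp,
    Finset.prod_image Nat.succ_injective.injOn, pnorm, Finsupp.prod]
  refine Finset.prod_congr rfl fun r _ => ?_
  rw [hcount, cnorm, mul_pow, Nat.succ_eq_add_one]
  push_cast
  ring

theorem formqt_toSymFun (q t : K) (F G : MvPolynomial ℕ K) :
    formqt q t (toSymFun K F) (toSymFun K G) = pform (cnorm q t) F G := by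
  rw [formqt, powerSumCoeff_toSymFun, powerSumCoeff_toSymFun, pform_eq_sum _ F G le_rfl,
    ptnCoeff, Finsupp.onFinset_sum _ (by simp), Finset.sum_map]
  refine Finset.sum_congr rfl fun a _ => ?_
  have h : mult (multEquiv.symm a) = a := multEquiv.apply_symm_apply a
  change zqt q t (multEquiv.symm a) * coeff (mult (multEquiv.symm a)) F *
    coeff (mult (multEquiv.symm a)) G = _
  rw [zqt_eq, h]
  ring

end SymFun

/-! ### Families that are triangular with respect to the monomial symmetric functions -/

theorem card_domBelow_lt {k l : Ptn} (h : k.DomLT l) :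
    (domBelow k).card < (domBelow l).card := by
  refine Finset.card_lt_card (Finset.ssubset_iff_of_subset (fun j hj => ?_) |>.2
    ⟨k, mem_domBelow.2 h, fun hk => (mem_domBelow.1 hk).2 rfl⟩)
  exact mem_domBelow.2 ((mem_domBelow.1 hj).trans_le h.1)

theorem dom_induction {p : Ptn → Prop} (h : ∀ l, (∀ k : Ptn, k.DomLT l → p k) → p l) (l : Ptn) :
    p l := by
  induction hn : (domBelow l).card using Nat.strong_induction_on generalizing l with
  | _ n ih => exact h l fun k hk => ih _ (hn ▸ card_domBelow_lt hk) k rfl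

section Triangular

variable {R : Type*} [CommRing R] [Algebra ℚ R]

/-- Families of the form `G_l = m_l + ∑_{k < l} u_{lk} m_k`. -/
def IsTriangular (G : Ptn → MvPolynomial ℕ R) : Prop :=
  ∀ l, G l - monoFun R l ∈ monoSpan R {k | k.DomLT l}

theorem IsTriangular.mem {G : Ptn → MvPolynomial ℕ R} (hG : IsTriangular G) (l : Ptn) :
    G l ∈ monoSpan R {k | k.DomLE l} := by
  have h := add_mem (monoSpan_mono (fun k (hk : k.DomLT l) => hk.1) (hG l))
    (monoFun_mem (R := R) (S := {k | k.DomLE l}) (Ptn.DomLE.refl l))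
  rwa [sub_add_cancel] at h

theorem IsTriangular.monoFun_mem_span {G : Ptn → MvPolynomial ℕ R} (hG : IsTriangular G)
    (l : Ptn) : monoFun R l ∈ Submodule.span R (G '' {k | k.DomLE l}) := by
  induction l using dom_induction with
  | h l ih =>
    have h1 : monoSpan R {k | k.DomLT l} ≤ Submodule.span R (G '' {k | k.DomLE l}) := by
      refine Submodule.span_le.2 ?_
      rintro _ ⟨k, hk, rfl⟩
      have h3 : {j : Ptn | j.DomLE k} ⊆ {j : Ptn | j.DomLE l} := by
        intro j hj
        exact Ptn.DomLE.trans hj (show k.DomLT l from hk).1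
      exact Submodule.span_mono (Set.image_mono h3) (ih k hk)
    have h2 := sub_mem (Submodule.subset_span ⟨l, Ptn.DomLE.refl l, rfl⟩ :
      G l ∈ Submodule.span R (G '' {k | k.DomLE l})) (h1 (hG l))
    rwa [sub_sub_cancel] at h2

theorem IsTriangular.monoSpan_le {G : Ptn → MvPolynomial ℕ R} (hG : IsTriangular G) (l : Ptn) :
    monoSpan R {k | k.DomLT l} ≤ Submodule.span R (G '' {k | k.DomLT l}) := by
  refine Submodule.span_le.2 ?_
  rintro _ ⟨k, hk, rfl⟩
  have h3 : {j : Ptn | j.DomLE k} ⊆ {j : Ptn | j.DomLT l} := by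
    intro j hj
    exact Ptn.DomLE.trans_lt hj hk
  exact Submodule.span_mono (Set.image_mono h3) (hG.monoFun_mem_span k)

theorem IsTriangular.span_eq_top {G : Ptn → MvPolynomial ℕ R} (hG : IsTriangular G) :
    Submodule.span R (Set.range G) = ⊤ := by
  refine eq_top_iff.2 fun F _ => ?_
  rw [eq_sum_monoFun F]
  refine Submodule.sum_mem _ fun l _ => Submodule.smul_mem _ _ ?_
  exact Submodule.span_mono (Set.image_subset_range _ _) (hG.monoFun_mem_span l)

theorem IsTriangular.monomialCoeff_self {G : Ptn → MvPolynomial ℕ R} (hG : IsTriangular G)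
    (l : Ptn) : monomialCoeff R (G l) l = 1 := by
  have h : monomialCoeff R (G l - monoFun R l) l = 0 := by
    by_contra h
    exact (mem_monoSpan_iff.1 (hG l) l h).2 rfl
  rw [map_sub, Finsupp.sub_apply, monomialCoeff_monoFun, Finsupp.single_eq_same] at h
  exact sub_eq_zero.1 h

theorem ev_eq_zero_of_mem {n : ℕ} {F : MvPolynomial ℕ R} {S : Set Ptn} (hF : F ∈ monoSpan R S)
    (hS : ∀ l ∈ S, n < l.length) : ev R n F = 0 := by
  induction hF using Submodule.span_induction with
  | mem F hF =>
    obtain ⟨l, hl, rfl⟩ := hF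
    rw [ev_monoFun, monoR_eq_zero R (hS l hl)]
  | zero => simp
  | add F G _ _ hF hG => rw [map_add, hF, hG, add_zero]
  | smul c F _ hF => rw [map_smul, hF, smul_zero]

/-- Every m_k with k ≤ l has at least ℓ(l) > n parts and so vanishes in n variables. -/
theorem IsTriangular.ev_eq_zero {G : Ptn → MvPolynomial ℕ R} (hG : IsTriangular G) {n : ℕ}
    {l : Ptn} (hl : n < l.length) : ev R n (G l) = 0 :=
  ev_eq_zero_of_mem (hG.mem l) fun _ hk => hl.trans_le (Ptn.DomLE.length_le hk)

end Triangular

section Orthogonal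

variable {K : Type*} [Field K]

theorem eq_zero_of_pform_eq_zero {c : ℕ → K} (hc : ∀ a, pnorm c a ≠ 0) {F : MvPolynomial ℕ K}
    (h : ∀ G, pform c F G = 0) : F = 0 := by
  ext a
  have h1 := h (monomial a 1)
  rw [pform_comm, pform_monomial, one_mul] at h1
  exact (mul_eq_zero.1 h1).resolve_left (hc a)

variable [Algebra ℚ K]

theorem IsTriangular.eq_zero_of_pform_eq_zero {c : ℕ → K} (hc : ∀ a, pnorm c a ≠ 0)
    {G : Ptn → MvPolynomial ℕ K} (hG : IsTriangular G) {F : MvPolynomial ℕ K}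
    (h : ∀ l, pform c F (G l) = 0) : F = 0 := by
  refine MacSym.eq_zero_of_pform_eq_zero hc fun H => ?_
  have hH : H ∈ Submodule.span K (Set.range G) := by
    rw [hG.span_eq_top]
    trivial
  induction hH using Submodule.span_induction with
  | mem H hH =>
    obtain ⟨l, rfl⟩ := hH
    exact h l
  | zero => simp
  | add H H' _ _ h1 h2 => rw [map_add, h1, h2, add_zero]
  | smul x H _ h1 => rw [map_smul, h1, smul_zero]

/-- Orthogonal triangular families are unique. -/
theorem IsTriangular.eq_of_orthogonal {c : ℕ → K} (hc : ∀ a, pnorm c a ≠ 0)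
    {F G : Ptn → MvPolynomial ℕ K} (hF : IsTriangular F) (hG : IsTriangular G)
    (hF' : ∀ l k, l ≠ k → pform c (F l) (F k) = 0)
    (hG' : ∀ l k, l ≠ k → pform c (G l) (G k) = 0) : F = G := by
  ext1 l
  induction l using dom_induction with
  | h l ih =>
    rw [← sub_eq_zero]
    refine hG.eq_zero_of_pform_eq_zero hc fun k => ?_
    -- For k < l the families agree at k by induction, so F_l and G_l are both orthogonal to G_k.
    -- For other k the difference is a combination of G_j with j < l, none of which is G_k.
    by_cases hk : k.DomLT l
    · rw [map_sub, LinearMap.sub_apply, hG' l k hk.2.symm, ← ih k hk, hF' l k hk.2.symm, sub_zero]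
    · have h1 : F l - G l ∈ Submodule.span K (G '' {k | k.DomLT l}) := by
        refine hG.monoSpan_le l ?_
        have := sub_mem (hF l) (hG l)
        rwa [sub_sub_sub_cancel_right] at this
      generalize F l - G l = D at h1 ⊢
      induction h1 using Submodule.span_induction with
      | mem H hH =>
        obtain ⟨j, hj, rfl⟩ := hH
        refine hG' j k ?_
        rintro rfl
        exact hk hj
      | zero => simp
      | add H H' _ _ h1 h2 => rw [map_add, LinearMap.add_apply, h1, h2, add_zero]
      | smul x H _ h1 => rw [map_smul, LinearMap.smul_apply, h1, smul_zero]

/-- An isotropic member would be orthogonal to the whole family, which spans, while the form is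
nondegenerate. No positivity is involved, so this works over any such field. -/
theorem IsTriangular.pform_self_ne_zero {c : ℕ → K} (hc : ∀ a, pnorm c a ≠ 0)
    {G : Ptn → MvPolynomial ℕ K} (hG : IsTriangular G)
    (hG' : ∀ l k, l ≠ k → pform c (G l) (G k) = 0) (l : Ptn) : pform c (G l) (G l) ≠ 0 := by
  intro h0
  have h : G l = 0 := hG.eq_zero_of_pform_eq_zero hc fun k => by
    by_cases hk : l = k
    · rw [← hk, h0]
    · exact hG' l k hk
  have h1 := hG.monomialCoeff_self l
  rw [h] at h1
  simp at h1

/-- Condition (A) already expresses P_l through m's, which are images of `monoFun`. So P_l lies in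
the image of `toSymFun`, and surjectivity onto Λ is not needed. -/
theorem isMacdonald_iff (q t : K) (P : Ptn → SymFun K) :
    IsMacdonald q t P ↔ ∃ F : Ptn → MvPolynomial ℕ K, IsTriangular F ∧
      (∀ l k, l ≠ k → pform (cnorm q t) (F l) (F k) = 0) ∧ P = fun l => toSymFun K (F l) := by
  constructor
  · rintro ⟨hA, hB⟩
    choose u hu hP using hA
    set F : Ptn → MvPolynomial ℕ K := fun l =>
      monoFun K l + (u l).sum fun k c => c • monoFun K k with hF
    have hPF : P = fun l => toSymFun K (F l) := by
      ext1 l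
      refine Subtype.ext (funext fun n => ?_)
      rw [toSymFun_apply, hP, hF, map_add, ev_monoFun, Finsupp.sum, Finsupp.sum, map_sum]
      congr 1
      refine Finset.sum_congr rfl fun k _ => ?_
      rw [smul_eq_C_mul, map_mul, ev_C, ev_monoFun]
      rfl
    refine ⟨F, fun l => ?_, fun l k h => ?_, hPF⟩
    · rw [hF, add_sub_cancel_left]
      exact Submodule.sum_mem _ fun k hk => Submodule.smul_mem _ _ (monoFun_mem (hu l k hk))
    · rw [← formqt_toSymFun]
      have := hB l k h
      rwa [hPF] at this
  · rintro ⟨F, hF, hF', rfl⟩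
    refine ⟨fun l => ⟨monomialCoeff K (F l - monoFun K l), fun k hk => ?_, fun n => ?_⟩,
      fun l k h => ?_⟩
    · exact mem_monoSpan_iff.1 (hF l) k (Finsupp.mem_support_iff.1 hk)
    · rw [toSymFun_apply, mono_eq_monoR, ← ev_monoFun]
      simp only [mono_eq_monoR]
      rw [← ev_eq_sum, map_sub, add_sub_cancel]
    · rw [formqt_toSymFun, hF' l k h]

/-- `macP` is a choice by `Classical.epsilon`: exhibiting one family makes the choice satisfy the
conditions, and uniqueness identifies it. -/
theorem macP_eq {q t : K} (hc : ∀ a, pnorm (cnorm q t) a ≠ 0) {F : Ptn → MvPolynomial ℕ K}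
    (hF : IsTriangular F) (hF' : ∀ l k, l ≠ k → pform (cnorm q t) (F l) (F k) = 0) (l : Ptn) :
    macP q t l = toSymFun K (F l) := by
  have h : IsMacdonald q t (macP q t) :=
    Classical.epsilon_spec (p := IsMacdonald q t)
      ⟨_, (isMacdonald_iff q t _).2 ⟨F, hF, hF', rfl⟩⟩
  obtain ⟨G, hG, hG', hP⟩ := (isMacdonald_iff q t _).1 h
  rw [hP, hG.eq_of_orthogonal hc hF hG' hF']

end Orthogonal

/-! ### The Macdonald symmetric functions as eigenfunctions -/

section MacFun

variable {K : Type*} [Field K] [Algebra ℚ K]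

/-- The Macdonald symmetric functions as polynomials in the power sums, constructed as
eigenfunctions of the Macdonald operator. -/
def macFun (q t : K) (l : Ptn) : MvPolynomial ℕ K :=
  (eigLead q⁻¹ t l)⁻¹ • eigFun q⁻¹ t l

theorem macOp_macFun (q : K) {t : K} (ht : t ≠ 0) (l : Ptn) :
    macOp q⁻¹ t (macFun q t l) = eig q⁻¹ t l • macFun q t l := by
  rw [macFun, map_smul, macOp_eigFun _ ht, smul_comm]

theorem isTriangular_macFun {q t : K} (ht : t ≠ 0) (h : ∀ l, eigLead q⁻¹ t l ≠ 0) :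
    IsTriangular (macFun q t) := by
  intro l
  have h1 := Submodule.smul_mem _ (eigLead q⁻¹ t l)⁻¹ (eigFun_sub_mem q⁻¹ ht l)
  rwa [smul_sub, smul_smul, inv_mul_cancel₀ (h l), one_smul] at h1

omit [Algebra ℚ K] in
theorem eigLead_ne_zero {ρ t : K} {l : Ptn} (h : ∀ k : Ptn, k.DomLT l → eig ρ t k ≠ eig ρ t l) :
    eigLead ρ t l ≠ 0 :=
  Finset.prod_ne_zero_iff.2 fun k hk => sub_ne_zero.2 (h k (mem_domBelow.1 hk)).symm

end MacFun

/-! ### Multiplication by a power of the product of all variables -/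

section Rect

theorem Ptn.rect_add_row (s r : ℕ) (l : Ptn) (i : ℕ) :
    (Ptn.rect s r + l).row i = (if i < r then s else 0) + l.row i := rfl

theorem Ptn.sum_rect_add_row (s r : ℕ) (l : Ptn) (j : ℕ) :
    ∑ i ∈ Finset.range j, (Ptn.rect s r + l).row i =
      (∑ i ∈ Finset.range j, if i < r then s else 0) + ∑ i ∈ Finset.range j, l.row i := by
  rw [← Finset.sum_add_distrib]
  rfl

theorem Ptn.length_rect_add_le {s r : ℕ} {l : Ptn} {n : ℕ} (hr : r ≤ n) (hl : l.length ≤ n) :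
    (Ptn.rect s r + l).length ≤ n := by
  by_contra h
  have h1 := ((Ptn.rect s r + l).row_ne_zero_iff n).2 (not_le.1 h)
  rw [Ptn.rect_add_row, if_neg (by omega), l.row_eq_zero hl] at h1
  exact h1 rfl

theorem Ptn.length_le_length_rect_add (s r : ℕ) (l : Ptn) :
    l.length ≤ (Ptn.rect s r + l).length := by
  by_contra h
  have h1 := (l.row_ne_zero_iff _).2 (not_le.1 h)
  have h2 := (Ptn.rect s r + l).row_eq_zero le_rfl
  rw [Ptn.rect_add_row] at h2
  omega

theorem Ptn.DomLT.rect_add {s r : ℕ} {k l : Ptn} (h : k.DomLT l) :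
    (Ptn.rect s r + k).DomLT (Ptn.rect s r + l) := by
  have hle : ∀ j, ∑ i ∈ Finset.range j, (Ptn.rect s r + k).row i ≤
      ∑ i ∈ Finset.range j, (Ptn.rect s r + l).row i := by
    intro j
    rw [Ptn.sum_rect_add_row, Ptn.sum_rect_add_row]
    exact Nat.add_le_add_left (h.1.2 j) _
  refine ⟨⟨?_, hle⟩, ?_⟩
  · set N := max r (max k.length l.length)
    rw [← (Ptn.rect s r + k).sum_range_row (n := N)
        (Ptn.length_rect_add_le (le_max_left _ _)
          ((le_max_left _ _).trans (le_max_right _ _))),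
      ← (Ptn.rect s r + l).sum_range_row (n := N)
        (Ptn.length_rect_add_le (le_max_left _ _)
          ((le_max_right _ _).trans (le_max_right _ _))),
      Ptn.sum_rect_add_row, Ptn.sum_rect_add_row,
      k.sum_range_row ((le_max_left _ _).trans (le_max_right _ _)),
      l.sum_range_row ((le_max_right _ _).trans (le_max_right _ _)), h.1.1]
  · intro heq
    apply h.2
    ext i
    have := congrArg (fun p : Ptn => p.row i) heq
    simp only [Ptn.rect_add_row] at this
    omega

variable {R : Type*} [CommRing R]

theorem prod_X_pow_eq_monomial (s r : ℕ) :
    (∏ i : Fin r, (X i : MvPolynomial (Fin r) R) ^ s) =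
      monomial (Finsupp.equivFunOnFinite.symm fun _ => s) 1 := by
  rw [monomial_eq, Finsupp.prod_fintype _ _ (by simp), C_1, one_mul]
  rfl

theorem prod_X_pow_mul_monoR {s r : ℕ} {l : Ptn} (hl : l.length ≤ r) :
    (∏ i : Fin r, X i ^ s) * monoR R l r = monoR R (Ptn.rect s r + l) r := by
  classical
  set c : Fin r →₀ ℕ := Finsupp.equivFunOnFinite.symm fun _ => s with hc
  have hexpo : (Ptn.rect s r + l).expo r = c + l.expo r := by
    ext i
    rw [Finsupp.add_apply, Ptn.expo_apply, Ptn.rect_add_row, if_pos i.2]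
    rfl
  have hperm : ∀ p : Equiv.Perm (Fin r), c.mapDomain p = c := by
    intro p
    ext i
    obtain ⟨j, rfl⟩ := p.surjective i
    rw [Finsupp.mapDomain_apply p.injective]
    rfl
  have hlen : (Ptn.rect s r + l).length ≤ r := Ptn.length_rect_add_le le_rfl hl
  ext e
  rw [prod_X_pow_eq_monomial, coeff_monomial_mul', coeff_monoR, coeff_monoR, one_mul]
  by_cases h : shape e = (Ptn.rect s r + l).parts
  · rw [if_pos h]
    obtain ⟨p, rfl⟩ := exists_perm_of_shape_eq (h.trans (Ptn.shape_expo _ hlen).symm)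
    rw [hexpo, Finsupp.mapDomain_add, hperm, if_pos le_self_add, add_tsub_cancel_left, if_pos]
    rw [shape_mapDomain p.injective, l.shape_expo hl]
  · rw [if_neg h]
    split_ifs with h1 h2
    · exfalso
      apply h
      obtain ⟨p, hp⟩ := exists_perm_of_shape_eq (h2.trans (l.shape_expo hl).symm)
      have : e = ((Ptn.rect s r + l).expo r).mapDomain p := by
        rw [hexpo, Finsupp.mapDomain_add, hperm, hp, add_tsub_cancel_of_le h1]
      rw [this, shape_mapDomain p.injective, Ptn.shape_expo _ hlen]
    · rfl
    · rfl

variable [Algebra ℚ R]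

/-- The linear map `m_k ↦ m_{(s^r) + k}` for `ℓ(k) ≤ r` and `m_k ↦ 0` otherwise. -/
def addRect (R : Type*) [CommRing R] [Algebra ℚ R] (s r : ℕ) :
    MvPolynomial ℕ R →ₗ[R] MvPolynomial ℕ R :=
  (Finsupp.linearCombination R fun k : Ptn =>
    if k.length ≤ r then monoFun R (Ptn.rect s r + k) else 0) ∘ₗ monomialCoeff R

theorem addRect_monoFun (s r : ℕ) (l : Ptn) : addRect R s r (monoFun R l) =
    if l.length ≤ r then monoFun R (Ptn.rect s r + l) else 0 := by
  rw [addRect, LinearMap.comp_apply, monomialCoeff_monoFun, Finsupp.linearCombination_single,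
    one_smul]

theorem ev_addRect (s r : ℕ) (F : MvPolynomial ℕ R) :
    ev R r (addRect R s r F) = (∏ i : Fin r, X i ^ s) * ev R r F := by
  rw [eq_sum_monoFun F, Finsupp.sum, map_sum, map_sum, map_sum, Finset.mul_sum]
  refine Finset.sum_congr rfl fun l _ => ?_
  rw [map_smul, map_smul, map_smul, mul_smul_comm, addRect_monoFun, ev_monoFun]
  split_ifs with h
  · rw [ev_monoFun, prod_X_pow_mul_monoR h]
  · rw [monoR_eq_zero R (not_le.1 h), map_zero, mul_zero]

theorem addRect_mem {s r : ℕ} {l : Ptn} {F : MvPolynomial ℕ R}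
    (hF : F ∈ monoSpan R {k | k.DomLT l}) :
    addRect R s r F ∈ monoSpan R {k | k.DomLT (Ptn.rect s r + l)} := by
  induction hF using Submodule.span_induction with
  | mem F hF =>
    obtain ⟨k, hk, rfl⟩ := hF
    rw [addRect_monoFun]
    split_ifs
    · exact monoFun_mem (Ptn.DomLT.rect_add hk)
    · exact zero_mem _
  | zero => simp
  | add F G _ _ hF hG => rw [map_add]; exact add_mem hF hG
  | smul c F _ hF => rw [map_smul]; exact Submodule.smul_mem _ _ hF

-- In r variables E - t^r is the part of the operator containing the T_i, and each T_i multiplies ∏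
-- x_j^s by ρ^s.
omit [Algebra ℚ R] in
theorem eig_rect_add (ρ t : R) {s r : ℕ} {l : Ptn} (hl : l.length ≤ r) :
    eig ρ t (Ptn.rect s r + l) - t ^ r = ρ ^ s * (eig ρ t l - t ^ r) := by
  rw [← eig_eq ρ t l hl, ← eig_eq ρ t _ (Ptn.length_rect_add_le le_rfl hl),
    add_sub_cancel_left, add_sub_cancel_left, mul_left_comm, Finset.mul_sum _ _ (ρ ^ s)]
  refine congrArg _ (Finset.sum_congr rfl fun i _ => ?_)
  rw [Ptn.rect_add_row, if_pos i.2, pow_add]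
  ring

variable [IsDomain R]

/-- By its explicit form E descends to n variables. Multiplication by ∏ x_i^s makes sense only
there, so eigenvector arguments for it take place after `ev`. -/
theorem ev_macOp_congr (ρ t : R) {n : ℕ} {F G : MvPolynomial ℕ R} (h : ev R n F = ev R n G) :
    ev R n (macOp ρ t F) = ev R n (macOp ρ t G) := by
  refine mul_left_cancel₀ (vand_ne_zero (R := R) (n := n)) ?_
  rw [vand_mul_ev_macOp, vand_mul_ev_macOp, h]

theorem ev_aeval_macOp_eq {ρ t e : R} {n : ℕ} {F : MvPolynomial ℕ R}
    (h : ev R n (macOp ρ t F) = e • ev R n F) (p : Polynomial R) :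
    ev R n (Polynomial.aeval (macOp ρ t) p F) = p.eval e • ev R n F := by
  have hpow : ∀ m : ℕ, ev R n ((macOp ρ t ^ m) F) = e ^ m • ev R n F := by
    intro m
    induction m with
    | zero => simp
    | succ m ih =>
      rw [pow_succ', Module.End.mul_apply,
        ev_macOp_congr ρ t (ih.trans (map_smul (ev R n) (e ^ m) F).symm), map_smul, map_smul, h,
        smul_smul, ← pow_succ]
  induction p using Polynomial.induction_on' with
  | add p p' hp hp' => rw [map_add, LinearMap.add_apply, map_add, hp, hp', Polynomial.eval_add,
      add_smul]
  | monomial m c =>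
    rw [Polynomial.aeval_monomial, Algebra.algebraMap_eq_smul_one, smul_mul_assoc, one_mul,
      LinearMap.smul_apply, map_smul, hpow, Polynomial.eval_monomial, smul_smul]

theorem ev_macOp_addRect (ρ t : R) {s r : ℕ} {l : Ptn} (hl : l.length ≤ r) {F : MvPolynomial ℕ R}
    (hF : macOp ρ t F = eig ρ t l • F) :
    ev R r (macOp ρ t (addRect R s r F)) =
      eig ρ t (Ptn.rect s r + l) • ev R r (addRect R s r F) := by
  refine mul_left_cancel₀ (vand_ne_zero (R := R) (n := r)) ?_
  have h1 := vand_mul_ev_macOp (n := r) ρ t F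
  rw [hF, map_smul] at h1
  have h2 : ∀ i : Fin r, scaleVar ρ i (∏ j : Fin r, X j ^ s) =
      C ρ ^ s * ∏ j : Fin r, (X j : MvPolynomial (Fin r) R) ^ s := by
    intro i
    rw [map_prod, ← Finset.mul_prod_erase _ _ (Finset.mem_univ i),
      ← Finset.mul_prod_erase _ (fun j : Fin r => (X j : MvPolynomial (Fin r) R) ^ s)
        (Finset.mem_univ i), map_pow, scaleVar, aeval_X, Function.update_self, mul_pow, mul_assoc]
    congr 2
    refine Finset.prod_congr rfl fun j hj => ?_
    rw [map_pow, aeval_X, Function.update_of_ne (Finset.ne_of_mem_erase hj)]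
  have h3 := congrArg (C : R → MvPolynomial (Fin r) R) (eig_rect_add ρ t (s := s) hl)
  simp only [C_sub, C_mul, C_pow] at h3
  rw [vand_mul_ev_macOp, ev_addRect]
  simp only [map_mul, h2, smul_eq_C_mul] at h1 ⊢
  have h4 : ∀ i : Fin r, (1 - C t) * macCoeff t i *
      (C ρ ^ s * (∏ j : Fin r, X j ^ s) * scaleVar ρ i (ev R r F)) =
      (C ρ ^ s * ∏ j : Fin r, X j ^ s) *
        ((1 - C t) * macCoeff t i * scaleVar ρ i (ev R r F)) := fun i => by ring
  rw [Finset.sum_congr rfl fun i _ => h4 i, ← Finset.mul_sum]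
  linear_combination (-(C ρ ^ s * ∏ j : Fin r, (X j : MvPolynomial (Fin r) R) ^ s)) * h1 -
    (∏ j : Fin r, (X j : MvPolynomial (Fin r) R) ^ s) * vand R r * ev R r F * h3

end Rect

section

variable {K : Type*} [Field K] [Algebra ℚ K]

/-- The difference H lies in the span of m_k with k < (s^r) + l, on which ∏ (E - e_k) vanishes. In r
variables H is an eigenvector for e_{(s^r)+l}, so the same product multiplies it by a nonzero
scalar. If ℓ(l) > r, both sides are zero. -/
theorem ev_macFun_rect_add {q t : K} (ht : t ≠ 0) (h : ∀ l, eigLead q⁻¹ t l ≠ 0) (s r : ℕ)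
    (l : Ptn) : ev K r (macFun q t (Ptn.rect s r + l)) =
      (∏ i : Fin r, X i ^ s) * ev K r (macFun q t l) := by
  have htri := isTriangular_macFun ht h
  by_cases hl : l.length ≤ r
  · set l' := Ptn.rect s r + l with hl'
    set H := addRect K s r (macFun q t l) - macFun q t l' with hH
    have hHmem : H ∈ monoSpan K (domBelow l' : Set Ptn) := by
      rw [coe_domBelow]
      have h1 := addRect_mem (s := s) (r := r) (htri l)
      rw [map_sub, addRect_monoFun, if_pos hl, ← hl'] at h1
      have h2 := sub_mem h1 (htri l')
      rwa [sub_sub_sub_cancel_right] at h2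
    have hHeig : ev K r (macOp q⁻¹ t H) = eig q⁻¹ t l' • ev K r H := by
      rw [hH, map_sub, map_sub, ev_macOp_addRect _ _ hl (macOp_macFun q ht l), macOp_macFun q ht,
        map_smul, map_sub, smul_sub]
    have h0 := aeval_eigPoly_eq_zero q⁻¹ ht (domBelow l') (fun k hk j hj =>
      mem_domBelow.2 (hj.trans_lt (mem_domBelow.1 hk))) hHmem
    have h1 := ev_aeval_macOp_eq hHeig (eigPoly q⁻¹ t (domBelow l'))
    rw [h0, map_zero] at h1
    have h2 : (eigPoly q⁻¹ t (domBelow l')).eval (eig q⁻¹ t l') = eigLead q⁻¹ t l' := by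
      simp [eigPoly, eigLead, Polynomial.eval_prod]
    rw [h2, eq_comm, smul_eq_zero] at h1
    have h3 := h1.resolve_left (h l')
    rw [hH, map_sub, ev_addRect, sub_eq_zero] at h3
    exact h3.symm
  · rw [htri.ev_eq_zero (not_le.1 hl), mul_zero,
      htri.ev_eq_zero ((not_le.1 hl).trans_le (Ptn.length_le_length_rect_add s r l))]

end

end MacSym
end

/-! ### Separation of eigenvalues, and `macFun` as the Macdonald functions for both kinds of
parameters. -/

noncomputable section

namespace MacSym

open MvPolynomial Filter Topology

/-! ### Separation of the eigenvalues -/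

section Separation

theorem sum_range_row_sub (l k : Ptn) {n : ℕ} (hl : l.length ≤ n) (hk : k.length ≤ n)
    (h : k.weight = l.weight) : ∑ i ∈ Finset.range n, ((l.row i : ℝ) - k.row i) = 0 := by
  rw [Finset.sum_sub_distrib, sub_eq_zero]
  exact_mod_cast (l.sum_range_row hl).trans (h.symm.trans (k.sum_range_row hk).symm)

theorem Ptn.ext_of_row {l k : Ptn} {n : ℕ} (hl : l.length ≤ n) (hk : k.length ≤ n)
    (h : ∀ i < n, l.row i = k.row i) : l = k := by
  ext i
  by_cases hi : i < n
  · exact h i hi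
  · rw [l.row_eq_zero (hl.trans (not_lt.1 hi)), k.row_eq_zero (hk.trans (not_lt.1 hi))]

theorem eig_sub_eig {R : Type*} [CommRing R] (ρ t : R) {l k : Ptn} {n : ℕ} (hl : l.length ≤ n)
    (hk : k.length ≤ n) : eig ρ t l - eig ρ t k =
      (1 - t) * ∑ i ∈ Finset.range n, t ^ i * (ρ ^ l.row i - ρ ^ k.row i) := by
  rw [eig_eq_sum ρ t l hl, eig_eq_sum ρ t k hk, add_sub_add_left_eq_sub, ← mul_sub,
    ← Finset.sum_sub_distrib]
  congr 1
  refine Finset.sum_congr rfl fun i _ => ?_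
  ring

theorem eq_of_sum_X_pow_eq_zero {R : Type*} [CommRing R] {n : ℕ} {a : ℕ → R}
    (h : ∑ i ∈ Finset.range n, (Polynomial.X : Polynomial R) ^ i * Polynomial.C (a i) = 0)
    {i : ℕ} (hi : i < n) : a i = 0 := by
  have h1 := congrArg (fun p => Polynomial.coeff p i) h
  simp only [Polynomial.finsetSum_coeff, Polynomial.coeff_zero, Polynomial.coeff_X_pow_mul',
    Polynomial.coeff_C] at h1
  rw [Finset.sum_eq_single i] at h1
  · simpa using h1
  · intro j _ hj
    split_ifs <;> first | omega | rfl
  · intro h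
    exact absurd (Finset.mem_range.2 hi) h

/-- The eigenvalues are distinct as polynomials in `t`. -/
theorem eig_X_injective {R : Type*} [CommRing R] [IsDomain R] {ρ : R}
    (hρ : Function.Injective fun n : ℕ => ρ ^ n) {l k : Ptn}
    (h : eig (Polynomial.C ρ) Polynomial.X l = eig (Polynomial.C ρ) Polynomial.X k) : l = k := by
  have hl := le_max_left l.length k.length
  have hk := le_max_right l.length k.length
  have h1 := eig_sub_eig (Polynomial.C ρ) Polynomial.X hl hk
  rw [h, sub_self, eq_comm, mul_eq_zero] at h1
  have h2 : (1 - Polynomial.X : Polynomial R) ≠ 0 := by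
    intro h0
    have := congrArg (fun p => Polynomial.coeff p 1) h0
    simp [Polynomial.coeff_one] at this
  have h3 := h1.resolve_left h2
  simp only [← Polynomial.C_pow, ← Polynomial.C_sub] at h3
  refine Ptn.ext_of_row hl hk fun i hi => hρ ?_
  exact sub_eq_zero.1 (eq_of_sum_X_pow_eq_zero h3 hi)

/-- Abel summation. The induction carries w_n D_n ≤ ∑_{i<n} w_i d_i, with D_n the partial sum of d;
the inequality becomes strict from j on because w strictly decreases and D_j > 0. -/
theorem sum_mul_pos {w d : ℕ → ℝ} (hw : StrictAnti w)
    (hd : ∀ j, 0 ≤ ∑ i ∈ Finset.range j, d i) {j n : ℕ} (hj : j ≤ n)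
    (hdj : 0 < ∑ i ∈ Finset.range j, d i) (hn : ∑ i ∈ Finset.range n, d i = 0) :
    0 < ∑ i ∈ Finset.range n, w i * d i := by
  have h : ∀ n, (w n * ∑ i ∈ Finset.range n, d i ≤ ∑ i ∈ Finset.range n, w i * d i) ∧
      (j ≤ n → w n * ∑ i ∈ Finset.range n, d i < ∑ i ∈ Finset.range n, w i * d i) := by
    intro n
    induction n with
    | zero =>
      refine ⟨by simp, fun h => ?_⟩
      rw [Nat.le_zero.1 h] at hdj
      simp at hdj
    | succ n ih =>
      have h1 : w (n + 1) * ∑ i ∈ Finset.range (n + 1), d i ≤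
          w n * ∑ i ∈ Finset.range (n + 1), d i :=
        mul_le_mul_of_nonneg_right (hw (Nat.lt_succ_self n)).le (hd _)
      have h2 : w n * ∑ i ∈ Finset.range (n + 1), d i =
          w n * ∑ i ∈ Finset.range n, d i + w n * d n := by
        rw [Finset.sum_range_succ, mul_add]
      rw [Finset.sum_range_succ (fun i => w i * d i)]
      refine ⟨by linarith [ih.1], fun h => ?_⟩
      rcases Nat.lt_or_eq_of_le h with h3 | h3
      · linarith [ih.2 (Nat.le_of_lt_succ h3)]
      · rw [h3] at hdj
        have h4 := mul_lt_mul_of_pos_right (hw (Nat.lt_succ_self n)) hdj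
        linarith [ih.1]
  have h1 := (h n).2 hj
  rwa [hn, mul_zero] at h1

/-- Convexity of a ↦ ρ^a at integers: the graph lies above the line through b and b + 1, of slope
ρ^b (ρ - 1). -/
theorem mul_sub_le_pow_sub_pow {ρ : ℝ} (hρ : 1 ≤ ρ) (a b : ℕ) :
    ρ ^ b * (ρ - 1) * ((a : ℝ) - b) ≤ ρ ^ a - ρ ^ b := by
  rcases le_total b a with h | h
  · obtain ⟨c, rfl⟩ := Nat.exists_eq_add_of_le h
    have h1 := one_add_mul_le_pow (show (-2 : ℝ) ≤ ρ - 1 by linarith) c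
    rw [add_sub_cancel] at h1
    have h2 : 0 < ρ ^ b := pow_pos (by linarith) b
    push_cast
    rw [pow_add]
    nlinarith
  · obtain ⟨c, rfl⟩ := Nat.exists_eq_add_of_le h
    have h1 : ρ ^ c - 1 ≤ ρ ^ c * (ρ - 1) * c := by
      clear h
      induction c with
      | zero => simp
      | succ c ih =>
        have h2 : 1 ≤ ρ ^ (c + 1) := one_le_pow₀ hρ
        have h3 := mul_le_mul_of_nonneg_left ih (show 0 ≤ ρ by linarith)
        have h4 := mul_le_mul_of_nonneg_left h2 (show 0 ≤ ρ - 1 by linarith)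
        push_cast
        rw [pow_succ] at h2 h4 ⊢
        linarith
    have h2 : 0 < ρ ^ a := pow_pos (by linarith) a
    have h3 := mul_le_mul_of_nonneg_left h1 h2.le
    push_cast
    rw [pow_add]
    linarith

/-- For `ρ > 1` and `0 < t < 1` the eigenvalues strictly increase in the dominance order. -/
theorem eig_lt_eig {ρ t : ℝ} (hρ : 1 < ρ) (ht : 0 < t) (ht' : t < 1) {k l : Ptn}
    (h : k.DomLT l) : eig ρ t k < eig ρ t l := by
  set n := max l.length k.length
  have hl : l.length ≤ n := le_max_left _ _
  have hk : k.length ≤ n := le_max_right _ _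
  rw [← sub_pos, eig_sub_eig ρ t hl hk]
  refine mul_pos (by linarith) ?_
  have hd : ∀ j, 0 ≤ ∑ i ∈ Finset.range j, ((l.row i : ℝ) - k.row i) := by
    intro j
    rw [Finset.sum_sub_distrib, sub_nonneg]
    exact_mod_cast h.1.2 j
  obtain ⟨j, hj, hdj⟩ : ∃ j ≤ n, 0 < ∑ i ∈ Finset.range j, ((l.row i : ℝ) - k.row i) := by
    by_contra! hcon
    refine h.2 (Ptn.ext_of_row hk hl fun i hi => ?_)
    have h1 := le_antisymm (hcon i hi.le) (hd i)
    have h2 := le_antisymm (hcon (i + 1) hi) (hd (i + 1))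
    rw [Finset.sum_range_succ, h1, zero_add, sub_eq_zero] at h2
    exact_mod_cast h2.symm
  -- After the linear bound with slope taken at the smaller partition k, these are the weights of
  -- the differences l_i - k_i. They strictly decrease because the rows of k decrease and t < 1.
  have hw : StrictAnti fun i => t ^ i * (ρ ^ k.row i * (ρ - 1)) := by
    refine strictAnti_nat_of_succ_lt fun i => ?_
    have h1 : ρ ^ k.row (i + 1) ≤ ρ ^ k.row i := pow_le_pow_right₀ hρ.le (k.anti (Nat.le_succ i))
    have h2 : 0 < ρ ^ k.row (i + 1) := pow_pos (by linarith) _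
    refine mul_lt_mul (pow_lt_pow_right_of_lt_one₀ ht ht' (Nat.lt_succ_self i))
      (mul_le_mul_of_nonneg_right h1 (by linarith)) (mul_pos h2 (by linarith)) (pow_pos ht i).le
  refine (sum_mul_pos hw hd hj hdj (sum_range_row_sub l k hl hk h.1.1)).trans_le
    (Finset.sum_le_sum fun i _ => ?_)
  rw [mul_assoc]
  exact mul_le_mul_of_nonneg_left (mul_sub_le_pow_sub_pow hρ.le _ _) (pow_pos ht i).le

end Separation

theorem eq_zero_of_eventually {E : Type*} [TopologicalSpace E] [T2Space E] [Zero E] {f : ℝ → E}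
    {t : ℝ} (hf : ContinuousAt f t) (h : ∀ᶠ τ in 𝓝[≠] t, f τ = 0) : f t = 0 := by
  refine tendsto_nhds_unique (l := 𝓝[≠] t) (hf.tendsto.mono_left nhdsWithin_le_nhds) ?_
  exact tendsto_const_nhds.congr' (h.mono fun τ hτ => hτ.symm)

theorem Polynomial.eventually_eval_ne_zero {p : Polynomial ℝ} (hp : p ≠ 0) (t : ℝ) :
    ∀ᶠ τ in 𝓝[≠] t, p.eval τ ≠ 0 := by
  have h1 : ({x | p.IsRoot x} \ {t}).Finite := (Polynomial.finite_setOfPred_isRoot hp).subset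
    Set.sdiff_subset
  have h2 : ({x | p.IsRoot x} \ {t})ᶜ ∈ 𝓝 t := h1.isClosed.isOpen_compl.mem_nhds (by simp)
  filter_upwards [nhdsWithin_le_nhds h2, self_mem_nhdsWithin] with τ h3 h4 h5
  exact h3 ⟨h5, h4⟩

/-- An identity that depends continuously on `t` holds if it holds whenever two given
eigenvalues are distinct. -/
theorem eq_zero_of_eig_ne {E : Type*} [TopologicalSpace E] [T2Space E] [Zero E] {ρ t : ℝ}
    (hρ : 1 < ρ) (ht : 0 < t) (ht' : t < 1) {l k : Ptn} (hlk : l ≠ k) {f : ℝ → E}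
    (hf : ContinuousAt f t)
    (h : ∀ τ : ℝ, 0 < τ → τ < 1 → eig ρ τ l ≠ eig ρ τ k → f τ = 0) : f t = 0 := by
  refine eq_zero_of_eventually hf ?_
  -- The difference of the eigenvalues is a nonzero polynomial in t, so the eigenvalues differ for
  -- every τ ≠ t close to t.
  have hp : eig (Polynomial.C ρ) Polynomial.X l - eig (Polynomial.C ρ) Polynomial.X k ≠ 0 :=
    fun h0 => hlk (eig_X_injective (pow_right_injective₀ (by linarith) hρ.ne') (sub_eq_zero.1 h0))
  filter_upwards [Polynomial.eventually_eval_ne_zero hp t,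
    nhdsWithin_le_nhds (Ioo_mem_nhds ht ht')] with τ h1 h2
  refine h τ h2.1 h2.2 fun h3 => h1 ?_
  have h4 := fun j => map_eig (Polynomial.evalRingHom τ) (Polynomial.C ρ) Polynomial.X j
  simp only [Polynomial.coe_evalRingHom, Polynomial.eval_C, Polynomial.eval_X] at h4
  rw [Polynomial.eval_sub, h4, h4, h3, sub_self]

theorem pform_eq_zero_of_eigenvalue_ne {K : Type*} [Field K] [Algebra ℚ K] {q t : K} (hq : q ≠ 0)
    (ht : ∀ r : ℕ, 1 - t ^ (r + 1) ≠ 0) {F G : MvPolynomial ℕ K} {a b : K}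
    (hF : macOp q⁻¹ t F = a • F) (hG : macOp q⁻¹ t G = b • G) (h : a ≠ b) :
    pform (cnorm q t) F G = 0 := by
  have hE := pform_macOp (c := cnorm q t) (t := t) (inv_mul_cancel₀ hq) (fun r => by
    rw [cnorm]
    field_simp [ht r]) F G
  rw [hF, hG, map_smul, map_smul, LinearMap.smul_apply, smul_eq_mul,
    smul_eq_mul, ← sub_eq_zero, ← sub_mul] at hE
  exact (mul_eq_zero.1 hE).resolve_left (sub_ne_zero.2 h)

theorem pnorm_ne_zero {K : Type*} [Field K] [CharZero K] {c : ℕ → K} (hc : ∀ r, c r ≠ 0)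
    (a : ℕ →₀ ℕ) : pnorm c a ≠ 0 :=
  Finset.prod_ne_zero_iff.2 fun r _ =>
    mul_ne_zero (pow_ne_zero _ (hc r)) (Nat.cast_ne_zero.2 (Nat.factorial_ne_zero _))

theorem cnorm_ne_zero {K : Type*} [Field K] [CharZero K] {q t : K}
    (hq : ∀ r : ℕ, 1 - q ^ (r + 1) ≠ 0) (ht : ∀ r : ℕ, 1 - t ^ (r + 1) ≠ 0) (r : ℕ) :
    cnorm q t r ≠ 0 :=
  mul_ne_zero (by exact_mod_cast r.succ_ne_zero) (div_ne_zero (hq r) (ht r))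

theorem inVars_toSymFun_rect_add {K : Type*} [Field K] [Algebra ℚ K] {q t : K} (ht : t ≠ 0)
    (h : ∀ l, eigLead q⁻¹ t l ≠ 0) (h' : ∀ l, macP q t l = toSymFun K (macFun q t l)) (r s : ℕ)
    (l : Ptn) : inVars (macP q t (Ptn.rect s r + l)) r = mapG s r (inVars (macP q t l) r) := by
  refine Subtype.ext ?_
  change (macP q t (Ptn.rect s r + l)).1 r = (∏ i, MvPolynomial.X i ^ s) * (macP q t l).1 r
  rw [h', h', toSymFun_apply, toSymFun_apply, ev_macFun_rect_add ht h]

/-! ### Real parameters -/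

section Real

variable {q t : ℝ}

theorem one_sub_pow_succ_ne_zero (ht : 0 < t) (ht' : t < 1) (r : ℕ) : 1 - t ^ (r + 1) ≠ 0 :=
  (sub_pos.2 (pow_lt_one₀ ht.le ht' r.succ_ne_zero)).ne'

theorem eigLead_ne_zero_real (hq : 0 < q) (hq' : q < 1) (ht : 0 < t) (ht' : t < 1) (l : Ptn) :
    eigLead q⁻¹ t l ≠ 0 :=
  eigLead_ne_zero fun _ hk => (eig_lt_eig ((one_lt_inv₀ hq).2 hq') ht ht' hk).ne

/-- The eigenfunctions as polynomials in `t`. -/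
def genFun (ρ : ℝ) (l : Ptn) : MvPolynomial ℕ (Polynomial ℝ) :=
  eigFun (Polynomial.C ρ) Polynomial.X l

theorem map_genFun (ρ τ : ℝ) (l : Ptn) :
    map (Polynomial.evalRingHom τ) (genFun ρ l) = eigFun ρ τ l := by
  rw [genFun, map_eigFun]
  simp

theorem coeff_eigFun_eq_eval (ρ τ : ℝ) (l : Ptn) (a : ℕ →₀ ℕ) :
    coeff a (eigFun ρ τ l) = ((genFun ρ l).coeff a).eval τ := by
  rw [← map_genFun, coeff_map]
  rfl

theorem continuousAt_pform_eigFun (q : ℝ) (ht : 0 < t) (ht' : t < 1) (l k : Ptn) :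
    ContinuousAt (fun τ => pform (cnorm q τ) (eigFun q⁻¹ τ l) (eigFun q⁻¹ τ k)) t := by
  -- The support of the eigenfunction over ℝ[t] is a finite index set valid for all τ, so only
  -- finitely many continuous terms are added.
  have h : ∀ τ, pform (cnorm q τ) (eigFun q⁻¹ τ l) (eigFun q⁻¹ τ k) =
      ∑ a ∈ (genFun q⁻¹ l).support, ((genFun q⁻¹ l).coeff a).eval τ *
        (pnorm (cnorm q τ) a * ((genFun q⁻¹ k).coeff a).eval τ) := by
    intro τ
    rw [pform_eq_sum (S := (genFun q⁻¹ l).support)]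
    · simp only [coeff_eigFun_eq_eval]
    · rw [← map_genFun]
      exact support_map_subset _ _
  have hc : ∀ r, ContinuousAt (fun τ => cnorm q τ r) t := by
    intro r
    refine continuousAt_const.mul (continuousAt_const.div (by fun_prop) ?_)
    exact one_sub_pow_succ_ne_zero ht ht' r
  have hp : ∀ a, ContinuousAt (fun τ => pnorm (cnorm q τ) a) t := by
    intro a
    unfold pnorm Finsupp.prod
    exact tendsto_finsetProd _ fun r _ => ((hc r).pow _).mul continuousAt_const
  simp only [h]
  refine tendsto_finsetSum _ fun a _ => ?_
  exact ((Polynomial.continuous _).continuousAt).mul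
    ((hp a).mul (Polynomial.continuous _).continuousAt)

/-- Incomparable partitions are not separated by `eig_lt_eig`, so self-adjointness is used at nearby
τ only. The limit is taken for `eigFun`, which has no denominators in τ; the normalization at t
comes last. -/
theorem pform_macFun_real (hq : 0 < q) (hq' : q < 1) (ht : 0 < t) (ht' : t < 1) {l k : Ptn}
    (hlk : l ≠ k) : pform (cnorm q t) (macFun q t l) (macFun q t k) = 0 := by
  have h := eq_zero_of_eig_ne ((one_lt_inv₀ hq).2 hq') ht ht' hlk
    (continuousAt_pform_eigFun q ht ht' l k) fun τ hτ hτ' hne =>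
      pform_eq_zero_of_eigenvalue_ne hq.ne' (one_sub_pow_succ_ne_zero hτ hτ')
        (macOp_eigFun _ hτ.ne' l) (macOp_eigFun _ hτ.ne' k) hne
  rw [macFun, macFun, map_smul, map_smul, LinearMap.smul_apply, h, smul_zero, smul_zero]

theorem pnorm_cnorm_ne_zero (hq : 0 < q) (hq' : q < 1) (ht : 0 < t) (ht' : t < 1)
    (a : ℕ →₀ ℕ) : pnorm (cnorm q t) a ≠ 0 :=
  pnorm_ne_zero (cnorm_ne_zero (one_sub_pow_succ_ne_zero hq hq') (one_sub_pow_succ_ne_zero ht ht'))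
    a

theorem isTriangular_macFun_real (hq : 0 < q) (hq' : q < 1) (ht : 0 < t) (ht' : t < 1) :
    IsTriangular (macFun q t) :=
  isTriangular_macFun ht.ne' (eigLead_ne_zero_real hq hq' ht ht')

theorem macP_real (hq : 0 < q) (hq' : q < 1) (ht : 0 < t) (ht' : t < 1) (l : Ptn) :
    macP q t l = toSymFun ℝ (macFun q t l) :=
  macP_eq (pnorm_cnorm_ne_zero hq hq' ht ht') (isTriangular_macFun_real hq hq' ht ht')
    (fun _ _ h => pform_macFun_real hq hq' ht ht' h) l

theorem rect_add_real (hq : 0 < q) (hq' : q < 1) (ht : 0 < t) (ht' : t < 1) (r s : ℕ) (l : Ptn) :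
    inVars (macP q t (Ptn.rect s r + l)) r = mapG s r (inVars (macP q t l) r) :=
  inVars_toSymFun_rect_add ht.ne' (eigLead_ne_zero_real hq hq' ht ht') (macP_real hq hq' ht ht') r
    s l

end Real

/-! ### Indeterminate parameters -/

section Indeterminate

theorem algebraMap_ne_zero {p : MvPolynomial (Fin 2) ℚ} (x y : ℚ)
    (h : MvPolynomial.eval ![x, y] p ≠ 0) :
    algebraMap (MvPolynomial (Fin 2) ℚ) Qqt p ≠ 0 := by
  intro h0
  rw [FaithfulSMul.algebraMap_eq_zero_iff] at h0
  rw [h0, map_zero] at h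
  exact h rfl

theorem indq_ne_zero : indq ≠ 0 := algebraMap_ne_zero 1 1 (by simp)

theorem indt_ne_zero : indt ≠ 0 := algebraMap_ne_zero 1 1 (by simp)

theorem one_sub_indq_pow_ne_zero (r : ℕ) : 1 - indq ^ (r + 1) ≠ 0 := by
  have h : 1 - indq ^ (r + 1) = algebraMap (MvPolynomial (Fin 2) ℚ) Qqt (1 - X 0 ^ (r + 1)) := by
    rw [map_sub, map_one, map_pow, indq]
  rw [h]
  exact algebraMap_ne_zero 0 0 (by simp)

theorem one_sub_indt_pow_ne_zero (r : ℕ) : 1 - indt ^ (r + 1) ≠ 0 := by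
  have h : 1 - indt ^ (r + 1) = algebraMap (MvPolynomial (Fin 2) ℚ) Qqt (1 - X 1 ^ (r + 1)) := by
    rw [map_sub, map_one, map_pow, indt]
  rw [h]
  exact algebraMap_ne_zero 0 0 (by simp)

theorem eig_ind_injective {l k : Ptn} (h : eig indq⁻¹ indt l = eig indq⁻¹ indt k) : l = k := by
  set n := max l.length k.length
  have hl : l.length ≤ n := le_max_left _ _
  have hk : k.length ≤ n := le_max_right _ _
  have h1 := eig_sub_eig indq⁻¹ indt hl hk
  have ht := one_sub_indt_pow_ne_zero 0
  rw [zero_add, pow_one] at ht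
  rw [h, sub_self, eq_comm, mul_eq_zero] at h1
  have h2 := h1.resolve_left ht
  -- N bounds all rows of both partitions, so multiplication by q^N removes the negative powers of
  -- q.
  set N := l.row 0 + k.row 0
  have hlN : ∀ i, l.row i ≤ N := fun i => (l.anti i.zero_le).trans (Nat.le_add_right _ _)
  have hkN : ∀ i, k.row i ≤ N := fun i => (k.anti i.zero_le).trans (Nat.le_add_left _ _)
  have h3 : algebraMap (MvPolynomial (Fin 2) ℚ) Qqt (∑ i ∈ Finset.range n,
      X 1 ^ i * (X 0 ^ (N - l.row i) - X 0 ^ (N - k.row i))) = 0 := by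
    rw [← mul_zero (indq ^ N), ← h2, Finset.mul_sum, map_sum]
    refine Finset.sum_congr rfl fun i _ => ?_
    rw [map_mul, map_sub, map_pow, map_pow, map_pow]
    change indt ^ i * (indq ^ _ - indq ^ _) = _
    rw [pow_sub₀ _ indq_ne_zero (hlN i), pow_sub₀ _ indq_ne_zero (hkN i), inv_pow, inv_pow]
    ring
  rw [FaithfulSMul.algebraMap_eq_zero_iff] at h3
  -- Putting q = 2 leaves a polynomial in t whose coefficients are differences of powers of 2, and
  -- these vanish only for equal exponents.
  have h4 := congrArg (aeval ![(Polynomial.C (2 : ℚ) : Polynomial ℚ), Polynomial.X]) h3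
  simp only [map_sum, map_mul, map_sub, map_pow, aeval_X, map_zero, Matrix.cons_val_zero,
    Matrix.cons_val_one] at h4
  simp only [← Polynomial.C_pow, ← Polynomial.C_sub] at h4
  refine Ptn.ext_of_row hl hk fun i hi => ?_
  have h5 := sub_eq_zero.1 (eq_of_sum_X_pow_eq_zero h4 hi)
  have h6 := pow_right_injective₀ (show (0 : ℚ) < 2 by norm_num) (by norm_num) h5
  have := hlN i
  have := hkN i
  omega

theorem eigLead_ind_ne_zero (l : Ptn) : eigLead indq⁻¹ indt l ≠ 0 :=
  eigLead_ne_zero fun _ hk h => hk.2 (eig_ind_injective h)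

theorem macP_ind (l : Ptn) : macP indq indt l = toSymFun Qqt (macFun indq indt l) :=
  macP_eq (pnorm_ne_zero (cnorm_ne_zero one_sub_indq_pow_ne_zero one_sub_indt_pow_ne_zero))
    (isTriangular_macFun indt_ne_zero eigLead_ind_ne_zero)
    (fun _ _ h => pform_eq_zero_of_eigenvalue_ne indq_ne_zero one_sub_indt_pow_ne_zero
      (macOp_macFun _ indt_ne_zero _) (macOp_macFun _ indt_ne_zero _)
      fun h' => h (eig_ind_injective h')) l

theorem rect_add_ind (r s : ℕ) (l : Ptn) :
    inVars (macP indq indt (Ptn.rect s r + l)) r = mapG s r (inVars (macP indq indt l) r) :=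
  inVars_toSymFun_rect_add indt_ne_zero eigLead_ind_ne_zero macP_ind r s l

end Indeterminate

end MacSym
end

/-! ### Analytic properties of the infinite products. -/

noncomputable section

namespace MacSym

open Filter Topology

/-! ### The infinite products `(a;q)_∞` -/

section QPoch

variable {q : ℂ}

theorem summable_norm_mul_pow (hq : ‖q‖ < 1) (a : ℂ) : Summable fun k : ℕ => ‖-(a * q ^ k)‖ := by
  simp only [norm_neg, norm_mul, norm_pow]
  exact (summable_geometric_of_lt_one (norm_nonneg _) hq).mul_left _

theorem multipliable_qPoch (hq : ‖q‖ < 1) (a : ℂ) : Multipliable fun k : ℕ => 1 - a * q ^ k := by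
  simp only [sub_eq_add_neg]
  exact multipliable_one_add_of_summable (summable_norm_mul_pow hq a)

theorem differentiable_qPoch (hq : ‖q‖ < 1) : Differentiable ℂ fun a => qPoch a q := by
  intro a
  have hball : Metric.ball (0 : ℂ) (‖a‖ + 1) ∈ 𝓝 a :=
    Metric.isOpen_ball.mem_nhds (by simp)
  have h := Summable.hasProdLocallyUniformlyOn_nat_one_add (f := fun k (a : ℂ) => -(a * q ^ k))
    (Metric.isOpen_ball (x := (0 : ℂ)) (ε := ‖a‖ + 1))
    ((summable_geometric_of_lt_one (norm_nonneg _) hq).mul_left (‖a‖ + 1))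
    (Eventually.of_forall fun k x hx => by
      rw [norm_neg, norm_mul, norm_pow]
      exact mul_le_mul_of_nonneg_right (mem_ball_zero_iff.1 hx).le (by positivity))
    (fun k => by fun_prop)
  simp only [← sub_eq_add_neg] at h
  refine (TendstoLocallyUniformlyOn.differentiableOn h (Eventually.of_forall fun s => ?_)
    Metric.isOpen_ball).differentiableAt hball
  exact DifferentiableOn.fun_finsetProd fun i _ => by fun_prop

theorem continuous_qPoch (hq : ‖q‖ < 1) : Continuous fun a => qPoch a q :=
  (differentiable_qPoch hq).continuous

theorem qPoch_eq_mul (hq : ‖q‖ < 1) (a : ℂ) : qPoch a q = (1 - a) * qPoch (q * a) q := by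
  have h : (fun k : ℕ => 1 - a * q ^ (k + 1)) = fun k : ℕ => 1 - q * a * q ^ k := by
    ext k
    ring
  rw [qPoch, tprod_eq_zero_mul' (by rw [h]; exact multipliable_qPoch hq _), h, pow_zero, mul_one]
  rfl

theorem qPoch_ne_zero (hq : ‖q‖ < 1) {a : ℂ} (ha : ‖a‖ < 1) : qPoch a q ≠ 0 := by
  have h := tprod_one_add_ne_zero_of_summable (f := fun k : ℕ => -(a * q ^ k)) (fun k h0 => ?_)
    (summable_norm_mul_pow hq a)
  · simp only [← sub_eq_add_neg] at h
    exact h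
  · have h1 : ‖a * q ^ k‖ < 1 := by
      rw [norm_mul, norm_pow]
      exact mul_lt_one_of_nonneg_of_lt_one_left (norm_nonneg _) ha
        (pow_le_one₀ (norm_nonneg _) hq.le)
    rw [← sub_eq_add_neg, sub_eq_zero] at h0
    rw [← h0, norm_one] at h1
    exact lt_irrefl _ h1

theorem conj_qPoch {q : ℝ} (hq : ‖(q : ℂ)‖ < 1) (a : ℂ) :
    (starRingEnd ℂ) (qPoch a q) = qPoch ((starRingEnd ℂ) a) q := by
  rw [qPoch, (multipliable_qPoch hq a).map_tprod (starRingEnd ℂ) Complex.continuous_conj]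
  simp [qPoch]

/-- The logarithms of the factors give the double series of (a q^k)^{r+1}/(r+1). It converges
absolutely; summing over k first is a geometric series, and summing over r first gives the product.
-/
theorem qPoch_eq_exp (hq : ‖q‖ < 1) {a : ℂ} (ha : ‖a‖ < 1) :
    ∃ S, HasSum (fun r : ℕ => a ^ (r + 1) / ((r + 1) * (1 - q ^ (r + 1)))) S ∧
      qPoch a q = Complex.exp (-S) := by
  set f : ℕ × ℕ → ℂ := fun p => (a * q ^ p.1) ^ (p.2 + 1) / (p.2 + 1) with hf
  have hsum : Summable f := by
    refine Summable.of_norm_bounded ((summable_geometric_of_lt_one (norm_nonneg q) hq).mul_of_nonneg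
      (summable_geometric_of_lt_one (norm_nonneg a) ha) (fun _ => by positivity)
      (fun _ => by positivity)) fun p => ?_
    rw [hf, norm_div, norm_pow, norm_mul, norm_pow]
    have h1 : (1 : ℝ) ≤ ‖(p.2 : ℂ) + 1‖ := by
      have h2 : (p.2 : ℂ) + 1 = ((p.2 + 1 : ℕ) : ℂ) := by push_cast; rfl
      rw [h2, Complex.norm_natCast]
      exact_mod_cast Nat.succ_pos _
    refine (div_le_self (by positivity) h1).trans ?_
    rw [mul_pow, ← pow_mul, mul_comm]
    refine mul_le_mul (pow_le_pow_of_le_one (norm_nonneg _) hq.le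
      (Nat.le_mul_of_pos_right _ (Nat.succ_pos _)))
      (pow_le_pow_of_le_one (norm_nonneg _) ha.le (Nat.le_succ _)) (by positivity) (by positivity)
  have hlt : ∀ k : ℕ, ‖a * q ^ k‖ < 1 := fun k => by
    rw [norm_mul, norm_pow]
    exact mul_lt_one_of_nonneg_of_lt_one_left (norm_nonneg _) ha
      (pow_le_one₀ (norm_nonneg _) hq.le)
  refine ⟨∑' p, f p, ?_, ?_⟩
  · have h1 : HasSum (fun p : ℕ × ℕ => f p.swap) (∑' p, f p) :=
      (Equiv.prodComm ℕ ℕ).hasSum_iff.2 hsum.hasSum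
    refine h1.prod_fiberwise fun r => ?_
    have h2 : ‖q ^ (r + 1)‖ < 1 := by
      rw [norm_pow]
      exact pow_lt_one₀ (norm_nonneg _) hq (Nat.succ_ne_zero r)
    have h3 := (hasSum_geometric_of_norm_lt_one h2).mul_left (a ^ (r + 1) / ((r : ℂ) + 1))
    rw [← div_eq_mul_inv, div_div] at h3
    refine h3.congr_fun fun k => ?_
    simp only [hf, Prod.swap]
    ring
  · have h1 : HasSum (fun k : ℕ => -Complex.log (1 - a * q ^ k)) (∑' p, f p) := by
      refine hsum.hasSum.prod_fiberwise fun k => ?_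
      have h2 := (hasSum_nat_add_iff' 1).2 (Complex.hasSum_taylorSeries_neg_log (hlt k))
      simpa [hf] using h2
    have h3 := h1.neg.cexp
    rw [← h3.tprod_eq, qPoch]
    refine tprod_congr fun k => ?_
    rw [Function.comp_apply, neg_neg, Complex.exp_log]
    intro h0
    have h4 := hlt k
    rw [← sub_eq_zero.1 h0, norm_one] at h4
    exact lt_irrefl _ h4

theorem hasSum_qPoch_div {q t u : ℂ} (hq : ‖q‖ < 1) (ht : ‖t‖ ≤ 1) (hu : ‖u‖ < 1) :
    ∃ S, HasSum (fun r : ℕ => (1 - t ^ (r + 1)) / (1 - q ^ (r + 1)) * u ^ (r + 1) / (r + 1)) S ∧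
      qPoch (t * u) q / qPoch u q = Complex.exp S := by
  have htu : ‖t * u‖ < 1 := by
    rw [norm_mul]
    exact mul_lt_one_of_nonneg_of_lt_one_right ht (norm_nonneg _) hu
  obtain ⟨S, hS, hS'⟩ := qPoch_eq_exp hq hu
  obtain ⟨T, hT, hT'⟩ := qPoch_eq_exp hq htu
  refine ⟨S - T, ?_, ?_⟩
  · refine (hS.sub hT).congr_fun fun r => ?_
    rw [mul_pow, div_mul_eq_div_div, div_mul_eq_div_div]
    ring
  · rw [hS', hT', ← Complex.exp_sub]
    congr 1
    ring

end QPoch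

end MacSym
end

/-! ### Integration over the torus and contour deformation. -/

noncomputable section

namespace MacSym

open Filter Topology MeasureTheory Set

/-! ### Integration over the torus -/

section Torus

variable {m : ℕ}

/-- The point of the torus with arguments `θ`. -/
def tor (θ : Fin m → ℝ) : Fin m → ℂ := fun j => Complex.exp (θ j * Complex.I)

theorem norm_tor (θ : Fin m → ℝ) (j : Fin m) : ‖tor θ j‖ = 1 :=
  Complex.norm_exp_ofReal_mul_I _

theorem continuous_tor : Continuous (tor : (Fin m → ℝ) → Fin m → ℂ) := by
  unfold tor
  fun_prop

/-- The cube of arguments. -/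
def cube (m : ℕ) : Set (Fin m → ℝ) := Icc 0 fun _ => 2 * Real.pi

theorem isCompact_cube : IsCompact (cube m) := isCompact_Icc

instance : IsFiniteMeasure (volume.restrict (cube m)) :=
  isFiniteMeasure_restrict.2 isCompact_cube.measure_lt_top.ne

theorem integrableOn_cube {G : (Fin m → ℝ) → ℂ} (hG : Continuous G) : IntegrableOn G (cube m) :=
  hG.continuousOn.integrableOn_compact isCompact_cube

theorem torusMean_eq (F : (Fin m → ℂ) → ℂ) :
    torusMean F = ((2 * Real.pi : ℂ)⁻¹) ^ m * ∫ θ in cube m, F (tor θ) := by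
  rw [torusMean, torusIntegral, ← integral_const_mul]
  refine setIntegral_congr_fun measurableSet_Icc fun θ _ => ?_
  have h : torusMap 0 (fun _ => (1 : ℝ)) θ = tor θ := by
    ext j
    simp [torusMap, tor]
  have h1 : ∀ j : Fin m, tor θ j ≠ 0 := fun j => Complex.exp_ne_zero _
  have h2 : (Real.pi : ℂ) ≠ 0 := Complex.ofReal_ne_zero.2 Real.pi_ne_zero
  simp only [h, smul_eq_mul]
  rw [← mul_assoc, ← Finset.prod_mul_distrib]
  congr 1
  rw [Finset.prod_congr rfl (g := fun _ => (2 * Real.pi : ℂ)⁻¹), Finset.prod_const,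
    Finset.card_univ, Fintype.card_fin]
  intro j _
  have h3 := h1 j
  change (1 : ℝ) * tor θ j * Complex.I * _ = _
  field_simp
  simp

theorem torusMean_congr {F G : (Fin m → ℂ) → ℂ} (h : ∀ y, (∀ j, ‖y j‖ = 1) → F y = G y) :
    torusMean F = torusMean G := by
  rw [torusMean_eq, torusMean_eq]
  congr 2
  ext θ
  exact h _ (norm_tor θ)

theorem torusMean_const_mul (c : ℂ) (F : (Fin m → ℂ) → ℂ) :
    torusMean (fun y => c * F y) = c * torusMean F := by
  rw [torusMean_eq, torusMean_eq, integral_const_mul]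
  ring

theorem torusMean_add {F G : (Fin m → ℂ) → ℂ} (hF : Continuous fun θ => F (tor θ))
    (hG : Continuous fun θ => G (tor θ)) :
    torusMean (fun y => F y + G y) = torusMean F + torusMean G := by
  rw [torusMean_eq, torusMean_eq, torusMean_eq,
    integral_add (integrableOn_cube hF) (integrableOn_cube hG)]
  ring

theorem torusMean_sum {ι : Type*} (s : Finset ι) {F : ι → (Fin m → ℂ) → ℂ}
    (hF : ∀ i ∈ s, Continuous fun θ => F i (tor θ)) :
    torusMean (fun y => ∑ i ∈ s, F i y) = ∑ i ∈ s, torusMean (F i) := by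
  simp only [torusMean_eq]
  rw [integral_finsetSum _ fun i hi => integrableOn_cube (hF i hi), Finset.mul_sum]

theorem hasSum_torusMean {F : ℕ → (Fin m → ℂ) → ℂ} (hF : ∀ d, Continuous fun θ => F d (tor θ))
    {u : ℕ → ℝ} (hu : Summable u) (h : ∀ d, ∀ θ ∈ cube m, ‖F d (tor θ)‖ ≤ u d) :
    HasSum (fun d => torusMean (F d)) (torusMean fun y => ∑' d, F d y) := by
  simp only [torusMean_eq]
  refine (hasSum_integral_of_summable_integral_norm (fun d => integrableOn_cube (hF d)) ?_).mul_left
    _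
  refine Summable.of_nonneg_of_le (fun d => integral_nonneg fun θ => norm_nonneg _) (fun d => ?_)
    (hu.mul_left (volume.real (cube m)))
  refine (setIntegral_mono_on (integrableOn_cube (hF d)).norm (integrableOn_const
    isCompact_cube.measure_lt_top.ne) measurableSet_Icc fun θ hθ => h d θ hθ).trans ?_
  rw [setIntegral_const, smul_eq_mul]

theorem continuous_torusMean {T : Type*} [TopologicalSpace T] [FirstCountableTopology T]
    [LocallyCompactSpace T] {F : T → (Fin m → ℂ) → ℂ}
    (hF : Continuous fun p : T × (Fin m → ℝ) => F p.1 (tor p.2)) :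
    Continuous fun τ => torusMean (F τ) := by
  simp only [torusMean_eq]
  exact continuous_const.mul (continuous_parametric_integral_of_continuous
    (f := fun τ θ => F τ (tor θ)) hF isCompact_cube)

theorem eq_zero_of_torusMean_eq_zero {F : (Fin m → ℂ) → ℂ} {g : (Fin m → ℝ) → ℝ}
    (hg : Continuous g) (hg' : ∀ θ, 0 ≤ g θ) (hF : ∀ θ, F (tor θ) = g θ)
    (h : torusMean F = 0) {θ : Fin m → ℝ} (hθ : ∀ j, θ j ∈ Ioo 0 (2 * Real.pi)) : g θ = 0 := by
  have h2 : (2 * Real.pi : ℂ) ≠ 0 :=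
    mul_ne_zero two_ne_zero (Complex.ofReal_ne_zero.2 Real.pi_ne_zero)
  rw [torusMean_eq, mul_eq_zero] at h
  have h3 := h.resolve_left (pow_ne_zero _ (inv_ne_zero h2))
  simp only [hF] at h3
  rw [integral_complex_ofReal, Complex.ofReal_eq_zero, setIntegral_eq_zero_iff_of_nonneg_ae
    (Eventually.of_forall hg') (hg.continuousOn.integrableOn_compact isCompact_cube)] at h3
  set U : Set (Fin m → ℝ) := univ.pi fun _ => Ioo 0 (2 * Real.pi)
  have hU : IsOpen U := isOpen_set_pi finite_univ fun _ _ => isOpen_Ioo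
  have hUc : U ⊆ cube m := fun x hx =>
    ⟨fun j => (hx j (mem_univ j)).1.le, fun j => (hx j (mem_univ j)).2.le⟩
  exact Measure.eqOn_open_of_ae_eq (ae_restrict_of_ae_restrict_of_subset hUc h3) hU
    hg.continuousOn continuousOn_const (fun j _ => hθ j)

theorem integral_cube_succ {n : ℕ} (i : Fin (n + 1)) {G : (Fin (n + 1) → ℝ) → ℂ}
    (hG : Continuous G) : ∫ θ in cube (n + 1), G θ =
      ∫ y in cube n, ∫ x in Icc 0 (2 * Real.pi), G (i.insertNth x y) := by
  set e : ℝ × (Fin n → ℝ) ≃ᵐ (Fin (n + 1) → ℝ) :=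
    (MeasurableEquiv.piFinSuccAbove (fun _ => ℝ) i).symm
  have hem : MeasurePreserving e :=
    (volume_preserving_piFinSuccAbove (fun _ : Fin (n + 1) => ℝ) i).symm _
  have heπ : e ⁻¹' cube (n + 1) = Icc 0 (2 * Real.pi) ×ˢ cube n :=
    ((Fin.insertNthOrderIso (fun _ => ℝ) i).preimage_Icc _ _).trans (Icc_prod_eq _ _)
  have hins : Continuous fun p : (Fin n → ℝ) × ℝ => (i.insertNth p.2 p.1 : Fin (n + 1) → ℝ) := by
    refine continuous_pi fun j => ?_
    refine Fin.succAboveCases i ?_ (fun k => ?_) j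
    · simpa using continuous_snd
    · simp only [Fin.insertNth_apply_succAbove]
      fun_prop
  have he : ∀ p, e p = i.insertNth p.1 p.2 := fun p => rfl
  rw [← hem.map_eq, setIntegral_map_equiv, heπ, Measure.volume_eq_prod,
    ← setIntegral_prod_swap, setIntegral_prod]
  · rfl
  · exact (hG.comp hins).continuousOn.integrableOn_compact
      (isCompact_cube.prod isCompact_Icc)

/-- Cauchy's theorem for f(z)/z on the annulus between the circles of radius q and 1. Nothing is
required of f inside the smaller circle. -/
theorem integral_circle_scale {q : ℝ} (hq : 0 < q) (hq' : q < 1) {f : ℂ → ℂ}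
    (hc : ContinuousOn f (Metric.closedBall 0 1 \ Metric.ball 0 q))
    (hd : ∀ z ∈ Metric.ball 0 1 \ Metric.closedBall 0 q, DifferentiableAt ℂ f z) :
    ∫ x in Icc 0 (2 * Real.pi), f (Complex.exp (x * Complex.I)) =
      ∫ x in Icc 0 (2 * Real.pi), f (q * Complex.exp (x * Complex.I)) := by
  have h := Complex.circleIntegral_sub_center_inv_smul_eq_of_differentiable_on_annulus_off_countable
    hq hq'.le countable_empty hc (fun z hz => hd z hz.1)
  have h1 : ∀ r : ℝ, r ≠ 0 → (∮ z in C(0, r), (z - 0)⁻¹ • f z) =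
      Complex.I * ∫ x in Icc 0 (2 * Real.pi), f (r * Complex.exp (x * Complex.I)) := by
    intro r hr
    rw [circleIntegral_def_Icc, ← integral_const_mul]
    refine setIntegral_congr_fun measurableSet_Icc fun x _ => ?_
    have h2 : circleMap 0 r x ≠ 0 := circleMap_ne_center hr
    simp only [deriv_circleMap, sub_zero, smul_eq_mul]
    rw [mul_comm _ Complex.I, mul_assoc, mul_inv_cancel_left₀ h2, circleMap_zero]
  rw [h1 1 one_ne_zero, h1 q hq.ne'] at h
  have h2 := mul_left_cancel₀ Complex.I_ne_zero h
  simpa using h2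

/-- Contour deformation in one of the variables. -/
theorem torusMean_scale {q : ℝ} (hq : 0 < q) (hq' : q < 1) (i : Fin m) {F : (Fin m → ℂ) → ℂ}
    (h1 : Continuous fun θ => F (tor θ))
    (h2 : Continuous fun θ => F (Function.update (tor θ) i (q * tor θ i)))
    (hc : ∀ y : Fin m → ℂ, (∀ j, ‖y j‖ = 1) → ContinuousOn (fun z => F (Function.update y i z))
      (Metric.closedBall 0 1 \ Metric.ball 0 q))
    (hd : ∀ y : Fin m → ℂ, (∀ j, ‖y j‖ = 1) → ∀ z ∈ Metric.ball 0 1 \ Metric.closedBall 0 q,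
      DifferentiableAt ℂ (fun z => F (Function.update y i z)) z) :
    torusMean F = torusMean fun y => F (Function.update y i (q * y i)) := by
  obtain _ | n := m
  · exact i.elim0
  rw [torusMean_eq, torusMean_eq, integral_cube_succ i h1, integral_cube_succ i h2]
  congr 2
  ext y
  have h3 : ∀ (x : ℝ) (z : ℂ), Function.update (tor (i.insertNth x y : Fin (n + 1) → ℝ)) i z =
      Function.update (tor (i.insertNth 0 y : Fin (n + 1) → ℝ)) i z := by
    intro x z
    ext j
    refine Fin.succAboveCases i ?_ (fun k => ?_) j
    · rw [Function.update_self, Function.update_self]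
    · rw [Function.update_of_ne (Fin.succAbove_ne i k), Function.update_of_ne
        (Fin.succAbove_ne i k)]
      simp [tor]
  have h4 : ∀ x : ℝ, tor (i.insertNth x y : Fin (n + 1) → ℝ) i = Complex.exp (x * Complex.I) := by
    intro x
    simp [tor]
  have h5 : ∀ x : ℝ, tor (i.insertNth x y : Fin (n + 1) → ℝ) =
      Function.update (tor (i.insertNth 0 y : Fin (n + 1) → ℝ)) i
        (Complex.exp (x * Complex.I)) := by
    intro x
    rw [← h4, ← h3 x, Function.update_eq_self]
  have h6 := integral_circle_scale hq hq' (hc _ (norm_tor (i.insertNth 0 y)))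
    (hd _ (norm_tor (i.insertNth 0 y)))
  convert h6 using 3 with x x
  · rw [h5]
  · rw [h3, h4]

end Torus

end MacSym
end

/-! ### The weight on the torus as Vandermonde factors times theta-like quotients. -/

noncomputable section

namespace MacSym

open MvPolynomial Filter Topology

/-! ### The weight function on the torus -/

section Weight

variable {q t : ℝ}

/-- The factor `(qu;q)_∞ (q/u;q)_∞ / ((tu;q)_∞ (t/u;q)_∞)`. -/
def pairD (q t : ℝ) (u : ℂ) : ℂ :=
  qPoch (q * u) q * qPoch (q * u⁻¹) q / (qPoch (t * u) q * qPoch (t * u⁻¹) q)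

/-- The quotient of theta functions `(u;q)_∞ (q/u;q)_∞ / ((tu;q)_∞ (tq/u;q)_∞)`. -/
def thetaQuot (q t : ℝ) (u : ℂ) : ℂ :=
  qPoch u q * qPoch (q * u⁻¹) q / (qPoch (t * u) q * qPoch (q * (t * u⁻¹)) q)

theorem pairD_inv (u : ℂ) : pairD q t u⁻¹ = pairD q t u := by
  rw [pairD, pairD, inv_inv, mul_comm (qPoch (q * u⁻¹) q), mul_comm (qPoch (t * u⁻¹) q)]

/-- Both sides have the same factors, swapped within numerator and denominator. This turns a q-shift
of the contour into an inversion of the variable. -/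
theorem thetaQuot_mul (hq : q ≠ 0) (u : ℂ) : thetaQuot q t (q * u) = thetaQuot q t u⁻¹ := by
  have hq' : (q : ℂ) ≠ 0 := Complex.ofReal_ne_zero.2 hq
  have h1 : (q : ℂ) * (q * u)⁻¹ = u⁻¹ := by
    rw [mul_inv, mul_inv_cancel_left₀ hq']
  have h2 : (q : ℂ) * (t * (q * u)⁻¹) = t * u⁻¹ := by rw [mul_left_comm, h1]
  rw [thetaQuot, thetaQuot, h1, h2, inv_inv, mul_comm (qPoch (q * u) q),
    mul_comm (qPoch (t * (q * u)) q), mul_left_comm (t : ℂ)]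

theorem norm_ofReal_lt_one (hq : 0 < q) (hq' : q < 1) : ‖(q : ℂ)‖ < 1 := by
  rwa [Complex.norm_real, Real.norm_of_nonneg hq.le]

theorem norm_ofReal_mul_lt_one (ht : 0 < t) (ht' : t < 1) {u : ℂ} (hu : ‖u‖ = 1) :
    ‖(t : ℂ) * u‖ < 1 := by
  rw [norm_mul, hu, mul_one]
  exact norm_ofReal_lt_one ht ht'

theorem one_sub_mul_pairD (hq : 0 < q) (hq' : q < 1) (ht : 0 < t) (ht' : t < 1) {u : ℂ}
    (hu : ‖u‖ = 1) : (1 - u) * (1 - t * u⁻¹) * pairD q t u = thetaQuot q t u := by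
  have hqn := norm_ofReal_lt_one hq hq'
  have hu' : ‖u⁻¹‖ = 1 := by rw [norm_inv, hu, inv_one]
  have h1 : qPoch (t * u⁻¹) q ≠ 0 := qPoch_ne_zero hqn (norm_ofReal_mul_lt_one ht ht' hu')
  have h2 := qPoch_eq_mul hqn (t * u⁻¹)
  have h3 : qPoch (q * (t * u⁻¹)) q ≠ 0 := fun h0 => h1 (by rw [h2, h0, mul_zero])
  have h4 : 1 - t * u⁻¹ ≠ 0 := fun h0 => h1 (by rw [h2, h0, zero_mul])
  have h5 : qPoch (t * u) q ≠ 0 := qPoch_ne_zero hqn (norm_ofReal_mul_lt_one ht ht' hu)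
  rw [pairD, thetaQuot, h2, qPoch_eq_mul hqn u]
  generalize qPoch (t * u) q = a at *
  generalize qPoch (q * (t * u⁻¹)) q = b at *
  generalize 1 - t * u⁻¹ = c at *
  field_simp

/-- The weight function without its zeros on the torus. -/
def weight0 (q t : ℝ) {m : ℕ} (y : Fin m → ℂ) : ℂ :=
  ∏ k, ∏ l ∈ Finset.Ioi k, pairD q t (y k / y l)

theorem weight0_inv {m : ℕ} (y : Fin m → ℂ) : weight0 q t y⁻¹ = weight0 q t y := by
  refine Finset.prod_congr rfl fun k _ => Finset.prod_congr rfl fun l _ => ?_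
  rw [Pi.inv_apply, Pi.inv_apply, inv_div_inv, ← inv_div, pairD_inv]

theorem kerDelta_eq_prod {m : ℕ} (y : Fin m → ℂ) :
    kerDelta q t y = ∏ k, ∏ l ∈ Finset.Ioi k, qPoch (y l / y k) q / qPoch (t * (y l / y k)) q *
      (qPoch (y k / y l) q / qPoch (t * (y k / y l)) q) := by
  have h := Finset.prod_prod_Ioi_mul_eq_prod_prod_off_diag fun a b : Fin m =>
    qPoch (y b / y a) q / qPoch (t * (y b / y a)) q
  rw [kerDelta]
  simp only [← Finset.compl_singleton] at h ⊢
  rw [← h]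
  refine Finset.prod_congr rfl fun k _ => Finset.prod_congr rfl fun l _ => ?_
  ring

theorem kerDelta_eq (hq : 0 < q) (hq' : q < 1) {m : ℕ} {y : Fin m → ℂ} (hy : ∀ j, y j ≠ 0) :
    kerDelta q t y = pairProd 1 y⁻¹ * pairProd 1 y * weight0 q t y := by
  have hqn := norm_ofReal_lt_one hq hq'
  rw [kerDelta_eq_prod, pairProd, pairProd, weight0, ← Finset.prod_mul_distrib,
    ← Finset.prod_mul_distrib]
  refine Finset.prod_congr rfl fun k _ => ?_
  rw [← Finset.prod_mul_distrib, ← Finset.prod_mul_distrib]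
  refine Finset.prod_congr rfl fun l _ => ?_
  have hk := hy k
  have hl := hy l
  have h1 : y l / y k = (y k / y l)⁻¹ := (inv_div _ _).symm
  have h2 : (1 * (y k)⁻¹ - 1 * (y l)⁻¹) * (1 * y k - 1 * y l) =
      (1 - y k / y l) * (1 - (y k / y l)⁻¹) := by
    field_simp
  simp only [Pi.one_apply, Pi.inv_apply]
  rw [h2, h1, pairD, qPoch_eq_mul hqn (y k / y l), qPoch_eq_mul hqn (y k / y l)⁻¹]
  simp only [div_eq_mul_inv, mul_inv]
  ring

/-- A factor of the weight that goes with the shift of the variable `y_i`. -/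
def shiftFactor (q t : ℝ) {m : ℕ} (i k l : Fin m) (y : Fin m → ℂ) : ℂ :=
  if k = i then thetaQuot q t (y i / y l) else if l = i then thetaQuot q t (y i / y k)
  else ((y k)⁻¹ - (y l)⁻¹) * (y k - y l) * pairD q t (y k / y l)

/-- The weight that goes with the shift of the variable `y_i`. -/
def shiftWeight (q t : ℝ) {m : ℕ} (i : Fin m) (y : Fin m → ℂ) : ℂ :=
  ∏ k, ∏ l ∈ Finset.Ioi k, shiftFactor q t i k l y

/-- For a pair containing i, with u the quotient of y_i by the other variable, the linear factors
combine to (1 - u)(1 - t/u), exactly what completes `pairD` to `thetaQuot`. -/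
theorem shiftWeight_eq (hq : 0 < q) (hq' : q < 1) (ht : 0 < t) (ht' : t < 1) {m : ℕ} (i : Fin m)
    {y : Fin m → ℂ} (hy : ∀ j, ‖y j‖ = 1) :
    pairProd 1 y⁻¹ * pairProd (Function.update 1 i (t : ℂ)) y * weight0 q t y =
      shiftWeight q t i y := by
  have hy0 : ∀ j, y j ≠ 0 := fun j => norm_ne_zero_iff.1 (by rw [hy j]; exact one_ne_zero)
  have hu : ∀ j k, ‖y j / y k‖ = 1 := fun j k => by rw [norm_div, hy, hy, div_one]
  rw [pairProd, pairProd, weight0, shiftWeight, ← Finset.prod_mul_distrib,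
    ← Finset.prod_mul_distrib]
  refine Finset.prod_congr rfl fun k _ => ?_
  rw [← Finset.prod_mul_distrib, ← Finset.prod_mul_distrib]
  refine Finset.prod_congr rfl fun l hl => ?_
  have hkl : k ≠ l := (Finset.mem_Ioi.1 hl).ne
  have hk := hy0 k
  have hl := hy0 l
  simp only [Pi.one_apply, Pi.inv_apply, one_mul]
  rw [shiftFactor]
  split_ifs with h1 h2
  · subst h1
    rw [Function.update_self, Function.update_of_ne hkl.symm, Pi.one_apply,
      ← one_sub_mul_pairD hq hq' ht ht' (hu k l), inv_div]
    congr 1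
    field_simp
  · subst h2
    rw [Function.update_self, Function.update_of_ne hkl, Pi.one_apply,
      ← one_sub_mul_pairD hq hq' ht ht' (hu l k), inv_div, ← pairD_inv (y k / y l), inv_div]
    congr 1
    field_simp
    ring
  · rw [Function.update_of_ne h1, Function.update_of_ne h2, Pi.one_apply, Pi.one_apply, one_mul,
      one_mul]

/-- The shift inverts the argument of each theta quotient, and the pairs without i are invariant
under inversion. So shifting one variable by q has the effect of inverting all of them. -/
theorem shiftWeight_update (hq : q ≠ 0) {m : ℕ} (i : Fin m) (y : Fin m → ℂ) :
    shiftWeight q t i (Function.update y i (q * y i)) = shiftWeight q t i y⁻¹ := by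
  refine Finset.prod_congr rfl fun k _ => Finset.prod_congr rfl fun l hl => ?_
  have hkl : k ≠ l := (Finset.mem_Ioi.1 hl).ne
  rw [shiftFactor, shiftFactor]
  split_ifs with h1 h2
  · subst h1
    rw [Function.update_self, Function.update_of_ne hkl.symm, mul_div_assoc, thetaQuot_mul hq,
      Pi.inv_apply, Pi.inv_apply, inv_div_inv, inv_div]
  · subst h2
    rw [Function.update_self, Function.update_of_ne hkl, mul_div_assoc, thetaQuot_mul hq,
      Pi.inv_apply, Pi.inv_apply, inv_div_inv, inv_div]
  · rw [Function.update_of_ne h1, Function.update_of_ne h2, Pi.inv_apply, Pi.inv_apply, inv_inv,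
      inv_inv, inv_div_inv, ← pairD_inv (y k / y l), inv_div]
    ring

theorem differentiableAt_thetaQuot (hq : 0 < q) (hq' : q < 1) {u : ℂ}
    (h1 : ‖(t : ℂ) * u‖ < 1) (h2 : ‖(q : ℂ) * (t * u⁻¹)‖ < 1) (hu : u ≠ 0) :
    DifferentiableAt ℂ (thetaQuot q t) u := by
  have hqn := norm_ofReal_lt_one hq hq'
  have hd := differentiable_qPoch hqn
  have hinv : DifferentiableAt ℂ (fun u : ℂ => u⁻¹) u := differentiableAt_inv hu
  unfold thetaQuot
  refine DifferentiableAt.div ?_ ?_ (mul_ne_zero (qPoch_ne_zero hqn h1) (qPoch_ne_zero hqn h2))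
  · exact (hd u).mul ((hd _).comp u (f := fun u : ℂ => (q : ℂ) * u⁻¹) (hinv.const_mul _))
  · exact ((hd _).comp u (f := fun u : ℂ => (t : ℂ) * u) (differentiableAt_id.const_mul _)).mul
      ((hd _).comp u (f := fun u : ℂ => (q : ℂ) * (t * u⁻¹)) ((hinv.const_mul _).const_mul _))

/-- For q ≤ |z| ≤ 1 one has |t z| < 1 and |q t / z| ≤ t < 1, so no denominator vanishes on the
closed annulus and the contour crosses no pole. -/
theorem differentiableAt_shiftWeight (hq : 0 < q) (hq' : q < 1) (ht : 0 < t) (ht' : t < 1) {m : ℕ}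
    (i : Fin m) {y : Fin m → ℂ} (hy : ∀ j, ‖y j‖ = 1) {z : ℂ} (hz : q ≤ ‖z‖) (hz' : ‖z‖ ≤ 1) :
    DifferentiableAt ℂ (fun z => shiftWeight q t i (Function.update y i z)) z := by
  have hz0 : 0 < ‖z‖ := hq.trans_le hz
  have hy0 : ∀ j, y j ≠ 0 := fun j => norm_ne_zero_iff.1 (by rw [hy j]; exact one_ne_zero)
  have hth : ∀ l, DifferentiableAt ℂ (fun z => thetaQuot q t (z / y l)) z := by
    intro l
    have h1 : ‖z / y l‖ = ‖z‖ := by rw [norm_div, hy, div_one]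
    refine (differentiableAt_thetaQuot hq hq' ?_ ?_
      (div_ne_zero (norm_pos_iff.1 hz0) (hy0 l))).comp z (f := fun z => z / y l)
      (differentiableAt_id.div_const _)
    · rw [norm_mul, h1, Complex.norm_real, Real.norm_of_nonneg ht.le]
      nlinarith
    · rw [norm_mul, norm_mul, norm_inv, h1, Complex.norm_real, Complex.norm_real,
        Real.norm_of_nonneg ht.le, Real.norm_of_nonneg hq.le]
      have h2 : q * ‖z‖⁻¹ ≤ 1 := by
        rw [← div_eq_mul_inv]
        exact (div_le_one hz0).2 hz
      nlinarith
  unfold shiftWeight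
  refine DifferentiableAt.fun_finsetProd fun k _ => DifferentiableAt.fun_finsetProd fun l hl => ?_
  have hkl : k ≠ l := (Finset.mem_Ioi.1 hl).ne
  unfold shiftFactor
  split_ifs with h1 h2
  · subst h1
    simpa only [Function.update_self, Function.update_of_ne hkl.symm] using hth l
  · subst h2
    simpa only [Function.update_self, Function.update_of_ne hkl] using hth k
  · simp only [Function.update_of_ne h1, Function.update_of_ne h2]
    exact differentiableAt_const _

theorem continuous_qPoch_tor_div (hq : 0 < q) (hq' : q < 1) {m : ℕ} (c : ℂ) (k l : Fin m) :
    Continuous fun θ : Fin m → ℝ => qPoch (c * (tor θ k / tor θ l)) q := by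
  refine (continuous_qPoch (norm_ofReal_lt_one hq hq')).comp (continuous_const.mul ?_)
  exact ((continuous_apply k).comp continuous_tor).div ((continuous_apply l).comp continuous_tor)
    fun θ => Complex.exp_ne_zero _

theorem norm_tor_div {m : ℕ} (θ : Fin m → ℝ) (k l : Fin m) : ‖tor θ k / tor θ l‖ = 1 := by
  rw [norm_div, norm_tor, norm_tor, div_one]

theorem continuous_pairD_tor (hq : 0 < q) (hq' : q < 1) (ht : 0 < t) (ht' : t < 1) {m : ℕ}
    (k l : Fin m) : Continuous fun θ : Fin m → ℝ => pairD q t (tor θ k / tor θ l) := by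
  have hqn := norm_ofReal_lt_one hq hq'
  unfold pairD
  simp only [inv_div]
  exact ((continuous_qPoch_tor_div hq hq' _ _ _).mul (continuous_qPoch_tor_div hq hq' _ _ _)).div
    ((continuous_qPoch_tor_div hq hq' _ _ _).mul (continuous_qPoch_tor_div hq hq' _ _ _))
    fun θ => mul_ne_zero
      (qPoch_ne_zero hqn (norm_ofReal_mul_lt_one ht ht' (norm_tor_div θ _ _)))
      (qPoch_ne_zero hqn (norm_ofReal_mul_lt_one ht ht' (norm_tor_div θ _ _)))

theorem tor_inv {m : ℕ} (θ : Fin m → ℝ) : (tor θ)⁻¹ = tor (-θ) := by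
  ext j
  rw [Pi.inv_apply, tor, tor, ← Complex.exp_neg]
  simp

theorem continuous_pairProd_tor {m : ℕ} (s : Fin m → ℂ) :
    Continuous fun θ : Fin m → ℝ => pairProd s (tor θ) := by
  have h : ∀ k : Fin m, Continuous fun θ : Fin m → ℝ => tor θ k := fun k =>
    (continuous_apply k).comp continuous_tor
  unfold pairProd
  exact continuous_finsetProd _ fun k _ => continuous_finsetProd _ fun l _ =>
    (continuous_const.mul (h k)).sub (continuous_const.mul (h l))

theorem continuous_tor_inv {m : ℕ} {f : (Fin m → ℂ) → ℂ} (hf : Continuous fun θ => f (tor θ)) :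
    Continuous fun θ => f (tor θ)⁻¹ := by
  simp only [tor_inv]
  exact hf.comp continuous_neg

theorem continuous_weight0_tor (hq : 0 < q) (hq' : q < 1) (ht : 0 < t) (ht' : t < 1) {m : ℕ} :
    Continuous fun θ : Fin m → ℝ => weight0 q t (tor θ) :=
  continuous_finsetProd _ fun k _ => continuous_finsetProd _ fun l _ =>
    continuous_pairD_tor hq hq' ht ht' k l

theorem continuous_kerDelta_tor (hq : 0 < q) (hq' : q < 1) (ht : 0 < t) (ht' : t < 1) {m : ℕ} :
    Continuous fun θ : Fin m → ℝ => kerDelta q t (tor θ) := by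
  have h : ∀ θ : Fin m → ℝ, kerDelta q t (tor θ) =
      pairProd 1 (tor θ)⁻¹ * pairProd 1 (tor θ) * weight0 q t (tor θ) := fun θ =>
    kerDelta_eq hq hq' fun j => Complex.exp_ne_zero _
  simp only [h]
  exact ((continuous_tor_inv (continuous_pairProd_tor _)).mul (continuous_pairProd_tor _)).mul
    (continuous_weight0_tor hq hq' ht ht')

theorem continuous_shiftWeight_tor (hq : 0 < q) (hq' : q < 1) (ht : 0 < t) (ht' : t < 1) {m : ℕ}
    (i : Fin m) : Continuous fun θ : Fin m → ℝ => shiftWeight q t i (tor θ) := by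
  simp only [← shiftWeight_eq hq hq' ht ht' i (norm_tor _)]
  exact ((continuous_tor_inv (continuous_pairProd_tor _)).mul (continuous_pairProd_tor _)).mul
    (continuous_weight0_tor hq hq' ht ht')

end Weight

/-! ### Values of symmetric functions -/

section Values

/-- The value at `y` of the symmetric polynomial given by a polynomial in the power sums. -/
def pev {m : ℕ} (F : MvPolynomial ℕ ℂ) (y : Fin m → ℂ) : ℂ := eval y (ev ℂ m F)

theorem continuous_pev {m : ℕ} (F : MvPolynomial ℕ ℂ) :
    Continuous fun y : Fin m → ℂ => pev F y := continuous_eval _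

theorem continuous_pev_tor {m : ℕ} (F : MvPolynomial ℕ ℂ) :
    Continuous fun θ : Fin m → ℝ => pev F (tor θ) := (continuous_pev F).comp continuous_tor

theorem differentiableAt_eval {ι : Type*} (p : MvPolynomial ι ℂ) {g : ℂ → ι → ℂ} {z : ℂ}
    (hg : ∀ j, DifferentiableAt ℂ (fun z => g z j) z) :
    DifferentiableAt ℂ (fun z => eval (g z) p) z := by
  induction p using MvPolynomial.induction_on with
  | C a => simpa only [eval_C] using differentiableAt_const a
  | add p r hp hr => simpa only [map_add] using hp.fun_add hr
  | mul_X p j hp => simpa only [map_mul, eval_X] using hp.fun_mul (hg j)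

theorem pairProd_mul_pev_macOp (ρ t : ℂ) {m : ℕ} (F : MvPolynomial ℕ ℂ) (y : Fin m → ℂ) :
    pairProd 1 y * pev (macOp ρ t F) y = t ^ m * (pairProd 1 y * pev F y) +
      ∑ i, (1 - t) * pairProd (Function.update 1 i t) y *
        pev F (Function.update y i (ρ * y i)) := by
  have h := congrArg (eval y) (vand_mul_ev_macOp (n := m) ρ t F)
  have h1 : ∀ s : Fin m → MvPolynomial (Fin m) ℂ, eval y (pairProd s X) =
      pairProd (fun j => eval y (s j)) y := by
    intro s
    rw [map_pairProd]
    congr 1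
    ext j
    simp
  have h2 : ∀ (i : Fin m) (p : MvPolynomial (Fin m) ℂ), eval y (scaleVar ρ i p) =
      eval (Function.update y i (ρ * y i)) p := by
    intro i p
    induction p using MvPolynomial.induction_on with
    | C a => rw [← algebraMap_eq, AlgHom.commutes, algebraMap_eq, eval_C, eval_C]
    | add p r hp hr => rw [map_add, map_add, map_add, hp, hr]
    | mul_X p j hp =>
      rw [map_mul, map_mul, map_mul, hp, scaleVar, aeval_X, eval_X]
      rcases eq_or_ne j i with rfl | hj
      · simp
      · rw [Function.update_of_ne hj, Function.update_of_ne hj, eval_X]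
  have h3 : (fun _ : Fin m => (1 : ℂ)) = 1 := rfl
  have h4 : ∀ i : Fin m, (fun j => eval y (Function.update (1 : Fin m → MvPolynomial (Fin m) ℂ) i
      (C t) j)) = Function.update (1 : Fin m → ℂ) i t := by
    intro i
    ext j
    rcases eq_or_ne j i with rfl | hj
    · simp
    · rw [Function.update_of_ne hj, Function.update_of_ne hj, Pi.one_apply, map_one, Pi.one_apply]
  simp only [map_add, map_mul, map_sum, map_pow, map_sub, map_one, eval_C, vand, macCoeff, h1,
    h2, h4, Pi.one_apply, h3] at h
  exact h

end Values

end MacSym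
end

/-! ### Self-adjointness of the operator on the torus. -/

noncomputable section

namespace MacSym

open MvPolynomial Filter Topology

/-! ### The torus scalar product -/

section TorusForm

variable {q t : ℝ} {m : ℕ}

/-- The torus scalar product, without its normalization and for complex coefficients. -/
def tform (q t : ℝ) (m : ℕ) (F G : MvPolynomial ℕ ℂ) : ℂ :=
  torusMean fun y : Fin m → ℂ => pev F y⁻¹ * pev G y * kerDelta q t y

/-- The contribution to `⟨F, E G⟩` of the shift of the variable `y_i`. -/
def shiftIntegrand (q t : ℝ) (i : Fin m) (F G : MvPolynomial ℕ ℂ) (y : Fin m → ℂ) : ℂ :=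
  pev F y⁻¹ * pev G (Function.update y i ((q : ℂ)⁻¹ * y i)) * shiftWeight q t i y

theorem update_inv_mul (i : Fin m) (y : Fin m → ℂ) :
    (Function.update y i (q * y i))⁻¹ = Function.update y⁻¹ i ((q : ℂ)⁻¹ * y⁻¹ i) := by
  ext j
  rcases eq_or_ne j i with rfl | hj
  · simp [mul_comm]
  · simp [Function.update_of_ne hj]

/-- Replacing y_i by q y_i undoes the rescaling in G and creates the rescaling by 1/q in F at the
inverse point: F and G exchange roles. -/
theorem shiftIntegrand_update (hq : q ≠ 0) (i : Fin m) (F G : MvPolynomial ℕ ℂ)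
    (y : Fin m → ℂ) : shiftIntegrand q t i F G (Function.update y i (q * y i)) =
      shiftIntegrand q t i G F y⁻¹ := by
  have hq' : (q : ℂ) ≠ 0 := Complex.ofReal_ne_zero.2 hq
  rw [shiftIntegrand, shiftIntegrand, shiftWeight_update hq, update_inv_mul, inv_inv,
    Function.update_self, Function.update_idem, inv_mul_cancel_left₀ hq', Function.update_eq_self,
    mul_comm (pev F _)]

theorem continuous_pev_update_tor (F : MvPolynomial ℕ ℂ) (i : Fin m) (c : ℂ) :
    Continuous fun θ : Fin m → ℝ => pev F (Function.update (tor θ) i (c * tor θ i)) := by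
  refine (continuous_pev F).comp (continuous_pi fun j => ?_)
  have h : ∀ k : Fin m, Continuous fun θ : Fin m → ℝ => tor θ k := fun k =>
    (continuous_apply k).comp continuous_tor
  rcases eq_or_ne j i with rfl | hj
  · simpa only [Function.update_self] using (h j).const_mul c
  · simpa only [Function.update_of_ne hj] using h j

theorem continuous_shiftIntegrand_tor (hq : 0 < q) (hq' : q < 1) (ht : 0 < t) (ht' : t < 1)
    (i : Fin m) (F G : MvPolynomial ℕ ℂ) :
    Continuous fun θ : Fin m → ℝ => shiftIntegrand q t i F G (tor θ) :=
  ((continuous_tor_inv (continuous_pev_tor F)).mul (continuous_pev_update_tor G i _)).mul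
    (continuous_shiftWeight_tor hq hq' ht ht' i)

theorem torusMean_shiftIntegrand (hq : 0 < q) (hq' : q < 1) (ht : 0 < t) (ht' : t < 1)
    (i : Fin m) (F G : MvPolynomial ℕ ℂ) : torusMean (shiftIntegrand q t i F G) =
      torusMean fun y => shiftIntegrand q t i G F y⁻¹ := by
  have hdiff : ∀ y : Fin m → ℂ, (∀ j, ‖y j‖ = 1) → ∀ z : ℂ, q ≤ ‖z‖ → ‖z‖ ≤ 1 →
      DifferentiableAt ℂ (fun z => shiftIntegrand q t i F G (Function.update y i z)) z := by
    intro y hy z hz hz'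
    have hz0 : z ≠ 0 := norm_pos_iff.1 (hq.trans_le hz)
    unfold shiftIntegrand
    refine DifferentiableAt.fun_mul (DifferentiableAt.fun_mul ?_ ?_)
      (differentiableAt_shiftWeight hq hq' ht ht' i hy hz hz')
    · refine differentiableAt_eval _ fun j => ?_
      rcases eq_or_ne j i with rfl | hj
      · simpa only [Pi.inv_apply, Function.update_self] using differentiableAt_inv hz0
      · simpa only [Pi.inv_apply, Function.update_of_ne hj] using differentiableAt_const _
    · refine differentiableAt_eval _ fun j => ?_
      rcases eq_or_ne j i with rfl | hj
      · simpa only [Function.update_self] using differentiableAt_id.const_mul _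
      · simpa only [Function.update_of_ne hj] using differentiableAt_const _
  have h := torusMean_scale hq hq' i (continuous_shiftIntegrand_tor hq hq' ht ht' i F G) (by
      simp only [shiftIntegrand_update hq.ne']
      exact continuous_tor_inv (continuous_shiftIntegrand_tor hq hq' ht ht' i G F))
    (fun y hy z hz => (hdiff y hy z (by simpa using hz.2)
      (by simpa using hz.1)).continuousAt.continuousWithinAt)
    (fun y hy z hz => hdiff y hy z (le_of_lt (by simpa using hz.2))
      (le_of_lt (by simpa using hz.1)))
  rw [h]
  simp only [shiftIntegrand_update hq.ne']

theorem pev_macOp_right (hq : 0 < q) (hq' : q < 1) (ht : 0 < t) (ht' : t < 1)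
    (F G : MvPolynomial ℕ ℂ) {y : Fin m → ℂ} (hy : ∀ j, ‖y j‖ = 1) :
    pev F y⁻¹ * pev (macOp (q : ℂ)⁻¹ t G) y * kerDelta q t y =
      (t : ℂ) ^ m * (pev F y⁻¹ * pev G y * kerDelta q t y) +
        (1 - t) * ∑ i, shiftIntegrand q t i F G y := by
  have hy0 : ∀ j, y j ≠ 0 := fun j => norm_ne_zero_iff.1 (by rw [hy j]; exact one_ne_zero)
  have h := pairProd_mul_pev_macOp (q : ℂ)⁻¹ t G y
  have h1 : ∀ i : Fin m, shiftIntegrand q t i F G y = pev F y⁻¹ *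
      pev G (Function.update y i ((q : ℂ)⁻¹ * y i)) *
        (pairProd 1 y⁻¹ * pairProd (Function.update 1 i (t : ℂ)) y * weight0 q t y) := fun i => by
    rw [shiftWeight_eq hq hq' ht ht' i hy]
    rfl
  have h2 : ∑ i, (1 - (t : ℂ)) * pairProd (Function.update 1 i (t : ℂ)) y *
      pev G (Function.update y i ((q : ℂ)⁻¹ * y i)) * (pev F y⁻¹ * pairProd 1 y⁻¹ * weight0 q t y) =
      (1 - t) * ∑ i, shiftIntegrand q t i F G y := by
    rw [Finset.mul_sum]
    refine Finset.sum_congr rfl fun i _ => ?_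
    rw [h1]
    ring
  rw [← Finset.sum_mul] at h2
  rw [kerDelta_eq hq hq' hy0, ← h2]
  linear_combination (pev F y⁻¹ * pairProd 1 y⁻¹ * weight0 q t y) * h

theorem kerDelta_inv (hq : 0 < q) (hq' : q < 1) {y : Fin m → ℂ} (hy : ∀ j, y j ≠ 0) :
    kerDelta q t y⁻¹ = kerDelta q t y := by
  rw [kerDelta_eq hq hq' hy, kerDelta_eq (y := y⁻¹) hq hq' (fun j => inv_ne_zero (hy j)), inv_inv, weight0_inv,
    mul_comm (pairProd 1 y)]

theorem continuous_tform_tor (hq : 0 < q) (hq' : q < 1) (ht : 0 < t) (ht' : t < 1)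
    (F G : MvPolynomial ℕ ℂ) : Continuous fun θ : Fin m → ℝ =>
      pev F (tor θ)⁻¹ * pev G (tor θ) * kerDelta q t (tor θ) :=
  ((continuous_tor_inv (continuous_pev_tor F)).mul (continuous_pev_tor G)).mul
    (continuous_kerDelta_tor hq hq' ht ht')

/-- The Macdonald operator is self-adjoint for the torus scalar product. -/
theorem tform_macOp (hq : 0 < q) (hq' : q < 1) (ht : 0 < t) (ht' : t < 1)
    (F G : MvPolynomial ℕ ℂ) :
    tform q t m (macOp (q : ℂ)⁻¹ t F) G = tform q t m F (macOp (q : ℂ)⁻¹ t G) := by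
  have hS := fun i : Fin m => continuous_shiftIntegrand_tor hq hq' ht ht' i
  have hright : tform q t m F (macOp (q : ℂ)⁻¹ t G) = (t : ℂ) ^ m * tform q t m F G +
      (1 - t) * ∑ i : Fin m, torusMean (shiftIntegrand q t i F G) := by
    rw [tform, torusMean_congr fun y hy => pev_macOp_right hq hq' ht ht' F G hy, torusMean_add,
      torusMean_const_mul, torusMean_const_mul, torusMean_sum]
    · rfl
    · exact fun i _ => hS i F G
    · exact continuous_const.mul (continuous_tform_tor hq hq' ht ht' F G)
    · exact continuous_const.mul (continuous_finsetSum _ fun i _ => hS i F G)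
  -- The pointwise identity for the pair (G, F) is applied at y⁻¹, where Δ takes the same value. The
  -- resulting integrals are those produced by the contour shift.
  have hleft : tform q t m (macOp (q : ℂ)⁻¹ t F) G = (t : ℂ) ^ m * tform q t m F G +
      (1 - t) * ∑ i : Fin m, torusMean fun y => shiftIntegrand q t i G F y⁻¹ := by
    have h : ∀ y : Fin m → ℂ, (∀ j, ‖y j‖ = 1) →
        pev (macOp (q : ℂ)⁻¹ t F) y⁻¹ * pev G y * kerDelta q t y =
        (t : ℂ) ^ m * (pev F y⁻¹ * pev G y * kerDelta q t y) +
          (1 - t) * ∑ i, shiftIntegrand q t i G F y⁻¹ := by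
      intro y hy
      have hy0 : ∀ j, y j ≠ 0 := fun j => norm_ne_zero_iff.1 (by rw [hy j]; exact one_ne_zero)
      have h1 := pev_macOp_right hq hq' ht ht' G F (y := y⁻¹) (fun j => by
        rw [Pi.inv_apply, norm_inv, hy, inv_one])
      rw [inv_inv, kerDelta_inv hq hq' hy0] at h1
      linear_combination h1
    rw [tform, torusMean_congr h, torusMean_add, torusMean_const_mul, torusMean_const_mul,
      torusMean_sum]
    · rfl
    · exact fun i _ => continuous_tor_inv (hS i G F)
    · exact continuous_const.mul (continuous_tform_tor hq hq' ht ht' F G)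
    · exact continuous_const.mul (continuous_finsetSum _ fun i _ => continuous_tor_inv (hS i G F))
  rw [hleft, hright]
  simp only [torusMean_shiftIntegrand hq hq' ht ht' _ F G]

theorem pev_smul (c : ℂ) (F : MvPolynomial ℕ ℂ) (y : Fin m → ℂ) : pev (c • F) y = c * pev F y := by
  rw [pev, map_smul, smul_eval, pev]

theorem tform_smul_left (c : ℂ) (F G : MvPolynomial ℕ ℂ) :
    tform q t m (c • F) G = c * tform q t m F G := by
  rw [tform, tform, ← torusMean_const_mul]
  congr 1
  ext y
  rw [pev_smul]
  ring

theorem tform_smul_right (c : ℂ) (F G : MvPolynomial ℕ ℂ) :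
    tform q t m F (c • G) = c * tform q t m F G := by
  rw [tform, tform, ← torusMean_const_mul]
  congr 1
  ext y
  rw [pev_smul]
  ring

theorem tform_eq_zero_of_eigenvalue_ne (hq : 0 < q) (hq' : q < 1) (ht : 0 < t) (ht' : t < 1)
    {F G : MvPolynomial ℕ ℂ} {a b : ℂ} (hF : macOp (q : ℂ)⁻¹ t F = a • F)
    (hG : macOp (q : ℂ)⁻¹ t G = b • G) (h : a ≠ b) : tform q t m F G = 0 := by
  have h1 := tform_macOp (m := m) hq hq' ht ht' F G
  rw [hF, hG, tform_smul_left, tform_smul_right, ← sub_eq_zero, ← sub_mul] at h1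
  exact (mul_eq_zero.1 h1).resolve_left (sub_ne_zero.2 h)

/-- Complexification. -/
def toC : MvPolynomial ℕ ℝ →+* MvPolynomial ℕ ℂ := map Complex.ofRealHom

theorem toC_smul (c : ℝ) (F : MvPolynomial ℕ ℝ) : toC (c • F) = (c : ℂ) • toC F := by
  rw [smul_eq_C_mul, map_mul, smul_eq_C_mul, toC, map_C]
  rfl

theorem pev_toC (F : MvPolynomial ℕ ℝ) (y : Fin m → ℂ) : pev (toC F) y = aeval y (ev ℝ m F) := by
  rw [pev, toC, map_ev, eval_map, aeval_def]
  rfl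

theorem evalC_inVars (F : MvPolynomial ℕ ℝ) (y : Fin m → ℂ) :
    evalC (inVars (toSymFun ℝ F) m) y = pev (toC F) y := by
  rw [pev_toC, ← toSymFun_apply]
  rfl

theorem formTorus_inVars (F G : MvPolynomial ℕ ℝ) :
    formTorus q t (inVars (toSymFun ℝ F) m) (inVars (toSymFun ℝ G) m) =
      ((m.factorial : ℂ))⁻¹ * tform q t m (toC F) (toC G) := by
  rw [formTorus, tform]
  simp only [evalC_inVars]
  rfl

end TorusForm

end MacSym
end

/-! ### Orthogonality and definiteness of the torus scalar product. -/

noncomputable section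

namespace MacSym

open MvPolynomial Filter Topology

/-! ### Orthogonality and positivity for the torus scalar product -/

section TorusOrthogonal

variable {q t : ℝ} {m : ℕ}

theorem continuous_eval_map (P : MvPolynomial (Fin m) (Polynomial ℝ)) {T : Type*}
    [TopologicalSpace T] {a : T → ℝ} {y : T → Fin m → ℂ} (ha : Continuous a) (hy : Continuous y) :
    Continuous fun p => aeval (y p) (map (Polynomial.evalRingHom (a p)) P) := by
  induction P using MvPolynomial.induction_on with
  | C b =>
    simp only [map_C, aeval_C, Polynomial.coe_evalRingHom, Complex.coe_algebraMap]
    exact Complex.continuous_ofReal.comp (b.continuous.comp ha)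
  | add P Q hP hQ => simpa only [map_add] using hP.fun_add hQ
  | mul_X P j hP =>
    simp only [map_mul, map_X, aeval_X]
    exact hP.mul ((continuous_apply j).comp hy)

theorem pev_toC_eigFun (ρ τ : ℝ) (l : Ptn) (y : Fin m → ℂ) : pev (toC (eigFun ρ τ l)) y =
    aeval y (map (Polynomial.evalRingHom τ) (ev (Polynomial ℝ) m (genFun ρ l))) := by
  rw [pev_toC, ← map_genFun, map_ev]

theorem continuous_kerDelta (hq : 0 < q) (hq' : q < 1) :
    Continuous fun p : Set.Ioo (0 : ℝ) 1 × (Fin m → ℝ) => kerDelta q p.1 (tor p.2) := by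
  have hqn := norm_ofReal_lt_one hq hq'
  have h : ∀ k l : Fin m, Continuous fun p : Set.Ioo (0 : ℝ) 1 × (Fin m → ℝ) =>
      tor p.2 k / tor p.2 l := fun k l =>
    (((continuous_apply k).comp continuous_tor).comp continuous_snd).div
      (((continuous_apply l).comp continuous_tor).comp continuous_snd)
      fun p => Complex.exp_ne_zero _
  have h1 : Continuous fun p : Set.Ioo (0 : ℝ) 1 × (Fin m → ℝ) => ((p.1 : ℝ) : ℂ) :=
    Complex.continuous_ofReal.comp (continuous_subtype_val.comp continuous_fst)
  unfold kerDelta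
  refine continuous_finsetProd _ fun k _ => continuous_finsetProd _ fun l _ => ?_
  refine ((continuous_qPoch hqn).comp (h k l)).div
    ((continuous_qPoch hqn).comp (h1.mul (h k l))) fun p => ?_
  exact qPoch_ne_zero hqn (norm_ofReal_mul_lt_one p.1.2.1 p.1.2.2 (norm_tor_div _ _ _))

theorem continuousAt_tform_eigFun (hq : 0 < q) (hq' : q < 1) (ht : 0 < t) (ht' : t < 1) (ρ : ℝ)
    (l k : Ptn) : ContinuousAt
      (fun τ : ℝ => tform q τ m (toC (eigFun ρ τ l)) (toC (eigFun ρ τ k))) t := by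
  have h : Continuous fun τ : Set.Ioo (0 : ℝ) 1 =>
      tform q τ m (toC (eigFun ρ τ l)) (toC (eigFun ρ τ k)) := by
    have : LocallyCompactSpace (Set.Ioo (0 : ℝ) 1) := isOpen_Ioo.locallyCompactSpace
    unfold tform
    refine continuous_torusMean (F := fun (τ : Set.Ioo (0 : ℝ) 1) (y : Fin m → ℂ) =>
      pev (toC (eigFun ρ τ l)) y⁻¹ * pev (toC (eigFun ρ τ k)) y * kerDelta q τ y) ?_
    have h1 : Continuous fun p : Set.Ioo (0 : ℝ) 1 × (Fin m → ℝ) => (p.1 : ℝ) :=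
      continuous_subtype_val.comp continuous_fst
    simp only [pev_toC_eigFun, tor_inv]
    exact ((continuous_eval_map _ h1 (continuous_tor.comp continuous_snd.neg)).mul
      (continuous_eval_map _ h1 (continuous_tor.comp continuous_snd))).mul
        (continuous_kerDelta hq hq')
  exact (continuousOn_iff_continuous_domRestrict.2 h).continuousAt (Ioo_mem_nhds ht ht')

theorem macOp_toC_eigFun (q : ℝ) (ht : t ≠ 0) (l : Ptn) :
    macOp (q : ℂ)⁻¹ t (toC (eigFun q⁻¹ t l)) =
      ((eig q⁻¹ t l : ℝ) : ℂ) • toC (eigFun q⁻¹ t l) := by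
  rw [← toC_smul, ← macOp_eigFun _ ht, toC, map_macOp]
  simp

/-- The continuity argument in t again, now for the torus scalar product, whose integrand is jointly
continuous in τ and the angles. -/
theorem tform_eigFun (hq : 0 < q) (hq' : q < 1) (ht : 0 < t) (ht' : t < 1) {l k : Ptn}
    (hlk : l ≠ k) : tform q t m (toC (eigFun q⁻¹ t l)) (toC (eigFun q⁻¹ t k)) = 0 :=
  eq_zero_of_eig_ne ((one_lt_inv₀ hq).2 hq') ht ht' hlk
    (continuousAt_tform_eigFun hq hq' ht ht' q⁻¹ l k) fun τ hτ hτ' hne =>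
      tform_eq_zero_of_eigenvalue_ne hq hq' hτ hτ' (macOp_toC_eigFun q hτ.ne' l)
        (macOp_toC_eigFun q hτ.ne' k) (by exact_mod_cast hne)

theorem tform_macFun (hq : 0 < q) (hq' : q < 1) (ht : 0 < t) (ht' : t < 1) {l k : Ptn}
    (hlk : l ≠ k) : tform q t m (toC (macFun q t l)) (toC (macFun q t k)) = 0 := by
  rw [macFun, macFun, toC_smul, toC_smul, tform_smul_left, tform_smul_right,
    tform_eigFun hq hq' ht ht' hlk, mul_zero, mul_zero]

theorem tor_inv_eq_conj (θ : Fin m → ℝ) (j : Fin m) :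
    (tor θ j)⁻¹ = (starRingEnd ℂ) (tor θ j) := by
  rw [tor, ← Complex.exp_neg, ← Complex.exp_conj]
  simp

theorem pev_toC_inv (F : MvPolynomial ℕ ℝ) (θ : Fin m → ℝ) :
    pev (toC F) (tor θ)⁻¹ = (starRingEnd ℂ) (pev (toC F) (tor θ)) := by
  have h : (tor θ)⁻¹ = Complex.conjAe ∘ tor θ := by
    ext j
    exact tor_inv_eq_conj θ j
  rw [pev_toC, pev_toC, h]
  exact (comp_aeval_apply (tor θ) Complex.conjAe.toAlgHom (ev ℝ m F)).symm

/-- On the torus the factors for (k, l) and (l, k) are complex conjugates. -/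
theorem kerDelta_tor (hq : 0 < q) (hq' : q < 1) (θ : Fin m → ℝ) :
    kerDelta q t (tor θ) = ((∏ k, ∏ l ∈ Finset.Ioi k, Complex.normSq
      (qPoch (tor θ l / tor θ k) q / qPoch (t * (tor θ l / tor θ k)) q) : ℝ) : ℂ) := by
  have hqn := norm_ofReal_lt_one hq hq'
  rw [kerDelta_eq_prod, Complex.ofReal_prod]
  refine Finset.prod_congr rfl fun k _ => ?_
  rw [Complex.ofReal_prod]
  refine Finset.prod_congr rfl fun l _ => ?_
  have h : tor θ k / tor θ l = (starRingEnd ℂ) (tor θ l / tor θ k) := by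
    rw [map_div₀, ← tor_inv_eq_conj, ← tor_inv_eq_conj, inv_div_inv]
  rw [← Complex.mul_conj, map_div₀, conj_qPoch hqn, conj_qPoch hqn, map_mul, Complex.conj_ofReal,
    ← h]

theorem qPoch_ne_zero_of_ne_one (hq : 0 < q) (hq' : q < 1) {u : ℂ} (hu : ‖u‖ = 1) (hu' : u ≠ 1) :
    qPoch u q ≠ 0 := by
  rw [qPoch_eq_mul (norm_ofReal_lt_one hq hq')]
  exact mul_ne_zero (sub_ne_zero.2 hu'.symm)
    (qPoch_ne_zero (norm_ofReal_lt_one hq hq') (norm_ofReal_mul_lt_one hq hq' hu))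

/-- The function |F|² Δ is continuous and nonnegative with integral zero, so it vanishes on the open
cube of angles. Since Δ = 0 only where two coordinates coincide, F times the Vandermonde product
vanishes on a product of infinite sets and is the zero polynomial. -/
theorem ev_eq_zero_of_tform_self_eq_zero (hq : 0 < q) (hq' : q < 1) (ht : 0 < t) (ht' : t < 1)
    {F : MvPolynomial ℕ ℝ} (h : tform q t m (toC F) (toC F) = 0) : ev ℂ m (toC F) = 0 := by
  have hqn := norm_ofReal_lt_one hq hq'
  set g : (Fin m → ℝ) → ℝ := fun θ => Complex.normSq (pev (toC F) (tor θ)) *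
    ∏ k, ∏ l ∈ Finset.Ioi k, Complex.normSq
      (qPoch (tor θ l / tor θ k) q / qPoch (t * (tor θ l / tor θ k)) q) with hg
  have hF : ∀ θ : Fin m → ℝ, pev (toC F) (tor θ)⁻¹ * pev (toC F) (tor θ) * kerDelta q t (tor θ) =
      g θ := by
    intro θ
    rw [pev_toC_inv, mul_comm ((starRingEnd ℂ) _), Complex.mul_conj, kerDelta_tor hq hq', hg,
      Complex.ofReal_mul]
  have hgc : Continuous g := by
    have h1 := Complex.continuous_re.comp (continuous_tform_tor (m := m) hq hq' ht ht' (toC F)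
      (toC F))
    refine h1.congr fun θ => ?_
    rw [Function.comp_apply, hF, Complex.ofReal_re]
  have hg0 : ∀ θ, 0 ≤ g θ := fun θ => mul_nonneg (Complex.normSq_nonneg _)
    (Finset.prod_nonneg fun k _ => Finset.prod_nonneg fun l _ => Complex.normSq_nonneg _)
  have hzero : ∀ θ : Fin m → ℝ, (∀ j, θ j ∈ Set.Ioo 0 (2 * Real.pi)) →
      pev (toC F) (tor θ) * pairProd 1 (tor θ) = 0 := by
    intro θ hθ
    have h1 := eq_zero_of_torusMean_eq_zero hgc hg0 hF h hθ
    rw [hg] at h1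
    rcases mul_eq_zero.1 h1 with h2 | h2
    · rw [Complex.normSq_eq_zero.1 h2, zero_mul]
    · obtain ⟨k, _, h3⟩ := Finset.prod_eq_zero_iff.1 h2
      obtain ⟨l, hl, h4⟩ := Finset.prod_eq_zero_iff.1 h3
      have h5 : qPoch (tor θ l / tor θ k) q = 0 := by
        refine (div_eq_zero_iff.1 (Complex.normSq_eq_zero.1 h4)).resolve_right ?_
        exact qPoch_ne_zero hqn (norm_ofReal_mul_lt_one ht ht' (norm_tor_div _ _ _))
      have h6 : tor θ l / tor θ k = 1 := by
        by_contra h6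
        exact qPoch_ne_zero_of_ne_one hq hq' (norm_tor_div _ _ _) h6 h5
      have h7 : tor θ l = tor θ k := (div_eq_one_iff_eq (Complex.exp_ne_zero _)).1 h6
      have h8 : pairProd 1 (tor θ) = 0 := by
        refine Finset.prod_eq_zero (Finset.mem_univ k) (Finset.prod_eq_zero hl ?_)
        rw [h7, Pi.one_apply, Pi.one_apply, sub_self]
      rw [h8, mul_zero]
  have hinf : (Set.image (fun x : ℝ => Complex.exp (x * Complex.I))
      (Set.Ioo 0 (2 * Real.pi))).Infinite := by
    refine (Set.Ioo_infinite Real.two_pi_pos).image fun x hx y hy hxy => ?_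
    exact Circle.exp_injOn_Ico (a := 0) (b := 2 * Real.pi) (by simp) ⟨hx.1.le, hx.2⟩
      ⟨hy.1.le, hy.2⟩ (Circle.ext hxy)
  have hpoly : ev ℂ m (toC F) * vand ℂ m = 0 := by
    refine funext_set (fun _ => Set.image (fun x : ℝ => Complex.exp (x * Complex.I))
      (Set.Ioo 0 (2 * Real.pi))) (fun _ => hinf) fun y hy => ?_
    have h1 : ∀ j, ∃ x : ℝ, x ∈ Set.Ioo 0 (2 * Real.pi) ∧ Complex.exp (x * Complex.I) = y j :=
      fun j => hy j (Set.mem_univ j)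
    choose θ hθ hθ' using h1
    have h2 : y = tor θ := funext fun j => (hθ' j).symm
    have h3 : eval y (vand ℂ m) = pairProd 1 y := by
      rw [vand, map_pairProd]
      congr 1
      · ext j
        simp
      · ext j
        simp
    rw [map_mul, map_zero, h3, h2]
    exact hzero θ hθ
  exact (mul_eq_zero.1 hpoly).resolve_right vand_ne_zero

/-- With at least ℓ(l) variables the monomial x^l is present and has coefficient 1, so P_l does not
vanish. -/
theorem tform_macFun_self_ne_zero (hq : 0 < q) (hq' : q < 1) (ht : 0 < t) (ht' : t < 1) {l : Ptn}
    (hl : l.length ≤ m) : tform q t m (toC (macFun q t l)) (toC (macFun q t l)) ≠ 0 := by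
  intro h
  have h1 := ev_eq_zero_of_tform_self_eq_zero hq hq' ht ht' h
  have h2 := (isTriangular_macFun_real hq hq' ht ht').monomialCoeff_self l
  rw [monomialCoeff_eq_coeff _ l (l.shape_expo hl)] at h2
  have h3 := congrArg (coeff (l.expo m)) h1
  rw [toC, map_ev, coeff_map, h2] at h3
  simp at h3

end TorusOrthogonal

end MacSym
end

/-! ### Convergence of exponential series and expansion of the Cauchy kernel. -/

noncomputable section

namespace MacSym

open Filter Topology

/-! ### Convergence of exponential series -/

section ExpSeries

theorem exists_analytic_of_geometric_bound {a : ℕ → ℂ} {M θ : ℝ} (hθ : 0 < θ)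
    (ha : ∀ r, ‖a r‖ ≤ M * θ ^ r) : ∃ A : ℂ → ℂ, DifferentiableOn ℂ A (Metric.ball 0 θ⁻¹) ∧
      ∀ n, iteratedDeriv n A 0 = n.factorial * a n := by
  set p := FormalMultilinearSeries.ofScalars ℂ a
  set R : NNReal := ⟨θ⁻¹, (inv_pos.2 hθ).le⟩
  have hR : (R : ENNReal) ≤ p.radius := by
    refine p.le_radius_of_bound M fun n => ?_
    rw [FormalMultilinearSeries.ofScalars_norm]
    change ‖a n‖ * θ⁻¹ ^ n ≤ M
    rw [inv_pow, ← div_eq_mul_inv, div_le_iff₀ (pow_pos hθ n)]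
    exact ha n
  have hR0 : (0 : ENNReal) < R := ENNReal.coe_pos.2 (inv_pos.2 hθ)
  have h := (p.hasFPowerSeriesOnBall (hR0.trans_le hR)).mono hR0 hR
  refine ⟨p.sum, ?_, fun n => ?_⟩
  · have h1 := h.differentiableOn
    rwa [Metric.eball_coe] at h1
  · have h1 := h.factorial_smul 1 n
    rw [iteratedDeriv_eq_iteratedFDeriv, ← h1]
    simp [p, FormalMultilinearSeries.ofScalars]

/-- Let A = ∑ a_r z^r, analytic for |z| < 1/θ, and B its primitive with B(0) = 0. Then exp B solves
f' = A f, so its Taylor coefficients obey the recursion of `expCoeff`. Both series are evaluated at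
z = 1, inside the disc because θ < 1. -/
theorem hasSum_expCoeff {a : ℕ → ℂ} {M θ : ℝ} (hθ : 0 < θ) (hθ' : θ < 1)
    (ha : ∀ r, ‖a r‖ ≤ M * θ ^ r) : ∃ S, HasSum (fun r : ℕ => a r / (r + 1)) S ∧
      HasSum (expCoeff a) (Complex.exp S) := by
  obtain ⟨A, hA, hA'⟩ := exists_analytic_of_geometric_bound hθ ha
  obtain ⟨B, hB0, hB⟩ := hA.isExactOn_ball.with_val_at 0 0
  have hU : IsOpen (Metric.ball (0 : ℂ) θ⁻¹) := Metric.isOpen_ball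
  have h0 : (0 : ℂ) ∈ Metric.ball (0 : ℂ) θ⁻¹ := Metric.mem_ball_self (inv_pos.2 hθ)
  have h1 : (1 : ℂ) ∈ Metric.ball (0 : ℂ) θ⁻¹ := by
    rw [mem_ball_zero_iff, norm_one]
    exact (one_lt_inv₀ hθ).2 hθ'
  have hBd : DifferentiableOn ℂ B (Metric.ball 0 θ⁻¹) := fun z hz =>
    (hB z hz).differentiableAt.differentiableWithinAt
  have hfac : ∀ n : ℕ, (n.factorial : ℂ) ≠ 0 := fun n => Nat.cast_ne_zero.2 n.factorial_ne_zero
  refine ⟨B 1, ?_, ?_⟩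
  · have h2 := Complex.hasSum_taylorSeries_on_ball hBd h1
    rw [← hasSum_nat_add_iff' 1] at h2
    simp only [Finset.range_one, Finset.sum_singleton, sub_zero, one_pow, one_smul,
      iteratedDeriv_zero, hB0, smul_zero] at h2
    refine h2.congr_fun fun n => ?_
    have h3 : deriv B =ᶠ[𝓝 0] A := by
      filter_upwards [hU.mem_nhds h0] with z hz
      exact (hB z hz).deriv
    rw [iteratedDeriv_succ', h3.iteratedDeriv_eq, hA', Nat.factorial_succ, smul_eq_mul]
    have := hfac n
    have h4 : ((n : ℂ) + 1) ≠ 0 := Nat.cast_add_one_ne_zero n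
    push_cast
    field_simp
  · set f : ℂ → ℂ := fun z => Complex.exp (B z) with hf
    have hfd : DifferentiableOn ℂ f (Metric.ball 0 θ⁻¹) := hBd.cexp
    have h2 := Complex.hasSum_taylorSeries_on_ball hfd h1
    have h3 : deriv f =ᶠ[𝓝 0] A * f := by
      filter_upwards [hU.mem_nhds h0] with z hz
      rw [(hB z hz).cexp.deriv, Pi.mul_apply, mul_comm]
    have hy : (fun n : ℕ => (n.factorial : ℂ)⁻¹ * iteratedDeriv n f 0) = expCoeff a := by
      refine eq_expCoeff (by simp [hf, hB0]) fun n => ?_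
      rw [iteratedDeriv_succ', h3.iteratedDeriv_eq, iteratedDeriv_mul
        (hA.analyticAt (hU.mem_nhds h0)).contDiffAt (hfd.analyticAt (hU.mem_nhds h0)).contDiffAt,
        Nat.factorial_succ, Finset.mul_sum, Finset.mul_sum]
      refine Finset.sum_congr rfl fun i hi => ?_
      have hi' : i ≤ n := Nat.lt_succ_iff.1 (Finset.mem_range.1 hi)
      have h4 : ((n : ℂ) + 1) ≠ 0 := Nat.cast_add_one_ne_zero n
      have h5 := hfac n
      have h6 := hfac i
      have h7 := hfac (n - i)
      rw [hA', Nat.cast_choose ℂ hi']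
      push_cast
      field_simp
    rw [← hy]
    refine h2.congr_fun fun n => ?_
    simp

theorem expCoeff_nonneg {α : ℕ → ℝ} (hα : ∀ r, 0 ≤ α r) (d : ℕ) : 0 ≤ expCoeff α d := by
  induction d using Nat.strong_induction_on with
  | _ d ih =>
    cases d with
    | zero => simp
    | succ d =>
      have h := succ_mul_expCoeff α d
      have h1 : 0 ≤ ((d : ℝ) + 1) * expCoeff α (d + 1) := by
        rw [h]
        exact Finset.sum_nonneg fun r _ => mul_nonneg (hα r) (ih _ (by omega))
      exact nonneg_of_mul_nonneg_right h1 (by positivity)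

/-- Majorant principle: the recursion has nonnegative coefficients. It provides the uniform bound
for interchanging the series with the torus integral. -/
theorem norm_expCoeff_le {a : ℕ → ℂ} {α : ℕ → ℝ} (h : ∀ r, ‖a r‖ ≤ α r) (d : ℕ) :
    ‖expCoeff a d‖ ≤ expCoeff α d := by
  induction d using Nat.strong_induction_on with
  | _ d ih =>
    cases d with
    | zero => simp
    | succ d =>
      have h1 : ((d : ℝ) + 1) * ‖expCoeff a (d + 1)‖ ≤ ((d : ℝ) + 1) * expCoeff α (d + 1) := by
        have h2 : ‖(d : ℂ) + 1‖ = (d : ℝ) + 1 := by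
          rw [← Nat.cast_succ, Complex.norm_natCast, Nat.cast_succ]
        rw [← h2, ← norm_mul, succ_mul_expCoeff, h2, succ_mul_expCoeff]
        refine (norm_sum_le _ _).trans (Finset.sum_le_sum fun r _ => ?_)
        rw [norm_mul]
        exact mul_le_mul (h r) (ih _ (by omega)) (norm_nonneg _) ((norm_nonneg _).trans (h r))
      exact le_of_mul_le_mul_left h1 (by positivity)

theorem summable_expCoeff {M θ : ℝ} (hM : 0 ≤ M) (hθ : 0 < θ) (hθ' : θ < 1) :
    Summable (expCoeff fun r => M * θ ^ r) := by
  obtain ⟨S, _, hS⟩ := hasSum_expCoeff (a := fun r => ((M * θ ^ r : ℝ) : ℂ)) (M := M) hθ hθ'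
    (fun r => by
      rw [Complex.norm_real, Real.norm_of_nonneg (by positivity)])
  have h : ∀ d, expCoeff (fun r => ((M * θ ^ r : ℝ) : ℂ)) d =
      ((expCoeff (fun r => M * θ ^ r) d : ℝ) : ℂ) := fun d =>
    (map_expCoeff Complex.ofRealHom _ d).symm
  exact Complex.summable_ofReal.1 (hS.summable.congr fun d => h d)

end ExpSeries

/-! ### The Cauchy kernel -/

section Kernel

/-- Summability leaves only finitely many |x_i| ≥ 1/2. The bound θ is the geometric rate in the
later estimates. -/
theorem exists_norm_le_of_summable {ι : Type*} {x : ι → ℂ} (hx : ∀ i, ‖x i‖ < 1)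
    (hs : Summable fun i => ‖x i‖) : ∃ θ : ℝ, 0 < θ ∧ θ < 1 ∧ ∀ i, ‖x i‖ ≤ θ := by
  have h1 : ∀ᶠ i in cofinite, ‖x i‖ < 1 / 2 :=
    hs.tendsto_cofinite_zero.eventually (gt_mem_nhds (by norm_num))
  have h2 : ∀ s : Finset ι, ∃ θ : ℝ, 1 / 2 ≤ θ ∧ θ < 1 ∧ ∀ i ∈ s, ‖x i‖ ≤ θ := by
    intro s
    induction s using Finset.cons_induction with
    | empty => exact ⟨1 / 2, le_rfl, by norm_num, by simp⟩
    | cons i s _ ih =>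
      obtain ⟨θ, h3, h4, h5⟩ := ih
      refine ⟨max θ ‖x i‖, h3.trans (le_max_left _ _), max_lt h4 (hx i), fun j hj => ?_⟩
      rcases Finset.mem_cons.1 hj with rfl | hj
      · exact le_max_right _ _
      · exact (h5 j hj).trans (le_max_left _ _)
  obtain ⟨θ, h3, h4, h5⟩ := h2 (Set.Finite.toFinset h1)
  refine ⟨θ, by linarith, h4, fun i => ?_⟩
  by_cases hi : ‖x i‖ < 1 / 2
  · exact hi.le.trans h3
  · exact h5 i ((Set.Finite.mem_toFinset h1).2 hi)

/-- The power sums of a summable family. -/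
def psumC {ι : Type*} (x : ι → ℂ) (r : ℕ) : ℂ := ∑' i, x i ^ (r + 1)

variable {q t : ℝ}

/-- The coefficients of the power sums in the logarithm of the Cauchy kernel. -/
def kerCoeff (q t : ℝ) {ι : Type*} (x : ι → ℂ) (r : ℕ) : ℂ :=
  (1 - (t : ℂ) ^ (r + 1)) / (1 - (q : ℂ) ^ (r + 1)) * psumC x r

theorem norm_kerCoeff_quot_le (hq : 0 < q) (hq' : q < 1) (ht : 0 < t) (ht' : t < 1) (r : ℕ) :
    ‖(1 - (t : ℂ) ^ (r + 1)) / (1 - (q : ℂ) ^ (r + 1))‖ ≤ (1 - q)⁻¹ := by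
  have h : (1 - (t : ℂ) ^ (r + 1)) / (1 - (q : ℂ) ^ (r + 1)) =
      (((1 - t ^ (r + 1)) / (1 - q ^ (r + 1)) : ℝ) : ℂ) := by
    push_cast
    rfl
  have h1 : t ^ (r + 1) ≤ 1 := pow_le_one₀ ht.le ht'.le
  have h2 : q ^ (r + 1) ≤ q := pow_le_of_le_one hq.le hq'.le r.succ_ne_zero
  have h3 : 0 < t ^ (r + 1) := pow_pos ht _
  rw [h, Complex.norm_real, Real.norm_of_nonneg (div_nonneg (by linarith) (by linarith)),
    ← one_div]
  exact div_le_div₀ zero_le_one (by linarith) (by linarith) (by linarith)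

theorem norm_pow_succ_le {z : ℂ} {θ : ℝ} (h : ‖z‖ ≤ θ) (r : ℕ) : ‖z ^ (r + 1)‖ ≤ ‖z‖ * θ ^ r := by
  rw [norm_pow, pow_succ']
  exact mul_le_mul_of_nonneg_left (pow_le_pow_left₀ (norm_nonneg _) h r) (norm_nonneg _)

variable {ι : Type} {m : ℕ}

theorem norm_sum_pow_le {y : Fin m → ℂ} (hy : ∀ j, ‖y j‖ = 1) (r : ℕ) :
    ‖∑ j, y j ^ (r + 1)‖ ≤ m := by
  refine (norm_sum_le _ _).trans ?_
  simp [hy]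

theorem norm_kerCoeff_mul_le (hq : 0 < q) (hq' : q < 1) (ht : 0 < t) (ht' : t < 1) {x : ι → ℂ}
    (hs : Summable fun i => ‖x i‖) {θ : ℝ} (hx : ∀ i, ‖x i‖ ≤ θ) {y : Fin m → ℂ}
    (hy : ∀ j, ‖y j‖ = 1) (r : ℕ) : ‖kerCoeff q t x r * ∑ j, y j ^ (r + 1)‖ ≤
      (1 - q)⁻¹ * (∑' i, ‖x i‖) * m * θ ^ r := by
  have h1 : ‖psumC x r‖ ≤ (∑' i, ‖x i‖) * θ ^ r :=
    tsum_of_norm_bounded (hs.hasSum.mul_right _) fun i => norm_pow_succ_le (hx i) r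
  have h2 := norm_kerCoeff_quot_le hq hq' ht ht' r
  have h3 : 0 ≤ (1 - q)⁻¹ := inv_nonneg.2 (by linarith)
  rw [norm_mul, kerCoeff, norm_mul]
  calc _ ≤ (1 - q)⁻¹ * ((∑' i, ‖x i‖) * θ ^ r) * m := by
        refine mul_le_mul (mul_le_mul h2 h1 (norm_nonneg _) h3) (norm_sum_pow_le hy r)
          (norm_nonneg _) (mul_nonneg h3 ((norm_nonneg _).trans h1))
    _ = _ := by ring

/-- The Cauchy kernel as a series of symmetric functions. -/
theorem hasSum_kerPi (hq : 0 < q) (hq' : q < 1) (ht : 0 < t) (ht' : t < 1) {x : ι → ℂ}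
    (hs : Summable fun i => ‖x i‖) {θ : ℝ} (hθ : 0 < θ) (hθ' : θ < 1) (hx : ∀ i, ‖x i‖ ≤ θ)
    {y : Fin m → ℂ} (hy : ∀ j, ‖y j‖ = 1) :
    HasSum (expCoeff fun r => kerCoeff q t x r * ∑ j, y j ^ (r + 1)) (kerPi q t x y) := by
  obtain ⟨S, hS, hS'⟩ := hasSum_expCoeff hθ hθ' (norm_kerCoeff_mul_le hq hq' ht ht' hs hx hy)
  convert hS'
  set γ : ℕ → ℂ := fun r => (1 - (t : ℂ) ^ (r + 1)) / (1 - (q : ℂ) ^ (r + 1)) with hγ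
  set g : ι × ℕ → ℂ := fun p => γ p.2 * x p.1 ^ (p.2 + 1) * (∑ j, y j ^ (p.2 + 1)) / (p.2 + 1)
    with hg
  have hγ' := norm_kerCoeff_quot_le hq hq' ht ht'
  have h3 : 0 ≤ (1 - q)⁻¹ := inv_nonneg.2 (by linarith)
  -- Absolute convergence in (i, r) permits both orders: summing over i first gives the power sums
  -- of x, summing over r first gives the factors of the product.
  have hsum : Summable g := by
    refine Summable.of_norm_bounded (((hs.mul_of_nonneg
      (summable_geometric_of_lt_one hθ.le hθ') (fun _ => norm_nonneg _)
      (fun _ => pow_nonneg hθ.le _)).mul_left ((1 - q)⁻¹)).mul_right (m : ℝ)) fun p => ?_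
    have h1 : (1 : ℝ) ≤ ‖(p.2 : ℂ) + 1‖ := by
      rw [← Nat.cast_succ, Complex.norm_natCast]
      exact_mod_cast Nat.succ_pos _
    rw [hg, norm_div]
    refine (div_le_self (norm_nonneg _) h1).trans ?_
    rw [norm_mul, norm_mul]
    exact mul_le_mul (mul_le_mul (hγ' _) (norm_pow_succ_le (hx _) _) (norm_nonneg _) h3)
      (norm_sum_pow_le hy _) (norm_nonneg _)
      (mul_nonneg h3 (mul_nonneg (norm_nonneg _) (pow_nonneg hθ.le _)))
  have htot : ∑' p, g p = S := by
    have h1 : HasSum (fun p : ℕ × ι => g p.swap) (∑' p, g p) :=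
      (Equiv.prodComm ℕ ι).hasSum_iff.2 hsum.hasSum
    refine (h1.prod_fiberwise (g := fun r : ℕ => kerCoeff q t x r * (∑ j, y j ^ (r + 1)) / (r + 1))
      fun r => ?_).unique hS
    have h2 : Summable fun i => x i ^ (r + 1) :=
      Summable.of_norm_bounded (hs.mul_right (θ ^ r)) fun i => norm_pow_succ_le (hx i) r
    have h4 := ((h2.hasSum.mul_left (γ r)).mul_right (∑ j, y j ^ (r + 1))).div_const ((r : ℂ) + 1)
    exact h4
  have hfib : ∀ i, ∃ T, HasSum (fun r => g (i, r)) T ∧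
      ∏ j, qPoch (t * (x i * y j)) q / qPoch (x i * y j) q = Complex.exp T := by
    intro i
    have h4 : ∀ j, ∃ T, HasSum (fun r : ℕ => γ r * (x i * y j) ^ (r + 1) / (r + 1)) T ∧
        qPoch (t * (x i * y j)) q / qPoch (x i * y j) q = Complex.exp T := fun j =>
      hasSum_qPoch_div (norm_ofReal_lt_one hq hq') (norm_ofReal_lt_one ht ht').le (by
        rw [norm_mul, hy, mul_one]
        exact (hx i).trans_lt hθ')
    choose T hT hT' using h4
    refine ⟨∑ j, T j, ?_, ?_⟩
    · refine (hasSum_sum fun j _ => hT j).congr_fun fun r => ?_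
      rw [hg, ← Finset.sum_div]
      simp only [Finset.mul_sum, mul_pow, mul_assoc]
    · rw [Complex.exp_sum]
      exact Finset.prod_congr rfl fun j _ => hT' j
  choose T hT hT' using hfib
  have hTsum : HasSum T S := htot ▸ hsum.hasSum.prod_fiberwise hT
  rw [kerPi, ← hTsum.cexp.tprod_eq]
  exact tprod_congr hT'

end Kernel

end MacSym
end

/-! ### Comparison of the two scalar products on the Cauchy kernel, and the integral formula. -/

noncomputable section

namespace MacSym

open MvPolynomial Filter Topology

/-! ### The integral operator with the Cauchy kernel -/

section IntegralOperator

theorem pform_map {R S : Type*} [CommRing R] [CommRing S] (f : R →+* S) (c : ℕ → R)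
    (F G : MvPolynomial ℕ R) :
    pform (fun r => f (c r)) (map f F) (map f G) = f (pform c F G) := by
  rw [pform_eq_sum _ _ _ (support_map_subset f F), pform_eq_sum c F G le_rfl, map_sum]
  refine Finset.sum_congr rfl fun a _ => ?_
  simp [coeff_map, pnorm, Finsupp.prod]

theorem constantCoeff_eval_shift {R : Type*} [CommRing R] (s : ℕ → R) (G : MvPolynomial ℕ R) :
    constantCoeff ((shift s G).eval 1) = eval s G := by
  induction G using MvPolynomial.induction_on with
  | C x => rw [shift_C, Polynomial.eval_C, constantCoeff_C, eval_C]
  | add F G hF hG => rw [map_add, Polynomial.eval_add, map_add, map_add, hF, hG]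
  | mul_X F r hF => simp [hF]

theorem pform_one_left {R : Type*} [CommRing R] (c : ℕ → R) (G : MvPolynomial ℕ R) :
    pform c 1 G = constantCoeff G := by
  have h := pform_monomial c 0 1 G
  rw [monomial_zero', C_1, one_mul] at h
  rw [h]
  simp [pnorm, constantCoeff_eq]

/-- The reproducing property of the kernel. By adjointness, pairing with the exponential is the
constant term of the shifted G, and shifting all p_{r+1} by s_r and then setting them to 0 evaluates
G at s. Only finitely many d contribute. -/
theorem hasSum_pform_expFun {c b s : ℕ → ℂ} (h : ∀ r : ℕ, ((r : ℂ) + 1) * s r = b r * c r)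
    (G : MvPolynomial ℕ ℂ) : HasSum (fun d => pform c (expFun b d) G) (eval s G) := by
  have h1 : ∀ d, pform c (expFun b d) G = constantCoeff ((shift s G).coeff d) := by
    intro d
    have h2 := pform_expFun_mul h d 1 G
    rwa [mul_one, pform_one_left] at h2
  simp only [h1]
  have h2 : eval s G = ∑ d ∈ Finset.range ((shift s G).natDegree + 1),
      constantCoeff ((shift s G).coeff d) := by
    rw [← constantCoeff_eval_shift, Polynomial.eval_eq_sum_range]
    simp
  rw [h2]
  refine hasSum_sum_of_ne_finset_zero fun d hd => ?_
  rw [Polynomial.coeff_eq_zero_of_natDegree_lt (by simpa [Nat.lt_succ_iff] using hd), map_zero]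

variable {m : ℕ}

theorem pev_eq_eval (F : MvPolynomial ℕ ℂ) (y : Fin m → ℂ) :
    pev F y = eval (fun r => ∑ j, y j ^ (r + 1)) F := by
  induction F using MvPolynomial.induction_on with
  | C x => rw [pev, ev_C, eval_C, eval_C]
  | add F G hF hG => rw [pev, map_add, map_add, map_add, ← hF, ← hG, pev, pev]
  | mul_X F r hF =>
    rw [map_mul, ← hF, eval_X, pev, map_mul, map_mul, ev_X, pev]
    simp [psum]

theorem pev_expFun (b : ℕ → ℂ) (d : ℕ) (y : Fin m → ℂ) :
    pev (expFun b d) y = expCoeff (fun r => b r * ∑ j, y j ^ (r + 1)) d := by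
  rw [pev_eq_eval, expFun, map_expCoeff]
  simp

variable {q t : ℝ}

theorem pform_toC (F G : MvPolynomial ℕ ℝ) : pform (fun r => ((cnorm q t r : ℝ) : ℂ)) (toC F)
    (toC G) = ((pform (cnorm q t) F G : ℝ) : ℂ) := pform_map Complex.ofRealHom (cnorm q t) F G

theorem isTriangular_toC {G : Ptn → MvPolynomial ℕ ℝ} (hG : IsTriangular G) :
    IsTriangular fun l => toC (G l) := by
  intro l
  have h : toC (G l) - monoFun ℂ l = toC (G l - monoFun ℝ l) := by
    rw [map_sub, toC, map_monoFun]
  rw [h, mem_monoSpan_iff]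
  intro k hk
  refine mem_monoSpan_iff.1 (hG l) k fun h0 => hk ?_
  rw [toC, monomialCoeff_map, h0, map_zero]

theorem cnorm_ofReal : cnorm (q : ℂ) (t : ℂ) = fun r => ((cnorm q t r : ℝ) : ℂ) := by
  ext r
  simp [cnorm]

/-- The numerator of `coefN` is formed over ℂ, with complexified parameters. By uniqueness the
Macdonald functions there are the complexifications of the real ones. -/
theorem macP_ofReal (hq : 0 < q) (hq' : q < 1) (ht : 0 < t) (ht' : t < 1) (l : Ptn) :
    macP (q : ℂ) (t : ℂ) l = toSymFun ℂ (toC (macFun q t l)) := by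
  refine macP_eq (pnorm_ne_zero fun r => ?_)
    (isTriangular_toC (isTriangular_macFun_real hq hq' ht ht')) (fun l k h => ?_) l
  · rw [cnorm_ofReal, Complex.ofReal_ne_zero]
    exact cnorm_ne_zero (one_sub_pow_succ_ne_zero hq hq') (one_sub_pow_succ_ne_zero ht ht') r
  · rw [cnorm_ofReal, pform_toC, pform_macFun_real hq hq' ht ht' h, Complex.ofReal_zero]

theorem formqt_macP_ofReal (hq : 0 < q) (hq' : q < 1) (ht : 0 < t) (ht' : t < 1) (l : Ptn) :
    formqt (q : ℂ) (t : ℂ) (macP (q : ℂ) (t : ℂ) l) (macP (q : ℂ) (t : ℂ) l) =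
      ((pform (cnorm q t) (macFun q t l) (macFun q t l) : ℝ) : ℂ) := by
  rw [macP_ofReal hq hq' ht ht', formqt_toSymFun, cnorm_ofReal, pform_toC]

theorem tform_add_left (hq : 0 < q) (hq' : q < 1) (ht : 0 < t) (ht' : t < 1)
    (F F' G : MvPolynomial ℕ ℂ) :
    tform q t m (F + F') G = tform q t m F G + tform q t m F' G := by
  rw [tform, tform, tform, ← torusMean_add (continuous_tform_tor hq hq' ht ht' F G)
    (continuous_tform_tor hq hq' ht ht' F' G)]
  congr 1
  ext y
  rw [pev, map_add, map_add, ← pev, ← pev]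
  ring

/-- Both pairings with P_l vanish on every other P_k, and the P_k span, so the two linear
functionals are proportional and F = P_l determines the factor. -/
theorem tform_mul_pform (hq : 0 < q) (hq' : q < 1) (ht : 0 < t) (ht' : t < 1) (l : Ptn)
    (F : MvPolynomial ℕ ℂ) :
    tform q t m F (toC (macFun q t l)) *
        ((pform (cnorm q t) (macFun q t l) (macFun q t l) : ℝ) : ℂ) =
      pform (fun r => ((cnorm q t r : ℝ) : ℂ)) F (toC (macFun q t l)) *
        tform q t m (toC (macFun q t l)) (toC (macFun q t l)) := by
  have hF : F ∈ Submodule.span ℂ (Set.range fun k => toC (macFun q t k)) := by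
    rw [(isTriangular_toC (isTriangular_macFun_real hq hq' ht ht')).span_eq_top]
    trivial
  induction hF using Submodule.span_induction with
  | mem F hF =>
    obtain ⟨k, rfl⟩ := hF
    dsimp only
    rw [pform_toC]
    by_cases h : k = l
    · rw [h, mul_comm]
    · rw [tform_macFun hq hq' ht ht' h, pform_macFun_real hq hq' ht ht' h, zero_mul,
        Complex.ofReal_zero, zero_mul]
  | zero =>
    have h := tform_smul_left (q := q) (t := t) (m := m) 0 0 (toC (macFun q t l))
    rw [zero_smul, zero_mul] at h
    rw [h, map_zero, LinearMap.zero_apply, zero_mul, zero_mul]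
  | add F F' _ _ h1 h2 =>
    rw [tform_add_left hq hq' ht ht', add_mul, h1, h2, map_add, LinearMap.add_apply, add_mul]
  | smul c F _ h1 =>
    rw [tform_smul_left, mul_assoc, h1, map_smul, LinearMap.smul_apply, smul_eq_mul, mul_assoc]

variable {ι : Type} {x : ι → ℂ}

/-- The kernel is expanded into its homogeneous pieces and integrated term by term, so each term is
a torus scalar product. -/
theorem hasSum_mapN (hq : 0 < q) (hq' : q < 1) (ht : 0 < t) (ht' : t < 1)
    (hx : ∀ i, ‖x i‖ < 1) (hs : Summable fun i => ‖x i‖) (F : MvPolynomial ℕ ℝ) :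
    HasSum (fun d => tform q t m (expFun (kerCoeff q t x) d) (toC F))
      (mapN q t (inVars (toSymFun ℝ F) m) x) := by
  obtain ⟨θ, hθ, hθ', hxθ⟩ := exists_norm_le_of_summable hx hs
  have hinv : ∀ {y : Fin m → ℂ}, (∀ j, ‖y j‖ = 1) → ∀ j, ‖y⁻¹ j‖ = 1 := fun hy j => by
    rw [Pi.inv_apply, norm_inv, hy, inv_one]
  have hK : mapN q t (inVars (toSymFun ℝ F) m) x = torusMean fun y : Fin m → ℂ =>
      ∑' d, pev (expFun (kerCoeff q t x) d) y⁻¹ * pev (toC F) y * kerDelta q t y := by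
    rw [mapN]
    refine torusMean_congr fun y hy => ?_
    have h1 : HasSum (fun d => pev (expFun (kerCoeff q t x) d) y⁻¹) (kerPi q t x y⁻¹) :=
      (hasSum_kerPi hq hq' ht ht' hs hθ hθ' hxθ (hinv hy)).congr_fun fun d => pev_expFun _ d _
    rw [((h1.mul_right (pev (toC F) y)).mul_right (kerDelta q t y)).tsum_eq, evalC_inVars]
    change kerPi q t x y⁻¹ * _ * _ = _
    ring
  rw [hK]
  have hcont : Continuous fun θ : Fin m → ℝ => pev (toC F) (tor θ) * kerDelta q t (tor θ) :=
    (continuous_pev_tor _).mul (continuous_kerDelta_tor hq hq' ht ht')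
  obtain ⟨B, hB⟩ := isCompact_cube.exists_bound_of_continuousOn hcont.continuousOn
  set M := (1 - q)⁻¹ * (∑' i, ‖x i‖) * m with hM
  have hM0 : 0 ≤ M := mul_nonneg (mul_nonneg (inv_nonneg.2 (by linarith))
    (tsum_nonneg fun i => norm_nonneg _)) (Nat.cast_nonneg _)
  refine hasSum_torusMean (fun d => continuous_tform_tor hq hq' ht ht' _ _)
    ((summable_expCoeff hM0 hθ hθ').mul_right B) fun d φ hφ => ?_
  rw [mul_assoc, norm_mul, pev_expFun]
  exact mul_le_mul (norm_expCoeff_le (norm_kerCoeff_mul_le hq hq' ht ht' hs hxθ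
    (hinv (norm_tor φ))) d) (hB φ hφ) (norm_nonneg _)
    (expCoeff_nonneg (fun r => mul_nonneg hM0 (pow_nonneg hθ.le r)) d)

theorem evalC_macP (hq : 0 < q) (hq' : q < 1) (ht : 0 < t) (ht' : t < 1) (l : Ptn) {n : ℕ}
    (y : Fin n → ℂ) : evalC (inVars (macP q t l) n) y = pev (toC (macFun q t l)) y := by
  rw [macP_real hq hq' ht ht', evalC_inVars]

/-- Sum the proportionality of the two pairings over the pieces of the kernel. One side gives the
integral times ⟨P_l, P_l⟩_{q,t}, the other P_l(x) times the unnormalized torus norm; the factor m!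
of `coefN` cancels the 1/m! in ⟨,⟩'. -/
theorem coefN_mul_mapN (hq : 0 < q) (hq' : q < 1) (ht : 0 < t) (ht' : t < 1) {l : Ptn}
    (hl : l.length ≤ m) (hx : ∀ i, ‖x i‖ < 1) (hs : Summable fun i => ‖x i‖) :
    coefN q t m l * mapN q t (inVars (macP q t l) m) x =
      eval (psumC x) (toC (macFun q t l)) := by
  set P := macFun q t l
  set c : ℕ → ℂ := fun r => ((cnorm q t r : ℝ) : ℂ)
  set N := ((pform (cnorm q t) P P : ℝ) : ℂ) with hN
  set T := tform q t m (toC P) (toC P) with hT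
  have hN0 : N ≠ 0 := Complex.ofReal_ne_zero.2
    ((isTriangular_macFun_real hq hq' ht ht').pform_self_ne_zero (pnorm_cnorm_ne_zero hq hq' ht ht')
      (fun _ _ h => pform_macFun_real hq hq' ht ht' h) l)
  have hT0 : T ≠ 0 := tform_macFun_self_ne_zero hq hq' ht ht' hl
  have hfac : (m.factorial : ℂ) ≠ 0 := Nat.cast_ne_zero.2 m.factorial_ne_zero
  -- The coefficient (1 - t^r)/(1 - q^r) in log Π is inverse, up to the factor r, to the norm of
  -- p_r; this is why the kernel reproduces.
  have hb : ∀ r : ℕ, ((r : ℂ) + 1) * psumC x r = kerCoeff q t x r * c r := by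
    intro r
    have h1 : (1 - (t : ℂ) ^ (r + 1)) ≠ 0 := by
      exact_mod_cast one_sub_pow_succ_ne_zero ht ht' r
    have h2 : (1 - (q : ℂ) ^ (r + 1)) ≠ 0 := by
      exact_mod_cast one_sub_pow_succ_ne_zero hq hq' r
    simp only [c, cnorm, kerCoeff]
    push_cast
    field_simp
  have h1 := hasSum_mapN (m := m) hq hq' ht ht' hx hs P
  have h2 := (hasSum_pform_expFun hb (toC P)).mul_right T
  have h4 := (h1.mul_right N).unique
    (h2.congr_fun fun d => tform_mul_pform hq hq' ht ht' l (expFun (kerCoeff q t x) d))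
  rw [coefN, formqt_macP_ofReal hq hq' ht ht', macP_real hq hq' ht ht', formTorus_inVars, ← hN, ← hT,
    mul_inv_cancel_left₀ hfac, div_mul_eq_mul_div, div_eq_iff hT0, mul_comm N]
  exact h4

/-- P_l is one fixed polynomial in the power sums, hence continuous in them, and each power sum of a
truncation of x converges. -/
theorem tendsto_evalC_macP (hq : 0 < q) (hq' : q < 1) (ht : 0 < t) (ht' : t < 1) {x : ℕ → ℂ}
    (hx : ∀ i, ‖x i‖ < 1) (hs : Summable fun i => ‖x i‖) (l : Ptn) :
    Tendsto (fun n : ℕ => evalC (inVars (macP q t l) n) (fun i : Fin n => x i)) atTop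
      (𝓝 (eval (psumC x) (toC (macFun q t l)))) := by
  simp only [evalC_macP hq hq' ht ht', pev_eq_eval]
  refine ((continuous_eval (toC (macFun q t l))).tendsto (psumC x)).comp
    (tendsto_pi_nhds.2 fun r => ?_)
  have h : Summable fun i => x i ^ (r + 1) := Summable.of_norm_bounded hs fun i => by
    rw [norm_pow]
    exact pow_le_of_le_one (norm_nonneg _) (hx i).le r.succ_ne_zero
  have h1 := h.hasSum.tendsto_sum_nat
  simpa only [psumC, ← Fin.sum_univ_eq_sum_range (fun i => x i ^ (r + 1))] using h1

end IntegralOperator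

end MacSym
end

theorem proposition3p1 :
    -- (i) with indeterminate parameters, over the field of rational functions
    (∀ (r s : ℕ) (l : MacSym.Ptn),
      MacSym.inVars (MacSym.macP MacSym.indq MacSym.indt (MacSym.Ptn.rect s r + l)) r =
        MacSym.mapG s r (MacSym.inVars (MacSym.macP MacSym.indq MacSym.indt l) r)) ∧
    ∀ q t : ℝ, 0 < q → q < 1 → 0 < t → t < 1 →
      -- (i) with real parameters
      (∀ (r s : ℕ) (l : MacSym.Ptn),
        MacSym.inVars (MacSym.macP q t (MacSym.Ptn.rect s r + l)) r =
          MacSym.mapG s r (MacSym.inVars (MacSym.macP q t l) r)) ∧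
      -- (ii)
      ∀ (m : ℕ) (l : MacSym.Ptn), l.length ≤ m →
        -- finitely many variables
        (∀ (n : ℕ) (x : Fin n → ℂ), (∀ i, ‖x i‖ < 1) →
          MacSym.evalC (MacSym.inVars (MacSym.macP q t l) n) x =
            MacSym.coefN q t m l * MacSym.mapN q t (MacSym.inVars (MacSym.macP q t l) m) x) ∧
        -- infinitely many variables
        (∀ x : ℕ → ℂ, (∀ i, ‖x i‖ < 1) → (Summable fun i => ‖x i‖) →
          Filter.Tendsto
            (fun n : ℕ => MacSym.evalC (MacSym.inVars (MacSym.macP q t l) n) (fun i : Fin n => x i))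
            Filter.atTop
            (nhds (MacSym.coefN q t m l *
              MacSym.mapN q t (MacSym.inVars (MacSym.macP q t l) m) x))) := by
  refine ⟨MacSym.rect_add_ind, fun q t hq hq' ht ht' => ⟨MacSym.rect_add_real hq hq' ht ht',
    fun m l hl => ⟨fun n x hx => ?_, fun x hx hs => ?_⟩⟩⟩
  · have h : MacSym.psumC x = fun r => ∑ i, x i ^ (r + 1) := funext fun r => tsum_fintype _
    rw [MacSym.coefN_mul_mapN hq hq' ht ht' hl hx Summable.of_finite,
      MacSym.evalC_macP hq hq' ht ht', MacSym.pev_eq_eval, h]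
  · rw [MacSym.coefN_mul_mapN hq hq' ht ht' hl hx hs]
    exact MacSym.tendsto_evalC_macP hq hq' ht ht' hx hs l
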